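/- **Theorem 3.1.** Let $n, r \in \mathbb{N}$, $m \ge 1$, $\nu_1,\dots,\nu_m \in (0,1]$, $\lambda_1,\dots,\lambda_m > 0$, $\beta \in (0,1]$ and $c > 0$. Let ${}_iH^{\nu_j}$ ($1 \le i \le r$, $1 \le j \le m$) be independent stable subordinators, ${}_iH^{\nu_j}$ being of order $\nu_j$, i.e. $\mathbb{E}\,e^{-\mu\, {}_iH^{\nu_j}(t)} = e^{-t\mu^{\nu_j}}$ for $\mu > 0$, and let $\boldsymbol{S}_n^{2\beta}$ be an isotropic stable process in $\mathbb{R}^n$ (starting at $0$, with independent stationary increments and càdlàg paths), independent of them, with $\mathbb{E}\,e^{i\boldsymbol{\xi}\cdot \boldsymbol{S}_n^{2\beta}(t)} = e^{-t\|\boldsymbol{\xi}\|^{2\beta}}$. Put $$\mathfrak{H}_r(t) = \sum_{j=1}^m \lambda_j^{1/\nu_j^r}\; {}_1H^{\nu_j}\big({}_2H^{\nu_j}(\cdots {}_rH^{\nu_j}(t)\cdots)\big), \qquad \mathfrak{L}_r(t) = \inf\{s > 0 : \mathfrak{H}_r(s) \ge t\}.$$ Consider the Cauchy problem $$\sum_{j=1}^m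 \lambda_j \frac{{}^C\partial^{\nu_j^r}}{\partial t^{\nu_j^r}}\, w(\boldsymbol{x},t) = -c^2(-\Delta)^\beta w(\boldsymbol{x},t), \quad \boldsymbol{x} \in \mathbb{R}^n,\ t > 0, \qquad w(\boldsymbol{x},0) = \delta(\boldsymbol{x}),$$ where ${}^C\partial^{\alpha}/\partial t^{\alpha}$ is the Caputo derivative, $\frac{1}{\Gamma(1-\alpha)}\int_0^t (t-s)^{-\alpha} f'(s)\,ds$ for $\alpha \in (0,1)$ and the ordinary derivative for $\alpha = 1$, and $(-\Delta)^\beta$ is the Fourier multiplier with symbol $\|\boldsymbol{\xi}\|^{2\beta}$. A solution is a family $(w_t)_{t \ge 0}$ of probability laws on $\mathbb{R}^n$ with $w_0 = \delta$ such that, for every Schwartz function $\varphi$, the function $t \mapsto \langle w_t, \varphi\rangle$ is continuous on $[0,\infty)$, all the above Caputo derivatives of it exist at every $t > 0$ (for orders $\alpha<1$: it is differentiable on $(0,t)$ and the integral converges absolutely), and $$\sum_{j=1}^m \lambda_j \frac{{}^C\partial^{\nu_j^r}}{\partial t^{\nu_j^r}} \langle w_t, \varphi\rangle = -c^2 \langle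 w_t, (-\Delta)^\beta\varphi\rangle, \qquad t > 0 .$$ Then the law of $\boldsymbol{S}_n^{2\beta}\big(c^2\, \mathfrak{L}_r(t)\big)$, $t \ge 0$, is a solution of this problem, and it is the only one. For $\beta = 1$ the process $\boldsymbol{S}_n^{2}$ is the $n$-dimensional Brownian motion $\boldsymbol{B}_n$ with generator $\Delta$ (the coordinates of $\boldsymbol{B}_n/\sqrt2$ are independent standard Brownian motions), so that the process above becomes the subordinated Brownian motion $\boldsymbol{B}_n\big(c^2\, \mathfrak{L}_r(t)\big)$. -/

import Mathlib

open MeasureTheory ProbabilityTheory Filter Set Topology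
open scoped NNReal SchwartzMap FourierTransform

noncomputable section

/-! ### Caputo (Dzerbayshan-Caputo) derivatives of order `ν ∈ (0, 1]` -/

/-- The Caputo derivative of order `ν ∈ (0, 1]` of `f` at `t > 0`: for `ν < 1` it is
`Γ(1 - ν)⁻¹ ∫₀ᵗ (t - s) ^ (-ν) f'(s) ds`, for `ν = 1` it is the ordinary derivative. -/
def caputoDeriv (ν : ℝ) (f : ℝ → ℂ) (t : ℝ) : ℂ :=
  if ν = 1 then deriv f t
  else ((Real.Gamma (1 - ν))⁻¹ : ℝ) • ∫ s in (0 : ℝ)..t, ((t - s) ^ (-ν) : ℝ) • deriv f s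

/-- The Caputo derivative of order `ν ∈ (0, 1]` of `f` at `t > 0` exists, in the classical sense:
`f'` exists on `(0, t)` and its integral against the kernel converges absolutely (`ν < 1`), or `f`
is differentiable at `t` (`ν = 1`). -/
def HasCaputo (ν : ℝ) (f : ℝ → ℂ) (t : ℝ) : Prop :=
  if ν = 1 then DifferentiableAt ℝ f t
  else (∀ s ∈ Ioo 0 t, DifferentiableAt ℝ f s) ∧
    IntervalIntegrable (fun s => ((t - s) ^ (-ν) : ℝ) • deriv f s) volume 0 t

/-! ### The fractional Laplacian and the Cauchy problem -/

/-- `(-Δ)^β φ`, the Fourier multiplier with symbol `‖ξ‖ ^ (2β)`. Mathlib's Fourier transform has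
the kernel `exp (-2π i ⟪x, ξ⟫)`, hence the symbol reads `(2π ‖ξ‖) ^ (2β)` here. -/
def fracLaplacian {n : ℕ} (β : ℝ) (φ : 𝓢(EuclideanSpace ℝ (Fin n), ℂ)) :
    EuclideanSpace ℝ (Fin n) → ℂ :=
  𝓕⁻ (fun ξ : EuclideanSpace ℝ (Fin n) =>
    (((2 * Real.pi * ‖ξ‖) ^ (2 * β) : ℝ) : ℂ) *
      𝓕 (φ : EuclideanSpace ℝ (Fin n) → ℂ) ξ)

/-- The function `t ↦ ⟨w(·, t), φ⟩` on `t ≥ 0`. -/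
def pairing {n : ℕ} (w : ℝ≥0 → Measure (EuclideanSpace ℝ (Fin n)))
    (φ : 𝓢(EuclideanSpace ℝ (Fin n), ℂ)) (t : ℝ) : ℂ :=
  ∫ x, φ x ∂(w t.toNNReal)

/-- The family of probability laws `w(·, t)`, `t ≥ 0`, on `ℝⁿ` solves
`∑ j, lam j * (Caputo ∂_t ^ (α j)) w = -c² (-Δ)^β w` for `t > 0`, with `w(·, 0) = δ`. In the space
variable the equation is understood in the sense of tempered distributions (against Schwartz
functions); in the time variable it holds classically, at every `t > 0`. -/
structure IsCauchySolution {n m : ℕ} (α lam : Fin m → ℝ) (β c : ℝ)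
    (w : ℝ≥0 → Measure (EuclideanSpace ℝ (Fin n))) : Prop where
  prob : ∀ t, IsProbabilityMeasure (w t)
  initial : w 0 = Measure.dirac 0
  cont : ∀ φ, ContinuousOn (pairing w φ) (Ici 0)
  hasCaputo : ∀ φ, ∀ t : ℝ, 0 < t → ∀ j, HasCaputo (α j) (pairing w φ) t
  eqn : ∀ φ, ∀ t : ℝ, 0 < t →
    ∑ j, (lam j : ℂ) * caputoDeriv (α j) (pairing w φ) t =
      -((c : ℂ) ^ 2) * ∫ x, fracLaplacian β φ x ∂(w t.toNNReal)

/-! ### The processes -/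

section Processes

variable {Ω : Type*} [MeasurableSpace Ω]

/-- `H` is a stable subordinator of order `ν ∈ (0, 1]`: it starts at `0`, has non-decreasing
right-continuous paths and independent increments, and its increments over `[s, t]` have the
Laplace transform `exp (-(t - s) μ ^ ν)`. -/
structure IsStableSubordinator (ν : ℝ) (H : ℝ≥0 → Ω → ℝ≥0) (P : Measure Ω) : Prop where
  measurable : ∀ t, Measurable (H t)
  zero : ∀ᵐ ω ∂P, H 0 ω = 0
  paths : ∀ᵐ ω ∂P, Monotone (fun t => H t ω) ∧
    ∀ t, ContinuousWithinAt (fun s => H s ω) (Ici t) t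
  indep : HasIndepIncrements (fun t ω => (H t ω : ℝ)) P
  laplace : ∀ s t : ℝ≥0, s ≤ t → ∀ μ : ℝ, 0 < μ →
    ∫ ω, Real.exp (-μ * ((H t ω : ℝ) - H s ω)) ∂P = Real.exp (-((t : ℝ) - s) * μ ^ ν)

/-- `S` is an isotropic `2β`-stable process in `ℝⁿ`: it starts at `0`, has càdlàg paths and
independent increments, and its increments over `[s, t]` have the characteristic function
`exp (-(t - s) ‖ξ‖ ^ (2β))`. -/
structure IsIsotropicStable {n : ℕ} (β : ℝ) (S : ℝ≥0 → Ω → EuclideanSpace ℝ (Fin n))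
    (P : Measure Ω) : Prop where
  measurable : ∀ t, Measurable (S t)
  zero : ∀ᵐ ω ∂P, S 0 ω = 0
  paths : ∀ᵐ ω ∂P, ∀ t, ContinuousWithinAt (fun s => S s ω) (Ici t) t ∧
    ∃ l, Tendsto (fun s => S s ω) (𝓝[<] t) (𝓝 l)
  indep : HasIndepIncrements S P
  charFun_eq : ∀ s t : ℝ≥0, s ≤ t → ∀ ξ,
    charFun (P.map (fun ω => S t ω - S s ω)) ξ =
      ((Real.exp (-((t : ℝ) - s) * ‖ξ‖ ^ (2 * β)) : ℝ) : ℂ)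

/-- `B` is the `n`-dimensional Brownian motion with generator `Δ`: the coordinates of `B / √2`
are independent standard Brownian motions. -/
structure IsBrownianLaplace {n : ℕ} (B : ℝ≥0 → Ω → EuclideanSpace ℝ (Fin n))
    (P : Measure Ω) : Prop where
  brownian : ∀ i, IsBrownianReal (fun t ω => (√2)⁻¹ * B t ω i) P
  indep : iIndepFun (fun (i : Fin n) ω (t : ℝ≥0) => B t ω i) P

end Processes

/-- The composition `t ↦ H₁ (H₂ (⋯ (Hᵣ t) ⋯))` of `r` functions. -/
def iterComp : (r : ℕ) → (Fin r → ℝ≥0 → ℝ≥0) → ℝ≥0 → ℝ≥0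
  | 0, _, t => t
  | r + 1, h, t => h 0 (iterComp r (fun i => h i.succ) t)

/-- A path `s ↦ ∑ j, lam j ^ (1 / ν j ^ r) * ₁H_j (₂H_j (⋯ (ᵣH_j s) ⋯))` of the weighted sum of
`r`-fold iterated subordinators; `h j i` is a path of the `i`-th subordinator of order `ν j`. -/
def weightedSum {m r : ℕ} (ν lam : Fin m → ℝ) (h : Fin m → Fin r → ℝ≥0 → ℝ≥0) (s : ℝ≥0) : ℝ :=
  ∑ j, lam j ^ (1 / ν j ^ r) * (iterComp r (h j) s : ℝ)

/-- The inverse (hitting time) `t ↦ inf {s > 0 : f s ≥ t}` of a path `f`. -/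
def inverseProcess (f : ℝ≥0 → ℝ) (t : ℝ≥0) : ℝ≥0 :=
  sInf {s : ℝ≥0 | 0 < s ∧ (t : ℝ) ≤ f s}

/-- The process `W(t) = S (c² 𝔏(t))`, where `𝔏` is the inverse of the weighted sum of the
`r`-fold iterated subordinators `H j i`. -/
def subordinated {Ω : Type*} {n m r : ℕ} (ν lam : Fin m → ℝ) (c : ℝ)
    (S : ℝ≥0 → Ω → EuclideanSpace ℝ (Fin n)) (H : Fin m → Fin r → ℝ≥0 → Ω → ℝ≥0)
    (t : ℝ≥0) (ω : Ω) : EuclideanSpace ℝ (Fin n) :=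
  S ((c ^ 2).toNNReal * inverseProcess (weightedSum ν lam (fun j i s => H j i s ω)) t) ω

end

noncomputable section

/-! ### Uniqueness of the Laplace transform -/

section LaplaceUniqueness

variable {E : Type*} [NormedAddCommGroup E] [NormedSpace ℝ E]

lemma integrable_bdd_smul_of_norm_le_one {α : Type*} [MeasurableSpace α] {μ : Measure α}
    {h : α → E} (hh : Integrable h μ) {c : α → ℝ} (hc : AEStronglyMeasurable c μ) (C : ℝ)
    (hC : ∀ᵐ a ∂μ, ‖c a‖ ≤ C) : Integrable (fun a => c a • h a) μ :=
  hh.bdd_smul C hc hC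

lemma integral_polynomial_exp_smul_eq_zero {h : ℝ → E} (hh : IntegrableOn h (Ioi 0))
    (h0 : ∀ k : ℕ, ∫ t in Ioi (0 : ℝ), Real.exp (-t) ^ k • h t = 0) (p : Polynomial ℝ) :
    IntegrableOn (fun t => p.eval (Real.exp (-t)) • h t) (Ioi 0) ∧
      ∫ t in Ioi (0 : ℝ), p.eval (Real.exp (-t)) • h t = 0 := by
  induction p using Polynomial.induction_on' with
  | add p q hp hq =>
    simp only [Polynomial.eval_add, add_smul]
    exact ⟨hp.1.add hq.1, by rw [integral_add hp.1 hq.1, hp.2, hq.2, add_zero]⟩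
  | monomial k a =>
    simp only [Polynomial.eval_monomial, mul_smul]
    refine ⟨?_, by rw [integral_smul, h0, smul_zero]⟩
    refine Integrable.smul a (integrable_bdd_smul_of_norm_le_one hh
      (by fun_prop : Continuous fun t : ℝ => Real.exp (-t) ^ k).aestronglyMeasurable 1 ?_)
    filter_upwards [ae_restrict_mem measurableSet_Ioi] with t ht
    rw [Real.norm_of_nonneg (by positivity)]
    exact pow_le_one₀ (by positivity) (Real.exp_le_one_iff.2 (by simpa using ht.le))

lemma ae_eq_zero_of_integral_exp_pow_smul_eq_zero [CompleteSpace E] {h : ℝ → E}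
    (hh : IntegrableOn h (Ioi 0))
    (h0 : ∀ k : ℕ, ∫ t in Ioi (0 : ℝ), Real.exp (-t) ^ k • h t = 0) :
    ∀ᵐ t, t ∈ Ioi (0 : ℝ) → h t = 0 := by
  refine isOpen_Ioi.ae_eq_zero_of_integral_contDiff_smul_eq_zero hh.locallyIntegrableOn ?_
  intro g hg hgc hgs
  have hg0 : ∀ t ≤ 0, g t = 0 := fun t ht => by
    by_contra hne
    exact absurd (hgs (subset_tsupport g hne)) (by simpa using ht)
  obtain ⟨R, hR⟩ : ∃ R, ∀ t, R ≤ t → g t = 0 := by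
    obtain ⟨R, hR⟩ := hgc.isCompact.bddAbove
    refine ⟨R + 1, fun t ht => ?_⟩
    by_contra hne
    have := hR (subset_tsupport g hne)
    linarith
  have hψ : ContinuousOn (fun x => g (-Real.log x)) (Icc 0 1) := by
    intro x hx
    rcases hx.1.eq_or_lt with rfl | hx0
    · have : (fun x => g (-Real.log x)) =ᶠ[𝓝[Icc 0 1] 0] fun _ => 0 := by
        have h1 : ∀ᶠ x in 𝓝[Icc (0 : ℝ) 1] 0, x < Real.exp (-R) :=
          nhdsWithin_le_nhds (Iio_mem_nhds (Real.exp_pos _))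
        filter_upwards [h1, self_mem_nhdsWithin] with x hx1 hx2
        rcases hx2.1.eq_or_lt with rfl | hx0
        · simp [hg0]
        · exact hR _ (by
            have := (Real.log_lt_iff_lt_exp hx0).2 hx1
            linarith)
      refine (continuousWithinAt_const (b := (0 : ℝ))).congr_of_eventuallyEq this (by simp [hg0])
    · exact (hg.continuous.continuousAt.comp
        (Real.continuousAt_log hx0.ne').neg).continuousWithinAt
  have hgi : IntegrableOn (fun t => g t • h t) (Ioi 0) := by
    obtain ⟨C, hC⟩ := hgc.exists_bound_of_continuous hg.continuous
    exact integrable_bdd_smul_of_norm_le_one hh hg.continuous.aestronglyMeasurable C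
      (Eventually.of_forall hC)
  have key : ∫ t in Ioi (0 : ℝ), g t • h t = 0 := by
    rw [← norm_le_zero_iff]
    refine le_of_forall_pos_le_add fun ε hε => ?_
    set I := ∫ t in Ioi (0 : ℝ), ‖h t‖ with hI
    have hI0 : 0 ≤ I := integral_nonneg fun _ => norm_nonneg _
    obtain ⟨p, hp⟩ := exists_polynomial_near_of_continuousOn 0 1 _ hψ (ε / (I + 1)) (by positivity)
    obtain ⟨hp1, hp2⟩ := integral_polynomial_exp_smul_eq_zero hh h0 p
    have : ∫ t in Ioi (0 : ℝ), g t • h t =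
        ∫ t in Ioi (0 : ℝ), (g t • h t - p.eval (Real.exp (-t)) • h t) := by
      rw [integral_sub hgi hp1, hp2, sub_zero]
    rw [this, zero_add]
    calc _ ≤ ∫ t in Ioi (0 : ℝ), (ε / (I + 1)) * ‖h t‖ := by
          refine norm_integral_le_of_norm_le (hh.norm.const_mul _) ?_
          filter_upwards [ae_restrict_mem measurableSet_Ioi] with t ht
          rw [← sub_smul, norm_smul]
          gcongr
          have := hp (Real.exp (-t)) ⟨by positivity, Real.exp_le_one_iff.2 (by simpa using ht.le)⟩
          rw [Real.log_exp, neg_neg] at this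
          rw [← norm_neg, neg_sub]
          exact this.le
      _ = ε * (I / (I + 1)) := by rw [integral_const_mul]; ring
      _ ≤ ε * 1 := by gcongr; rw [div_le_one (by positivity)]; linarith
      _ = ε := mul_one _
  rw [← key, ← integral_indicator measurableSet_Ioi]
  congr 1
  ext t
  by_cases ht : t ∈ Ioi (0 : ℝ)
  · rw [indicator_of_mem ht]
  · rw [indicator_of_notMem ht, hg0 t (by simpa using ht), zero_smul]

/-- A function whose Laplace transform vanishes on a half-line `[a, ∞)` is zero a.e. -/
theorem ae_eq_zero_of_laplace_eq_zero [CompleteSpace E] {f : ℝ → E} {a : ℝ}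
    (hf : IntegrableOn (fun t => Real.exp (-a * t) • f t) (Ioi 0))
    (h0 : ∀ μ, a ≤ μ → ∫ t in Ioi (0 : ℝ), Real.exp (-μ * t) • f t = 0) :
    ∀ᵐ t, t ∈ Ioi (0 : ℝ) → f t = 0 := by
  have := ae_eq_zero_of_integral_exp_pow_smul_eq_zero hf fun k => by
    rw [← h0 (a + k) (by simp)]
    congr 1
    ext t
    rw [smul_smul, ← Real.exp_nat_mul, ← Real.exp_add]
    congr 2
    ring
  filter_upwards [this] with t ht h
  simpa [(Real.exp_pos _).ne'] using ht h

end LaplaceUniqueness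

/-! ### Power kernels -/

/-- The kernel `t ↦ t ^ (b - 1) / Γ(b)` of the fractional integral of order `b`. -/
def powKer (b t : ℝ) : ℝ := if 0 < t then t ^ (b - 1) / Real.Gamma b else 0

lemma powKer_of_pos (b : ℝ) {t : ℝ} (ht : 0 < t) :
    powKer b t = t ^ (b - 1) / Real.Gamma b := if_pos ht

lemma powKer_of_nonpos (b : ℝ) {t : ℝ} (ht : t ≤ 0) : powKer b t = 0 := if_neg ht.not_gt

lemma powKer_nonneg {b : ℝ} (hb : 0 < b) (t : ℝ) : 0 ≤ powKer b t := by
  unfold powKer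
  split_ifs with h
  · exact div_nonneg (Real.rpow_nonneg h.le _) (Real.Gamma_pos_of_pos hb).le
  · rfl

@[fun_prop]
lemma measurable_powKer (b : ℝ) : Measurable (powKer b) :=
  Measurable.ite measurableSet_Ioi (by fun_prop) measurable_const

lemma continuousOn_powKer (b : ℝ) : ContinuousOn (powKer b) (Ioi 0) := by
  have : ContinuousOn (fun t : ℝ => t ^ (b - 1) / Real.Gamma b) (Ioi 0) :=
    ContinuousOn.div_const (fun t ht =>
      (Real.continuousAt_rpow_const t _ (Or.inl (ne_of_gt ht))).continuousWithinAt) _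
  exact this.congr fun t ht => powKer_of_pos b ht

lemma exp_neg_mul_rpow_le_Gamma {b R : ℝ} (hb : 0 < b) (hR : 0 < R) :
    Real.exp (-R) * R ^ b ≤ Real.Gamma (b + 1) := by
  have hi := Real.GammaIntegral_convergent (s := b + 1) (by linarith)
  rw [Real.Gamma_eq_integral (by linarith)]
  have h1 : ∫ x in Ioi R, Real.exp (-x) * R ^ b = Real.exp (-R) * R ^ b := by
    rw [integral_mul_const, integral_exp_neg_Ioi]
  rw [← h1]
  calc _ ≤ ∫ x in Ioi R, Real.exp (-x) * x ^ (b + 1 - 1) := by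
        refine setIntegral_mono_on ?_ (hi.mono_set (Ioi_subset_Ioi hR.le)) measurableSet_Ioi ?_
        · exact (integrableOn_exp_neg_Ioi R).mul_const _
        · intro x hx
          rw [add_sub_cancel_right]
          gcongr
          exact le_of_lt hx
    _ ≤ _ := setIntegral_mono_set hi (by
        filter_upwards [ae_restrict_mem measurableSet_Ioi] with x hx
        exact mul_nonneg (Real.exp_pos _).le (Real.rpow_nonneg (le_of_lt hx) _))
        (Ioi_subset_Ioi hR.le).eventuallyLE

lemma powKer_le {b t R : ℝ} (hb : 0 < b) (ht : 0 < t) (hR : 0 < R) :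
    powKer b t ≤ Real.exp R / t * (Real.exp 1 * t / R) ^ b := by
  have hΓ := exp_neg_mul_rpow_le_Gamma hb hR
  have hΓ0 := Real.Gamma_pos_of_pos hb
  rw [Real.Gamma_add_one hb.ne'] at hΓ
  rw [powKer_of_pos b ht, Real.rpow_sub_one ht.ne', Real.div_rpow (by positivity) hR.le,
    Real.mul_rpow (by positivity) ht.le, ← Real.exp_mul, one_mul, div_div, div_mul_div_comm,
    div_le_div_iff₀ (by positivity) (by positivity)]
  have hRb : R ^ b ≤ Real.exp R * (b * Real.Gamma b) := by
    have := mul_le_mul_of_nonneg_left hΓ (Real.exp_pos R).le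
    rwa [← mul_assoc, ← Real.exp_add, add_neg_cancel, Real.exp_zero, one_mul] at this
  have hbe : b ≤ Real.exp b := by linarith [Real.add_one_le_exp b]
  have : R ^ b ≤ Real.exp R * (Real.exp b * Real.Gamma b) := hRb.trans (by gcongr)
  have h2 : 0 ≤ t ^ b * t := by positivity
  nlinarith [mul_le_mul_of_nonneg_left this h2]

lemma integral_sub_rpow_mul_rpow {a b t : ℝ} (ha : 0 < a) (hb : 0 < b) (ht : 0 < t) :
    ∫ s in (0 : ℝ)..t, (t - s) ^ (a - 1) * s ^ (b - 1) =
      t ^ (a + b - 1) * (Real.Gamma a * Real.Gamma b / Real.Gamma (a + b)) := by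
  have h1 := Complex.betaIntegral_scaled (b : ℂ) (a : ℂ) ht
  have h2 := Complex.Gamma_mul_Gamma_eq_betaIntegral (s := (b : ℂ)) (t := (a : ℂ))
    (by simpa) (by simpa)
  have h3 : Complex.betaIntegral (b : ℂ) a =
      ((Real.Gamma a * Real.Gamma b / Real.Gamma (a + b) : ℝ) : ℂ) := by
    have h4 : (Real.Gamma (a + b) : ℂ) ≠ 0 := by
      exact_mod_cast (Real.Gamma_pos_of_pos (add_pos ha hb)).ne'
    rw [← Complex.ofReal_add, Complex.Gamma_ofReal, Complex.Gamma_ofReal, Complex.Gamma_ofReal,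
      add_comm b a] at h2
    push_cast
    rw [eq_div_iff h4, mul_comm _ (Real.Gamma (a + b) : ℂ), ← h2, mul_comm]
  rw [h3] at h1
  have h5 : ∫ s in (0 : ℝ)..t, (s : ℂ) ^ ((b : ℂ) - 1) * ((t : ℂ) - s) ^ ((a : ℂ) - 1) =
      ((∫ s in (0 : ℝ)..t, (t - s) ^ (a - 1) * s ^ (b - 1) : ℝ) : ℂ) := by
    rw [← intervalIntegral.integral_ofReal, intervalIntegral.integral_of_le ht.le,
      intervalIntegral.integral_of_le ht.le]
    refine setIntegral_congr_fun measurableSet_Ioc fun s hs => ?_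
    rw [Complex.ofReal_mul, Complex.ofReal_cpow (by linarith [hs.2]),
      Complex.ofReal_cpow hs.1.le]
    push_cast
    ring
  rw [h5] at h1
  have h6 : (t : ℂ) ^ ((b : ℂ) + a - 1) = ((t ^ (a + b - 1) : ℝ) : ℂ) := by
    rw [Complex.ofReal_cpow ht.le]
    push_cast
    ring_nf
  rw [h6] at h1
  exact_mod_cast h1

lemma integral_powKer_mul_powKer {a b t : ℝ} (ha : 0 < a) (hb : 0 < b) (ht : 0 < t) :
    ∫ s in (0 : ℝ)..t, powKer a (t - s) * powKer b s = powKer (a + b) t := by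
  have ha' := Real.Gamma_pos_of_pos ha
  have hb' := Real.Gamma_pos_of_pos hb
  have h : ∫ s in (0 : ℝ)..t, powKer a (t - s) * powKer b s =
      ∫ s in (0 : ℝ)..t, ((t - s) ^ (a - 1) * s ^ (b - 1)) *
        (Real.Gamma a * Real.Gamma b)⁻¹ := by
    rw [intervalIntegral.integral_of_le ht.le, intervalIntegral.integral_of_le ht.le,
      integral_Ioc_eq_integral_Ioo, integral_Ioc_eq_integral_Ioo]
    refine setIntegral_congr_fun measurableSet_Ioo fun s hs => ?_
    rw [powKer_of_pos _ (sub_pos.2 hs.2), powKer_of_pos _ hs.1]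
    field_simp
  rw [h, intervalIntegral.integral_mul_const, integral_sub_rpow_mul_rpow ha hb ht,
    powKer_of_pos _ ht]
  field_simp

lemma powKer_pos {b t : ℝ} (hb : 0 < b) (ht : 0 < t) : 0 < powKer b t := by
  rw [powKer_of_pos _ ht]
  exact div_pos (Real.rpow_pos_of_pos ht _) (Real.Gamma_pos_of_pos hb)

lemma intervalIntegrable_powKer_mul_powKer {a b t : ℝ} (ha : 0 < a) (hb : 0 < b) (ht : 0 < t) :
    IntervalIntegrable (fun s => powKer a (t - s) * powKer b s) volume 0 t := by
  by_contra h
  have := intervalIntegral.integral_undef h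
  rw [integral_powKer_mul_powKer ha hb ht] at this
  exact (powKer_pos (add_pos ha hb) ht).ne' this

lemma integral_exp_mul_powKer {b μ : ℝ} (hb : 0 < b) (hμ : 0 < μ) :
    ∫ t in Ioi (0 : ℝ), Real.exp (-μ * t) * powKer b t = μ ^ (-b) := by
  have h : ∫ t in Ioi (0 : ℝ), Real.exp (-μ * t) * powKer b t =
      ∫ t in Ioi (0 : ℝ), (t ^ (b - 1) * Real.exp (-(μ * t))) * (Real.Gamma b)⁻¹ := by
    refine setIntegral_congr_fun measurableSet_Ioi fun t ht => ?_
    rw [powKer_of_pos _ ht]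
    ring_nf
  rw [h, integral_mul_const, Real.integral_rpow_mul_exp_neg_mul_Ioi hb hμ, mul_assoc,
    mul_inv_cancel₀ (Real.Gamma_pos_of_pos hb).ne', mul_one, one_div, Real.inv_rpow hμ.le,
    Real.rpow_neg hμ.le]

lemma integrableOn_exp_mul_powKer {b μ : ℝ} (hb : 0 < b) (hμ : 0 < μ) :
    IntegrableOn (fun t => Real.exp (-μ * t) * powKer b t) (Ioi 0) := by
  by_contra h
  have := integral_undef h
  rw [integral_exp_mul_powKer hb hμ] at this
  exact (Real.rpow_pos_of_pos hμ _).ne' this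

lemma powKer_one {t : ℝ} (ht : 0 < t) : powKer 1 t = 1 := by
  simp [powKer_of_pos _ ht]

/-! ### The resolvent series -/

section Series

variable {ι : Type*} [Fintype ι]

/-- The `k`-fold convolution power of `K = ∑ i, c i • powKer (a i)`, convolved with `powKer b`. -/
def convPow (c a : ι → ℝ) : ℕ → ℝ → ℝ → ℝ
  | 0, b, t => powKer b t
  | k + 1, b, t => ∑ i, c i * convPow c a k (b + a i) t

/-- The solution `powKer b - K * powKer b + K * K * powKer b - ⋯` of the Volterra equation
`u + K * u = powKer b`, where `K = ∑ i, c i • powKer (a i)`. -/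
def resolventSeries (c a : ι → ℝ) (b t : ℝ) : ℝ := ∑' k : ℕ, (-1) ^ k * convPow c a k b t

variable {c a : ι → ℝ}

lemma convPow_nonneg (hc : ∀ i, 0 ≤ c i) (ha : ∀ i, 0 < a i) (k : ℕ) {b : ℝ} (hb : 0 < b)
    (t : ℝ) : 0 ≤ convPow c a k b t := by
  induction k generalizing b with
  | zero => exact powKer_nonneg hb t
  | succ k ih => exact Finset.sum_nonneg fun i _ => mul_nonneg (hc i) (ih (add_pos hb (ha i)))

lemma convPow_of_nonpos (c a : ι → ℝ) (k : ℕ) (b : ℝ) {t : ℝ} (ht : t ≤ 0) :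
    convPow c a k b t = 0 := by
  induction k generalizing b with
  | zero => exact powKer_of_nonpos b ht
  | succ k ih => simp [convPow, ih]

lemma measurable_convPow (a : ι → ℝ) (k : ℕ) (b : ℝ) :
    Measurable fun p : (ι → ℝ) × ℝ => convPow p.1 a k b p.2 := by
  induction k generalizing b with
  | zero => exact (measurable_powKer b).comp measurable_snd
  | succ k ih =>
    exact Finset.measurable_sum _ fun i _ =>
      ((measurable_pi_apply i).comp measurable_fst).mul (ih (b + a i))

lemma continuousOn_convPow (c a : ι → ℝ) (k : ℕ) (b : ℝ) :
    ContinuousOn (convPow c a k b) (Ioi 0) := by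
  induction k generalizing b with
  | zero => exact continuousOn_powKer b
  | succ k ih => exact continuousOn_finsetSum _ fun i _ => continuousOn_const.mul (ih _)

lemma convPow_le_of_le (hc : ∀ i, 0 ≤ c i) (ha : ∀ i, 0 < a i) {c' : ι → ℝ}
    (hcc : ∀ i, c i ≤ c' i) (k : ℕ) {b : ℝ} (hb : 0 < b) (t : ℝ) :
    convPow c a k b t ≤ convPow c' a k b t := by
  induction k generalizing b with
  | zero => rfl
  | succ k ih =>
    exact Finset.sum_le_sum fun i _ => mul_le_mul (hcc i) (ih (add_pos hb (ha i)))
      (convPow_nonneg hc ha k (add_pos hb (ha i)) t) ((hc i).trans (hcc i))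

lemma convPow_le_geometric (hc : ∀ i, 0 ≤ c i) (ha : ∀ i, 0 < a i) {R t : ℝ} (hR : 0 < R)
    (ht : 0 < t) (k : ℕ) {b : ℝ} (hb : 0 < b) :
    convPow c a k b t ≤ Real.exp R / t * (Real.exp 1 * t / R) ^ b *
      (∑ i, c i * (Real.exp 1 * t / R) ^ a i) ^ k := by
  set q := Real.exp 1 * t / R with hq
  have hq0 : 0 < q := by positivity
  induction k generalizing b with
  | zero => simpa [convPow] using powKer_le hb ht hR
  | succ k ih =>
    calc convPow c a (k + 1) b t
        ≤ ∑ i, c i * (Real.exp R / t * q ^ (b + a i) * (∑ i, c i * q ^ a i) ^ k) :=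
          Finset.sum_le_sum fun i _ =>
            mul_le_mul_of_nonneg_left (ih (add_pos hb (ha i))) (hc i)
      _ = _ := by
          rw [pow_succ, ← mul_assoc, Finset.mul_sum]
          refine Finset.sum_congr rfl fun i _ => ?_
          rw [Real.rpow_add hq0]
          ring

lemma tendsto_sum_mul_rpow_nhdsGT_zero (c : ι → ℝ) (ha : ∀ i, 0 < a i) :
    Tendsto (fun q : ℝ => ∑ i, c i * q ^ a i) (𝓝[>] 0) (𝓝 0) := by
  have h : ∀ i ∈ Finset.univ, Tendsto (fun q : ℝ => c i * q ^ a i) (𝓝[>] 0) (𝓝 0) := by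
    intro i _
    have h1 : Tendsto (fun q : ℝ => q ^ a i) (𝓝[>] 0) (𝓝 0) := by
      have := (Real.continuousAt_rpow_const 0 (a i) (Or.inr (ha i).le)).tendsto
      rw [Real.zero_rpow (ha i).ne'] at this
      exact this.mono_left nhdsWithin_le_nhds
    simpa using h1.const_mul (c i)
  simpa using tendsto_finsetSum _ h

/-- The terms of the resolvent series decay geometrically, uniformly in `t ∈ (0, T]`. -/
lemma exists_convPow_le (hc : ∀ i, 0 ≤ c i) (ha : ∀ i, 0 < a i) {T : ℝ} (hT : 0 < T) :
    ∃ R > 0, ∀ t, 0 < t → t ≤ T → ∀ k : ℕ, ∀ b, 0 < b →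
      convPow c a k b t ≤ (1 / 2) ^ k * (Real.exp R * (Real.exp 1 / R) ^ b * t ^ (b - 1)) := by
  have h1 := (tendsto_sum_mul_rpow_nhdsGT_zero c ha).eventually_le_const
    (show (0 : ℝ) < 1 / 2 by norm_num)
  obtain ⟨q, hq, hq0⟩ := (h1.and self_mem_nhdsWithin).exists
  have hq0 : 0 < q := hq0
  refine ⟨Real.exp 1 * T / q, by positivity, fun t ht htT k b hb => ?_⟩
  set R := Real.exp 1 * T / q with hR
  have hR0 : 0 < R := by positivity
  have hqt : Real.exp 1 * t / R ≤ q := by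
    rw [div_le_iff₀ hR0, hR, mul_div_cancel₀ _ hq0.ne']
    gcongr
  have h2 : ∑ i, c i * (Real.exp 1 * t / R) ^ a i ≤ 1 / 2 :=
    (Finset.sum_le_sum fun i _ => mul_le_mul_of_nonneg_left
      (Real.rpow_le_rpow (by positivity) hqt (ha i).le) (hc i)).trans hq
  have h3 : 0 ≤ ∑ i, c i * (Real.exp 1 * t / R) ^ a i :=
    Finset.sum_nonneg fun i _ => mul_nonneg (hc i) (by positivity)
  calc convPow c a k b t ≤ _ := convPow_le_geometric hc ha hR0 ht k hb
    _ ≤ Real.exp R / t * (Real.exp 1 * t / R) ^ b * (1 / 2) ^ k := by gcongr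
    _ = _ := by
        rw [mul_div_right_comm, Real.mul_rpow (by positivity) ht.le, Real.rpow_sub_one ht.ne']
        ring

lemma summable_convPow (hc : ∀ i, 0 ≤ c i) (ha : ∀ i, 0 < a i) {b : ℝ} (hb : 0 < b) (t : ℝ) :
    Summable fun k => convPow c a k b t := by
  rcases le_or_gt t 0 with ht | ht
  · simp only [convPow_of_nonpos c a _ b ht]
    exact summable_zero
  · obtain ⟨R, hR, h⟩ := exists_convPow_le hc ha ht
    exact Summable.of_nonneg_of_le (fun k => convPow_nonneg hc ha k hb t)
      (fun k => h t ht le_rfl k b hb)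
      ((summable_geometric_of_lt_one (by norm_num) (by norm_num)).mul_right _)

lemma norm_alternating {x : ℝ} (hx : 0 ≤ x) (k : ℕ) : ‖(-1) ^ k * x‖ = x := by
  rw [norm_mul, norm_pow, norm_neg, norm_one, one_pow, one_mul, Real.norm_of_nonneg hx]

lemma summable_alternating_convPow (hc : ∀ i, 0 ≤ c i) (ha : ∀ i, 0 < a i) {b : ℝ} (hb : 0 < b)
    (t : ℝ) : Summable fun k => (-1) ^ k * convPow c a k b t := by
  refine Summable.of_norm ?_
  simp only [norm_alternating (convPow_nonneg hc ha _ hb t)]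
  exact summable_convPow hc ha hb t

lemma resolventSeries_of_nonpos (c a : ι → ℝ) (b : ℝ) {t : ℝ} (ht : t ≤ 0) :
    resolventSeries c a b t = 0 := by
  simp [resolventSeries, convPow_of_nonpos c a _ b ht]

/-- The Volterra equation of the resolvent series. -/
lemma resolventSeries_eq (hc : ∀ i, 0 ≤ c i) (ha : ∀ i, 0 < a i) {b : ℝ} (hb : 0 < b) (t : ℝ) :
    resolventSeries c a b t = powKer b t - ∑ i, c i * resolventSeries c a (b + a i) t := by
  unfold resolventSeries
  rw [(summable_alternating_convPow hc ha hb t).tsum_eq_zero_add]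
  simp only [pow_zero, one_mul, ← tsum_mul_left]
  rw [← Summable.tsum_finsetSum fun i _ =>
    (summable_alternating_convPow hc ha (add_pos hb (ha i)) t).mul_left (c i), sub_eq_add_neg,
    ← tsum_neg]
  congr 1
  refine tsum_congr fun k => ?_
  simp only [convPow, Finset.mul_sum, ← Finset.sum_neg_distrib]
  refine Finset.sum_congr rfl fun i _ => ?_
  ring

/-- A bound of the resolvent series that is locally uniform in the coefficients and in `t`. -/
lemma exists_abs_resolventSeries_le {c' : ι → ℝ} (hc' : ∀ i, 0 ≤ c' i) (ha : ∀ i, 0 < a i)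
    {b : ℝ} (hb : 0 < b) {T : ℝ} (hT : 0 < T) :
    ∃ C, 0 ≤ C ∧ ∀ c : ι → ℝ, (∀ i, 0 ≤ c i) → (∀ i, c i ≤ c' i) → ∀ t, 0 < t → t ≤ T →
      |resolventSeries c a b t| ≤ C * t ^ (b - 1) := by
  obtain ⟨R, hR, h⟩ := exists_convPow_le hc' ha hT
  refine ⟨2 * (Real.exp R * (Real.exp 1 / R) ^ b), by positivity, fun c hc hcc t ht htT => ?_⟩
  rw [mul_assoc, ← tsum_geometric_two, ← tsum_mul_right, ← Real.norm_eq_abs]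
  refine tsum_of_norm_bounded (Summable.hasSum ?_) fun k => ?_
  · exact (summable_geometric_of_lt_one (by norm_num) (by norm_num)).mul_right _
  · rw [norm_alternating (convPow_nonneg hc ha k hb t)]
    exact (convPow_le_of_le hc ha hcc k hb t).trans (h t ht htT k b hb)

lemma continuousOn_resolventSeries (hc : ∀ i, 0 ≤ c i) (ha : ∀ i, 0 < a i) {b : ℝ} (hb : 0 < b) :
    ContinuousOn (resolventSeries c a b) (Ioi 0) := by
  intro t₀ ht₀
  have ht₀ : 0 < t₀ := ht₀
  obtain ⟨R, hR, h⟩ := exists_convPow_le hc ha (show 0 < 2 * t₀ by positivity)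
  have hcont : ContinuousOn (resolventSeries c a b) (Ioo (t₀ / 2) (2 * t₀)) := by
    refine continuousOn_tsum (u := fun k => (1 / 2) ^ k * (Real.exp R * (Real.exp 1 / R) ^ b *
      ((t₀ / 2) ^ (b - 1) + (2 * t₀) ^ (b - 1)))) ?_ ?_ ?_
    · exact fun k => (continuousOn_const.mul (continuousOn_convPow c a k b)).mono
        fun t ht => lt_trans (by positivity) ht.1
    · exact (summable_geometric_of_lt_one (by norm_num) (by norm_num)).mul_right _
    · intro k t ht
      have ht0 : 0 < t := lt_trans (by positivity) ht.1
      rw [norm_alternating (convPow_nonneg hc ha k hb t)]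
      refine (h t ht0 ht.2.le k b hb).trans ?_
      gcongr
      rcases le_total 0 (b - 1) with hb1 | hb1
      · exact (Real.rpow_le_rpow ht0.le ht.2.le hb1).trans
          (le_add_of_nonneg_left (by positivity))
      · exact (Real.rpow_le_rpow_of_nonpos (by positivity) ht.1.le hb1).trans
          (le_add_of_nonneg_right (by positivity))
  exact (hcont.continuousAt (Ioo_mem_nhds (by linarith) (by linarith))).continuousWithinAt

lemma measurable_resolventSeries_comp {X : Type*} [MeasurableSpace X] {c : X → ι → ℝ}
    (hcm : Measurable c) (hc : ∀ x i, 0 ≤ c x i) (ha : ∀ i, 0 < a i) {b : ℝ} (hb : 0 < b) :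
    Measurable fun p : X × ℝ => resolventSeries (c p.1) a b p.2 := by
  refine measurable_of_tendsto_metrizable
    (f := fun n (p : X × ℝ) => ∑ k ∈ Finset.range n, (-1) ^ k * convPow (c p.1) a k b p.2)
    (fun n => Finset.measurable_sum _ fun k _ => ?_) ?_
  · exact ((measurable_convPow a k b).comp
      ((hcm.comp measurable_fst).prodMk measurable_snd)).const_mul _
  · exact tendsto_pi_nhds.2 fun p =>
      (summable_alternating_convPow (hc p.1) ha hb p.2).hasSum.tendsto_sum_nat

lemma integral_powKer_mul_convPow (c : ι → ℝ) (ha : ∀ i, 0 < a i) {d t : ℝ}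
    (hd : 0 < d) (ht : 0 < t) (k : ℕ) {b : ℝ} (hb : 0 < b) :
    IntervalIntegrable (fun s => powKer d (t - s) * convPow c a k b s) volume 0 t ∧
      ∫ s in (0 : ℝ)..t, powKer d (t - s) * convPow c a k b s = convPow c a k (d + b) t := by
  induction k generalizing b with
  | zero => exact ⟨intervalIntegrable_powKer_mul_powKer hd hb ht, integral_powKer_mul_powKer hd hb ht⟩
  | succ k ih =>
    have h (s : ℝ) : powKer d (t - s) * convPow c a (k + 1) b s =
        ∑ i, c i * (powKer d (t - s) * convPow c a k (b + a i) s) := by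
      simp only [convPow, Finset.mul_sum]
      exact Finset.sum_congr rfl fun i _ => by ring
    simp only [h]
    have hi (i : ι) := (ih (add_pos hb (ha i))).1.const_mul (c i)
    refine ⟨?_, ?_⟩
    · have := IntervalIntegrable.sum Finset.univ fun i _ => hi i
      simpa only [Finset.sum_fn] using this
    rw [intervalIntegral.integral_finsetSum fun i _ => hi i]
    simp only [intervalIntegral.integral_const_mul, (ih (add_pos hb (ha _))).2, convPow, add_assoc]

/-- Fractional integration of order `d` maps the resolvent series of index `b` to the one of index
`d + b`. -/
lemma integral_powKer_mul_resolventSeries (hc : ∀ i, 0 ≤ c i) (ha : ∀ i, 0 < a i) {d b t : ℝ}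
    (hd : 0 < d) (hb : 0 < b) (ht : 0 < t) :
    ∫ s in (0 : ℝ)..t, powKer d (t - s) * resolventSeries c a b s =
      resolventSeries c a (d + b) t := by
  have hk (k : ℕ) := integral_powKer_mul_convPow c ha hd ht k hb
  have hF (k : ℕ) : ∫ s in Ioc 0 t, (-1) ^ k * (powKer d (t - s) * convPow c a k b s) =
      (-1) ^ k * convPow c a k (d + b) t := by
    rw [integral_const_mul, ← intervalIntegral.integral_of_le ht.le, (hk k).2]
  have := hasSum_integral_of_summable_integral_norm
    (F := fun k s => (-1) ^ k * (powKer d (t - s) * convPow c a k b s))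
    (μ := volume.restrict (Ioc 0 t)) (fun k => ((hk k).1.1).const_mul _) ?_
  · simp only [hF] at this
    rw [intervalIntegral.integral_of_le ht.le]
    unfold resolventSeries
    rw [this.tsum_eq]
    refine integral_congr_ae (Eventually.of_forall fun s => ?_)
    simp only [← tsum_mul_left]
    exact tsum_congr fun k => by ring
  · refine (summable_convPow hc ha (add_pos hd hb) t).congr fun k => ?_
    rw [← (hk k).2, intervalIntegral.integral_of_le ht.le]
    refine integral_congr_ae (Eventually.of_forall fun s => ?_)
    exact (norm_alternating (mul_nonneg (powKer_nonneg hd _) (convPow_nonneg hc ha k hb s)) k).symm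

lemma integral_resolventSeries (hc : ∀ i, 0 ≤ c i) (ha : ∀ i, 0 < a i) {b t : ℝ}
    (hb : 0 < b) (ht : 0 < t) :
    ∫ s in (0 : ℝ)..t, resolventSeries c a b s = resolventSeries c a (1 + b) t := by
  rw [← integral_powKer_mul_resolventSeries hc ha one_pos hb ht,
    intervalIntegral.integral_of_le ht.le, intervalIntegral.integral_of_le ht.le,
    integral_Ioc_eq_integral_Ioo, integral_Ioc_eq_integral_Ioo]
  refine setIntegral_congr_fun measurableSet_Ioo fun s hs => ?_
  rw [powKer_one (sub_pos.2 hs.2), one_mul]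

lemma intervalIntegrable_resolventSeries (hc : ∀ i, 0 ≤ c i) (ha : ∀ i, 0 < a i) {b T : ℝ}
    (hb : 0 < b) (hT : 0 < T) :
    IntervalIntegrable (resolventSeries c a b) volume 0 T := by
  obtain ⟨C, hC, h⟩ := exists_abs_resolventSeries_le hc ha hb hT
  have hi : IntervalIntegrable (fun t : ℝ => C * t ^ (b - 1)) volume 0 T :=
    (intervalIntegral.intervalIntegrable_rpow' (by linarith)).const_mul C
  refine hi.mono_fun ?_ ?_
  · exact (measurable_resolventSeries_comp (X := Unit) (c := fun _ => c) measurable_const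
      (fun _ => hc) ha hb).comp (measurable_const (a := ()) |>.prodMk measurable_id)
      |>.aestronglyMeasurable
  · rw [uIoc_of_le hT.le]
    filter_upwards [ae_restrict_mem measurableSet_Ioc] with t ht
    exact (h c hc (fun _ => le_rfl) t ht.1 ht.2).trans (le_abs_self _)

lemma hasDerivAt_resolventSeries (hc : ∀ i, 0 ≤ c i) (ha : ∀ i, 0 < a i) {b t : ℝ}
    (hb : 0 < b) (ht : 0 < t) :
    HasDerivAt (resolventSeries c a (1 + b)) (resolventSeries c a b t) t := by
  have hcont := (continuousOn_resolventSeries hc ha hb).continuousAt (Ioi_mem_nhds ht)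
  have hm : StronglyMeasurableAtFilter (resolventSeries c a b) (𝓝 t) :=
    (continuousOn_resolventSeries hc ha hb).stronglyMeasurableAtFilter isOpen_Ioi t ht
  have := intervalIntegral.integral_hasDerivAt_right
    (intervalIntegrable_resolventSeries hc ha hb ht) hm hcont
  refine this.congr_of_eventuallyEq ?_
  filter_upwards [Ioi_mem_nhds ht] with s hs
  exact (integral_resolventSeries hc ha hb hs).symm

lemma integral_exp_mul_convPow (c : ι → ℝ) (ha : ∀ i, 0 < a i) {μ : ℝ} (hμ : 0 < μ) (k : ℕ)
    {b : ℝ} (hb : 0 < b) :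
    IntegrableOn (fun t => Real.exp (-μ * t) * convPow c a k b t) (Ioi 0) ∧
      ∫ t in Ioi (0 : ℝ), Real.exp (-μ * t) * convPow c a k b t =
        μ ^ (-b) * (∑ i, c i * μ ^ (-a i)) ^ k := by
  induction k generalizing b with
  | zero => simpa only [convPow, pow_zero, mul_one] using
      ⟨integrableOn_exp_mul_powKer hb hμ, integral_exp_mul_powKer hb hμ⟩
  | succ k ih =>
    have h (t : ℝ) : Real.exp (-μ * t) * convPow c a (k + 1) b t =
        ∑ i, c i * (Real.exp (-μ * t) * convPow c a k (b + a i) t) := by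
      simp only [convPow, Finset.mul_sum]
      exact Finset.sum_congr rfl fun i _ => by ring
    simp only [h]
    have hi (i : ι) := (ih (add_pos hb (ha i))).1.const_mul (c i)
    refine ⟨integrable_finsetSum Finset.univ fun i _ => hi i, ?_⟩
    rw [integral_finsetSum _ fun i _ => hi i]
    simp only [integral_const_mul, (ih (add_pos hb (ha _))).2]
    rw [pow_succ', ← mul_assoc, Finset.mul_sum, Finset.sum_mul]
    refine Finset.sum_congr rfl fun i _ => ?_
    rw [neg_add, Real.rpow_add hμ]
    ring

/-- The Laplace transform of the resolvent series. -/
lemma integral_exp_mul_resolventSeries (hc : ∀ i, 0 ≤ c i) (ha : ∀ i, 0 < a i) {b μ : ℝ}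
    (hb : 0 < b) (hμ : 0 < μ) (hμ1 : ∑ i, c i * μ ^ (-a i) < 1) :
    IntegrableOn (fun t => Real.exp (-μ * t) * resolventSeries c a b t) (Ioi 0) ∧
      ∫ t in Ioi (0 : ℝ), Real.exp (-μ * t) * resolventSeries c a b t =
        μ ^ (-b) / (1 + ∑ i, c i * μ ^ (-a i)) := by
  set q := ∑ i, c i * μ ^ (-a i) with hq
  have hq0 : 0 ≤ q := Finset.sum_nonneg fun i _ => mul_nonneg (hc i) (by positivity)
  have hk (k : ℕ) := integral_exp_mul_convPow c ha hμ k hb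
  have hF (k : ℕ) : ∫ t in Ioi (0 : ℝ), (-1) ^ k * (Real.exp (-μ * t) * convPow c a k b t) =
      μ ^ (-b) * (-q) ^ k := by
    rw [integral_const_mul, (hk k).2, neg_pow]
    ring
  have hs : Summable fun k : ℕ =>
      ∫ t in Ioi (0 : ℝ), ‖(-1) ^ k * (Real.exp (-μ * t) * convPow c a k b t)‖ := by
    refine ((summable_geometric_of_lt_one hq0 hμ1).mul_left (μ ^ (-b))).congr fun k => ?_
    rw [← (hk k).2]
    refine integral_congr_ae (Eventually.of_forall fun s => ?_)
    exact (norm_alternating (mul_nonneg (Real.exp_pos _).le (convPow_nonneg hc ha k hb s)) k).symm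
  have heq : ∀ t, ∑' k : ℕ, (-1) ^ k * (Real.exp (-μ * t) * convPow c a k b t) =
      Real.exp (-μ * t) * resolventSeries c a b t := fun t => by
    unfold resolventSeries
    rw [← tsum_mul_left]
    exact tsum_congr fun k => by ring
  have hint := hasSum_integral_of_summable_integral_norm
    (F := fun k t => (-1) ^ k * (Real.exp (-μ * t) * convPow c a k b t))
    (μ := volume.restrict (Ioi 0)) (fun k => (hk k).1.const_mul _) hs
  simp only [hF, heq] at hint
  have hval : ∫ t in Ioi (0 : ℝ), Real.exp (-μ * t) * resolventSeries c a b t =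
      μ ^ (-b) / (1 + q) := by
    rw [← hint.tsum_eq, tsum_mul_left, tsum_geometric_of_abs_lt_one (by rwa [abs_neg, abs_of_nonneg hq0]),
      sub_neg_eq_add, div_eq_mul_inv]
  refine ⟨?_, hval⟩
  by_contra h
  have := integral_undef h
  rw [hval] at this
  have h2 : 0 < μ ^ (-b) / (1 + q) := div_pos (Real.rpow_pos_of_pos hμ _) (by linarith)
  exact h2.ne' this

end Series

/-! ### The relaxation equation with several fractional derivatives -/

section Relaxation

variable {J : Type*} [Fintype J]

/-- The sum of the weights of the derivatives of the highest order `A`. -/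
def leadCoeff (α lam : J → ℝ) (A : ℝ) : ℝ := ∑ j, if α j < A then 0 else lam j

/-- The symbol `∑ j, lam j * μ ^ α j`. -/
def symbol (α lam : J → ℝ) (μ : ℝ) : ℝ := ∑ j, lam j * μ ^ α j

/-- The coefficients of the Volterra kernel of the relaxation equation. -/
def relaxCoeff (α lam : J → ℝ) (A κ : ℝ) : Option J → ℝ
  | none => κ / leadCoeff α lam A
  | some j => if α j < A then lam j / leadCoeff α lam A else 0

/-- The exponents of the Volterra kernel of the relaxation equation. -/
def relaxExp (α : J → ℝ) (A : ℝ) : Option J → ℝ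
  | none => A
  | some j => if α j < A then A - α j else 1

/-- The function with Laplace transform `μ ^ (A - b) / (symbol α lam μ + κ)`. -/
def relaxSeries (α lam : J → ℝ) (A κ b t : ℝ) : ℝ :=
  resolventSeries (relaxCoeff α lam A κ) (relaxExp α A) b t / leadCoeff α lam A

/-- `A` is the largest of the orders `α j`, all of which are positive, and the weights are
positive. -/
structure IsLeadOrder (α lam : J → ℝ) (A : ℝ) : Prop where
  order_pos : ∀ j, 0 < α j
  weight_pos : ∀ j, 0 < lam j
  le_lead : ∀ j, α j ≤ A
  exists_eq : ∃ j, α j = A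

variable {α lam : J → ℝ} {A κ : ℝ}

namespace IsLeadOrder

lemma lead_pos (h : IsLeadOrder α lam A) : 0 < A := by
  obtain ⟨j, rfl⟩ := h.exists_eq
  exact h.order_pos j

lemma leadCoeff_pos (h : IsLeadOrder α lam A) : 0 < leadCoeff α lam A := by
  obtain ⟨j, hj⟩ := h.exists_eq
  refine Finset.sum_pos' (fun i _ => ?_) ⟨j, Finset.mem_univ j, ?_⟩
  · split_ifs
    · exact le_rfl
    · exact (h.weight_pos i).le
  · rw [if_neg (by simp [hj])]
    exact h.weight_pos j

lemma relaxCoeff_nonneg (h : IsLeadOrder α lam A) (hκ : 0 ≤ κ) (i : Option J) :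
    0 ≤ relaxCoeff α lam A κ i := by
  cases i with
  | none => exact div_nonneg hκ h.leadCoeff_pos.le
  | some j =>
    simp only [relaxCoeff]
    split_ifs
    · exact div_nonneg (h.weight_pos j).le h.leadCoeff_pos.le
    · exact le_rfl

lemma relaxCoeff_mono (h : IsLeadOrder α lam A) {κ' : ℝ} (hκ : κ ≤ κ') (i : Option J) :
    relaxCoeff α lam A κ i ≤ relaxCoeff α lam A κ' i := by
  cases i with
  | none => exact div_le_div_of_nonneg_right hκ h.leadCoeff_pos.le
  | some j => exact le_rfl

lemma relaxExp_pos (h : IsLeadOrder α lam A) (i : Option J) : 0 < relaxExp α A i := by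
  cases i with
  | none => exact h.lead_pos
  | some j =>
    simp only [relaxExp]
    split_ifs with hj
    · linarith
    · exact one_pos

lemma symbol_pos (h : IsLeadOrder α lam A) {μ : ℝ} (hμ : 0 < μ) : 0 < symbol α lam μ := by
  obtain ⟨j, hj⟩ := h.exists_eq
  exact Finset.sum_pos (fun i _ => mul_pos (h.weight_pos i) (Real.rpow_pos_of_pos hμ _))
    ⟨j, Finset.mem_univ j⟩

lemma hasDerivAt_relaxSeries (h : IsLeadOrder α lam A) (hκ : 0 ≤ κ) {b t : ℝ} (hb : 0 < b)
    (ht : 0 < t) :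
    HasDerivAt (relaxSeries α lam A κ (1 + b)) (relaxSeries α lam A κ b t) t :=
  (hasDerivAt_resolventSeries (h.relaxCoeff_nonneg hκ) h.relaxExp_pos hb ht).div_const _

lemma integral_powKer_mul_relaxSeries (h : IsLeadOrder α lam A) (hκ : 0 ≤ κ) {d b t : ℝ}
    (hd : 0 < d) (hb : 0 < b) (ht : 0 < t) :
    ∫ s in (0 : ℝ)..t, powKer d (t - s) * relaxSeries α lam A κ b s =
      relaxSeries α lam A κ (d + b) t := by
  unfold relaxSeries
  rw [← integral_powKer_mul_resolventSeries (h.relaxCoeff_nonneg hκ) h.relaxExp_pos hd hb ht]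
  simp only [← mul_div_assoc, intervalIntegral.integral_div]

lemma continuousOn_relaxSeries (h : IsLeadOrder α lam A) (hκ : 0 ≤ κ) {b : ℝ} (hb : 0 < b) :
    ContinuousOn (relaxSeries α lam A κ b) (Ioi 0) :=
  (continuousOn_resolventSeries (h.relaxCoeff_nonneg hκ) h.relaxExp_pos hb).div_const _

lemma measurable_relaxSeries_comp (h : IsLeadOrder α lam A) {X : Type*} [MeasurableSpace X]
    {k : X → ℝ} (hk : Measurable k) (hk0 : ∀ x, 0 ≤ k x) {b : ℝ} (hb : 0 < b) :
    Measurable fun p : X × ℝ => relaxSeries α lam A (k p.1) b p.2 := by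
  refine (measurable_resolventSeries_comp (c := fun x => relaxCoeff α lam A (k x))
    (measurable_pi_lambda _ fun i => ?_) (fun x => h.relaxCoeff_nonneg (hk0 x))
    h.relaxExp_pos hb).div_const _
  cases i with
  | none => exact hk.div_const _
  | some j => exact measurable_const

lemma exists_abs_relaxSeries_le (h : IsLeadOrder α lam A) (κ' : ℝ) (hκ' : 0 ≤ κ') {b : ℝ}
    (hb : 0 < b) {T : ℝ} (hT : 0 < T) :
    ∃ C, 0 ≤ C ∧ ∀ κ, 0 ≤ κ → κ ≤ κ' → ∀ t, 0 < t → t ≤ T →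
      |relaxSeries α lam A κ b t| ≤ C * t ^ (b - 1) := by
  obtain ⟨C, hC, hle⟩ := exists_abs_resolventSeries_le (h.relaxCoeff_nonneg hκ') h.relaxExp_pos hb hT
  refine ⟨C / leadCoeff α lam A, div_nonneg hC h.leadCoeff_pos.le, fun κ hκ hκκ t ht htT => ?_⟩
  unfold relaxSeries
  rw [abs_div, abs_of_pos h.leadCoeff_pos, div_mul_eq_mul_div]
  exact div_le_div_of_nonneg_right
    (hle _ (h.relaxCoeff_nonneg hκ) (h.relaxCoeff_mono hκκ) t ht htT) h.leadCoeff_pos.le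

lemma leadCoeff_mul_one_add_sum (h : IsLeadOrder α lam A) {μ : ℝ} (hμ : 0 < μ) :
    leadCoeff α lam A * μ ^ A *
      (1 + ∑ i, relaxCoeff α lam A κ i * μ ^ (-relaxExp α A i)) = symbol α lam μ + κ := by
  have hl := h.leadCoeff_pos
  have hA : 0 < μ ^ A := Real.rpow_pos_of_pos hμ A
  have h1 : leadCoeff α lam A * μ ^ A +
      ∑ j, leadCoeff α lam A * μ ^ A *
        (relaxCoeff α lam A κ (some j) * μ ^ (-relaxExp α A (some j))) = symbol α lam μ := by
    nth_rewrite 1 [leadCoeff]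
    rw [Finset.sum_mul, ← Finset.sum_add_distrib]
    refine Finset.sum_congr rfl fun j _ => ?_
    simp only [relaxCoeff, relaxExp]
    split_ifs with hj
    · rw [neg_sub, Real.rpow_sub hμ]
      field_simp
      ring
    · rw [le_antisymm (h.le_lead j) (not_lt.1 hj)]
      ring
  rw [Fintype.sum_option, mul_add, mul_one, mul_add, Finset.mul_sum, ← h1]
  simp only [relaxCoeff, relaxExp, Real.rpow_neg hμ.le]
  field_simp
  ring

lemma exists_laplace_relaxSeries (h : IsLeadOrder α lam A) (hκ : 0 ≤ κ) :
    ∃ a, 0 < a ∧ ∀ μ, a ≤ μ →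
      IntegrableOn (fun t => Real.exp (-μ * t) * relaxSeries α lam A κ (1 + A) t) (Ioi 0) ∧
      ∫ t in Ioi (0 : ℝ), Real.exp (-μ * t) * relaxSeries α lam A κ (1 + A) t =
        1 / (μ * (symbol α lam μ + κ)) := by
  have h1 := (tendsto_sum_mul_rpow_nhdsGT_zero (relaxCoeff α lam A κ)
    h.relaxExp_pos).eventually_lt_const one_pos
  obtain ⟨ε, hε, hε'⟩ := mem_nhdsGT_iff_exists_Ioc_subset.1 h1
  have hε0 : 0 < ε := hε
  refine ⟨ε⁻¹, inv_pos.2 hε0, fun μ hμε => ?_⟩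
  have hμ : 0 < μ := (inv_pos.2 hε0).trans_le hμε
  have hlt : ∑ i, relaxCoeff α lam A κ i * μ ^ (-relaxExp α A i) < 1 := by
    have : μ⁻¹ ∈ Ioc 0 ε := ⟨inv_pos.2 hμ, by rwa [inv_le_comm₀ hμ hε0]⟩
    simpa only [Real.inv_rpow hμ.le, ← Real.rpow_neg hμ.le, mem_ofPred_eq] using hε' this
  obtain ⟨hi, hv⟩ := integral_exp_mul_resolventSeries (h.relaxCoeff_nonneg hκ) h.relaxExp_pos
    (show 0 < 1 + A by linarith [h.lead_pos]) hμ hlt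
  simp only [relaxSeries, ← mul_div_assoc]
  refine ⟨hi.div_const _, ?_⟩
  rw [integral_div, hv, ← h.leadCoeff_mul_one_add_sum hμ, neg_add, Real.rpow_add hμ,
    Real.rpow_neg hμ.le, Real.rpow_neg hμ.le, Real.rpow_one]
  have hl := h.leadCoeff_pos
  have hA : 0 < μ ^ A := Real.rpow_pos_of_pos hμ A
  have hs : 0 < 1 + ∑ i, relaxCoeff α lam A κ i * μ ^ (-relaxExp α A i) :=
    add_pos_of_pos_of_nonneg one_pos (Finset.sum_nonneg fun i _ =>
      mul_nonneg (h.relaxCoeff_nonneg hκ i) (by positivity))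
  field_simp

/-- The relaxation equation. -/
lemma sum_mul_relaxSeries (h : IsLeadOrder α lam A) (hκ : 0 ≤ κ) {t : ℝ} (ht : 0 < t) :
    ∑ j, lam j * relaxSeries α lam A κ (1 - α j + A) t = 1 - κ * relaxSeries α lam A κ (1 + A) t := by
  have hl := h.leadCoeff_pos
  have hV := resolventSeries_eq (h.relaxCoeff_nonneg hκ) h.relaxExp_pos one_pos t
  rw [powKer_one ht, Fintype.sum_option] at hV
  set G := resolventSeries (relaxCoeff α lam A κ) (relaxExp α A) with hG
  have h1 : ∑ j, lam j * relaxSeries α lam A κ (1 - α j + A) t = G 1 t +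
      ∑ j, relaxCoeff α lam A κ (some j) * G (1 + relaxExp α A (some j)) t := by
    have h2 : G 1 t = ∑ j, (if α j < A then 0 else lam j) * (G 1 t / leadCoeff α lam A) := by
      rw [← Finset.sum_mul, ← leadCoeff, mul_div_cancel₀ _ hl.ne']
    rw [h2, ← Finset.sum_add_distrib]
    refine Finset.sum_congr rfl fun j _ => ?_
    simp only [relaxCoeff, relaxExp, relaxSeries, ← hG]
    split_ifs with hj
    · rw [show 1 - α j + A = 1 + (A - α j) by ring]
      ring
    · rw [le_antisymm (h.le_lead j) (not_lt.1 hj), sub_add_cancel]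
      ring
  rw [h1, hV]
  simp only [relaxCoeff, relaxExp, relaxSeries, ← hG]
  ring

lemma relaxSeries_of_nonpos (α lam : J → ℝ) (A κ b : ℝ) {t : ℝ} (ht : t ≤ 0) :
    relaxSeries α lam A κ b t = 0 := by
  simp [relaxSeries, resolventSeries_of_nonpos _ _ _ ht]

end IsLeadOrder

end Relaxation

/-! ### Processes at independent random times -/

section RandomTimes

variable {Ω : Type*} {m m₁ m₂ m₀ : MeasurableSpace Ω} {P : Measure[m₀] Ω}

lemma aestronglyMeasurable_of_tendsto_ae_of_subalgebra {β : Type*} [TopologicalSpace β]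
    [Nonempty β] [TopologicalSpace.IsCompletelyMetrizableSpace β] {f : ℕ → Ω → β} {g : Ω → β}
    (hf : ∀ n, AEStronglyMeasurable[m] (f n) P)
    (lim : ∀ᵐ ω ∂P, Tendsto (fun n => f n ω) atTop (𝓝 (g ω))) : AEStronglyMeasurable[m] g P := by
  choose f' hf' hff' using hf
  refine ⟨fun ω => limUnder atTop (fun n => f' n ω),
    @StronglyMeasurable.limUnder _ _ _ m _ _ _ _ _ _ _ hf', ?_⟩
  filter_upwards [lim, ae_all_iff.2 hff'] with ω h1 h2
  simp only [h2] at h1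
  exact h1.limUnder_eq.symm

lemma Indep.integral_mul_of_aestronglyMeasurable {f g : Ω → ℝ} (hm₁ : m₁ ≤ m₀) (hm₂ : m₂ ≤ m₀)
    (h : Indep m₁ m₂ P) (hf : AEStronglyMeasurable[m₁] f P) (hg : AEStronglyMeasurable[m₂] g P) :
    ∫ ω, f ω * g ω ∂P = (∫ ω, f ω ∂P) * ∫ ω, g ω ∂P := by
  obtain ⟨f', hf', hff'⟩ := hf
  obtain ⟨g', hg', hgg'⟩ := hg
  have hi : IndepFun f' g' P := by
    rw [IndepFun_iff_Indep]
    exact indep_of_indep_of_le h hf'.measurable.comap_le hg'.measurable.comap_le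
  have hfg : ∫ ω, f ω * g ω ∂P = ∫ ω, f' ω * g' ω ∂P := integral_congr_ae (hff'.mul hgg')
  rw [integral_congr_ae hff', integral_congr_ae hgg', hfg]
  exact hi.integral_fun_mul_eq_mul_integral (hf'.mono hm₁).aestronglyMeasurable
    (hg'.mono hm₂).aestronglyMeasurable

/-- An approximation of `x` from the right by an element of `(k + 1)⁻¹ ℕ`. -/
def rightApprox (k : ℕ) (x : ℝ≥0) : ℝ≥0 := (⌊((k : ℝ≥0) + 1) * x⌋₊ + 1) / ((k : ℝ≥0) + 1)

lemma lt_rightApprox (k : ℕ) (x : ℝ≥0) : x < rightApprox k x := by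
  unfold rightApprox
  rw [lt_div_iff₀ (by positivity), mul_comm]
  exact Nat.lt_floor_add_one _

lemma rightApprox_le (k : ℕ) (x : ℝ≥0) : rightApprox k x ≤ x + 1 / ((k : ℝ≥0) + 1) := by
  unfold rightApprox
  rw [div_le_iff₀ (by positivity), add_mul x, div_mul_cancel₀ _ (by positivity), mul_comm x]
  gcongr
  exact Nat.floor_le (by positivity)

lemma tendsto_rightApprox (x : ℝ≥0) :
    Tendsto (fun k => rightApprox k x) atTop (𝓝[≥] x) := by
  refine tendsto_nhdsWithin_iff.2 ⟨?_, Eventually.of_forall fun k => (lt_rightApprox k x).le⟩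
  have h1 : Tendsto (fun k : ℕ => x + 1 / ((k : ℝ≥0) + 1)) atTop (𝓝 x) := by
    simpa using tendsto_const_nhds.add (tendsto_one_div_add_atTop_nhds_zero_nat (𝕜 := ℝ≥0))
  exact tendsto_of_tendsto_of_tendsto_of_le_of_le tendsto_const_nhds h1
    (fun k => (lt_rightApprox k x).le) (fun k => rightApprox_le k x)

lemma measurable_apply_nat {E : Type*} [MeasurableSpace E] {Y : ℕ → Ω → E} {N : Ω → ℕ}
    (hY : ∀ n, Measurable[m] (Y n)) (hN : Measurable[m] N) :
    Measurable[m] fun ω => Y (N ω) ω := by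
  have : Measurable fun p : Ω × ℕ => Y p.2 p.1 := measurable_from_prod_countable_left hY
  exact this.comp (measurable_id.prodMk hN)

lemma measurable_floor_mul {T : Ω → ℝ≥0} (hT : Measurable[m] T) (k : ℕ) :
    Measurable[m] fun ω => ⌊((k : ℝ≥0) + 1) * T ω⌋₊ :=
  Nat.measurable_floor.comp (hT.const_mul _)

variable {E : Type*} [TopologicalSpace E] [TopologicalSpace.IsCompletelyMetrizableSpace E]
  [SecondCountableTopology E] [MeasurableSpace E] [BorelSpace E] [Nonempty E]

/-- A right-continuous process at a random time is a random variable. -/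
lemma aestronglyMeasurable_process_comp {X : ℝ≥0 → Ω → E} {T : Ω → ℝ≥0}
    (hX : ∀ t, Measurable[m] (X t))
    (hc : ∀ᵐ ω ∂P, ∀ t, ContinuousWithinAt (fun s => X s ω) (Ici t) t)
    (hT : AEStronglyMeasurable[m] T P) : AEStronglyMeasurable[m] (fun ω => X (T ω) ω) P := by
  obtain ⟨T', hT', hTT'⟩ := hT
  refine aestronglyMeasurable_of_tendsto_ae_of_subalgebra
    (f := fun k ω => X (rightApprox k (T' ω)) ω) (fun k => ?_) ?_
  · refine Measurable.aestronglyMeasurable (m := m) ?_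
    exact measurable_apply_nat (Y := fun n => X ((n + 1) / ((k : ℝ≥0) + 1))) (fun n => hX _)
      (measurable_floor_mul hT'.measurable k)
  · filter_upwards [hc, hTT'] with ω h1 h2
    rw [h2]
    exact (h1 (T' ω)).tendsto.comp (tendsto_rightApprox (T' ω))

lemma integral_process_apply_nat [IsProbabilityMeasure P] {𝕜 : Type*} [RCLike 𝕜]
    (hm₁ : m₁ ≤ m₀) (hm₂ : m₂ ≤ m₀) (hi : Indep m₁ m₂ P) {Y : ℕ → Ω → E} {N : Ω → ℕ}
    (hY : ∀ n, Measurable[m₁] (Y n)) (hN : Measurable[m₂] N) {ψ : E → 𝕜} (hψ : Continuous ψ)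
    {C : ℝ} (hC : ∀ x, ‖ψ x‖ ≤ C) :
    ∫ ω, ψ (Y (N ω) ω) ∂P = ∫ ω, (∫ ω', ψ (Y (N ω) ω') ∂P) ∂P := by
  have hV : Measurable[m₁] fun ω n => Y n ω := @measurable_pi_lambda _ _ _ m₁ _ _ hY
  have hVN : IndepFun (fun ω n => Y n ω) N P := by
    rw [IndepFun_iff_Indep]
    exact indep_of_indep_of_le hi hV.comap_le hN.comap_le
  have hV0 : Measurable fun ω n => Y n ω := hV.mono hm₁ le_rfl
  have hN0 : Measurable N := hN.mono hm₂ le_rfl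
  have hF : Measurable fun p : (ℕ → E) × ℕ => ψ (p.1 p.2) :=
    measurable_from_prod_countable_left fun n => hψ.measurable.comp (measurable_pi_apply n)
  have hprod := (indepFun_iff_map_prod_eq_prod_map_map hV0.aemeasurable hN0.aemeasurable).1 hVN
  have := Measure.isProbabilityMeasure_map (μ := P) hV0.aemeasurable
  have := Measure.isProbabilityMeasure_map (μ := P) hN0.aemeasurable
  calc ∫ ω, ψ (Y (N ω) ω) ∂P
      = ∫ p, ψ (p.1 p.2) ∂(P.map fun ω => ((fun n => Y n ω), N ω)) :=
        (integral_map (hV0.prodMk hN0).aemeasurable hF.aestronglyMeasurable).symm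
    _ = ∫ n, ∫ v, ψ (v n) ∂(P.map fun ω n => Y n ω) ∂(P.map N) := by
        rw [hprod, integral_prod_symm]
        refine Integrable.of_bound hF.aestronglyMeasurable C (Eventually.of_forall fun p => hC _)
    _ = ∫ ω, ∫ v, ψ (v (N ω)) ∂(P.map fun ω n => Y n ω) ∂P :=
        integral_map hN0.aemeasurable (Measurable.of_discrete).aestronglyMeasurable
    _ = _ := by
        refine integral_congr_ae (Eventually.of_forall fun ω => ?_)
        exact integral_map hV0.aemeasurable
          (hψ.measurable.comp (measurable_pi_apply _)).aestronglyMeasurable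

/-- Conditioning on an independent random time. -/
lemma integral_process_comp [IsProbabilityMeasure P] {𝕜 : Type*} [RCLike 𝕜]
    (hm₁ : m₁ ≤ m₀) (hm₂ : m₂ ≤ m₀) (hi : Indep m₁ m₂ P) {X : ℝ≥0 → Ω → E} {T : Ω → ℝ≥0}
    (hX : ∀ t, Measurable[m₁] (X t))
    (hc : ∀ᵐ ω ∂P, ∀ t, ContinuousWithinAt (fun s => X s ω) (Ici t) t)
    (hT : AEStronglyMeasurable[m₂] T P) {ψ : E → 𝕜} (hψ : Continuous ψ)
    {C : ℝ} (hC : ∀ x, ‖ψ x‖ ≤ C) {χ : ℝ≥0 → 𝕜} (hχ : Continuous χ)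
    (hψχ : ∀ t, ∫ ω, ψ (X t ω) ∂P = χ t) :
    ∫ ω, ψ (X (T ω) ω) ∂P = ∫ ω, χ (T ω) ∂P := by
  obtain ⟨T', hT', hTT'⟩ := hT
  have hχC : ∀ t, ‖χ t‖ ≤ C := fun t => by
    rw [← hψχ]
    simpa using norm_integral_le_of_norm_le_const (μ := P) (Eventually.of_forall fun ω => hC (X t ω))
  have h1 : ∫ ω, ψ (X (T ω) ω) ∂P = ∫ ω, ψ (X (T' ω) ω) ∂P :=
    integral_congr_ae (hTT'.mono fun ω h => by simp only [h])
  have h2 : ∫ ω, χ (T ω) ∂P = ∫ ω, χ (T' ω) ∂P :=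
    integral_congr_ae (hTT'.mono fun ω h => by simp only [h])
  have hk (k : ℕ) : ∫ ω, ψ (X (rightApprox k (T' ω)) ω) ∂P =
      ∫ ω, χ (rightApprox k (T' ω)) ∂P := by
    simp only [← hψχ]
    exact integral_process_apply_nat hm₁ hm₂ hi
      (Y := fun n => X ((n + 1) / ((k : ℝ≥0) + 1))) (fun n => hX _)
      (measurable_floor_mul hT'.measurable k) hψ hC
  have hmT : ∀ k, Measurable[m₂] fun ω => rightApprox k (T' ω) := fun k =>
    (measurable_from_nat (f := fun n : ℕ => ((n : ℝ≥0) + 1) / ((k : ℝ≥0) + 1))).comp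
      (measurable_floor_mul hT'.measurable k)
  rw [h1, h2]
  refine tendsto_nhds_unique (f := fun k : ℕ => ∫ ω, ψ (X (rightApprox k (T' ω)) ω) ∂P)
    (l := atTop) ?_ ?_
  · refine tendsto_integral_of_dominated_convergence (fun _ => C) (fun k => ?_)
      (integrable_const C) (fun k => Eventually.of_forall fun ω => hC _) ?_
    · refine Measurable.aestronglyMeasurable (hψ.measurable.comp ?_)
      exact measurable_apply_nat (Y := fun n => X ((n + 1) / ((k : ℝ≥0) + 1)))
        (fun n => (hX _).mono hm₁ le_rfl)
        ((measurable_floor_mul hT'.measurable k).mono hm₂ le_rfl)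
    · filter_upwards [hc] with ω h
      exact (hψ.tendsto _).comp ((h (T' ω)).tendsto.comp (tendsto_rightApprox (T' ω)))
  · simp only [hk]
    refine tendsto_integral_of_dominated_convergence (fun _ => C) (fun k => ?_)
      (integrable_const C) (fun k => Eventually.of_forall fun ω => hχC _) ?_
    · exact (hχ.measurable.comp ((hmT k).mono hm₂ le_rfl)).aestronglyMeasurable
    · refine Eventually.of_forall fun ω => (hχ.tendsto _).comp ?_
      exact (tendsto_rightApprox (T' ω)).mono_right nhdsWithin_le_nhds

end RandomTimes

/-! ### Laplace transforms of iterated subordinators -/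

section Subordinators

variable {Ω : Type*} [m₀ : MeasurableSpace Ω] {P : Measure Ω}

/-- The σ-algebra generated by a process. -/
@[reducible]
def processSigma {E : Type*} [MeasurableSpace E] (X : ℝ≥0 → Ω → E) : MeasurableSpace Ω :=
  MeasurableSpace.comap (fun ω t => X t ω) MeasurableSpace.pi

lemma measurable_processSigma {E : Type*} [MeasurableSpace E] (X : ℝ≥0 → Ω → E) (t : ℝ≥0) :
    Measurable[processSigma X] (X t) :=
  (measurable_pi_apply t).comp (comap_measurable fun ω t => X t ω)

lemma processSigma_le {E : Type*} [MeasurableSpace E] {X : ℝ≥0 → Ω → E}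
    (hX : ∀ t, Measurable (X t)) : processSigma X ≤ m₀ :=
  (measurable_pi_lambda _ hX).comap_le

lemma aestronglyMeasurable_mono_subalgebra {β : Type*} [TopologicalSpace β]
    {m m' : MeasurableSpace Ω} (h : m ≤ m') {f : Ω → β} (hf : AEStronglyMeasurable[m] f P) :
    AEStronglyMeasurable[m'] f P := by
  obtain ⟨g, hg, hfg⟩ := hf
  exact ⟨g, hg.mono h, hfg⟩

lemma aestronglyMeasurable_sum_of_subalgebra {m : MeasurableSpace Ω} {ι : Type*} [Fintype ι]
    {f : ι → Ω → ℝ} (hf : ∀ i, AEStronglyMeasurable[m] (f i) P) :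
    AEStronglyMeasurable[m] (fun ω => ∑ i, f i ω) P := by
  choose g hg hfg using hf
  refine ⟨fun ω => ∑ i, g i ω,
    (Finset.measurable_sum _ fun i _ => (hg i).measurable).stronglyMeasurable, ?_⟩
  filter_upwards [ae_all_iff.2 hfg] with ω h
  simp only [h]

lemma integral_prod_of_iIndep [IsProbabilityMeasure P] {ι κ : Type*}
    {m : ι × κ → MeasurableSpace Ω} (hm : ∀ p, m p ≤ m₀) (hi : iIndep m P) {Z : ι → Ω → ℝ}
    (hZ : ∀ j, AEStronglyMeasurable[⨆ i, m (j, i)] (Z j) P) (F : Finset ι) :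
    AEStronglyMeasurable[⨆ p ∈ {p : ι × κ | p.1 ∈ F}, m p] (fun ω => ∏ j ∈ F, Z j ω) P ∧
      ∫ ω, ∏ j ∈ F, Z j ω ∂P = ∏ j ∈ F, ∫ ω, Z j ω ∂P := by
  classical
  induction F using Finset.induction_on with
  | empty => exact ⟨by simpa using ⟨_, @stronglyMeasurable_const _ _ (_) _ _, ae_eq_rfl⟩, by simp⟩
  | insert a F ha ih =>
    have hle : ∀ S : Set (ι × κ), (⨆ p ∈ S, m p) ≤ m₀ := fun S => iSup₂_le fun p _ => hm p
    have hZa : AEStronglyMeasurable[⨆ p ∈ {p : ι × κ | p.1 = a}, m p] (Z a) P := by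
      refine aestronglyMeasurable_mono_subalgebra (iSup_le fun i => ?_) (hZ a)
      exact le_iSup₂_of_le (a, i) rfl le_rfl
    have hdisj : Disjoint {p : ι × κ | p.1 = a} {p : ι × κ | p.1 ∈ F} := by
      rw [Set.disjoint_left]
      rintro p rfl hp
      exact ha hp
    simp only [Finset.prod_insert ha]
    constructor
    · refine AEStronglyMeasurable.mul ?_ ?_
      · refine aestronglyMeasurable_mono_subalgebra (iSup₂_le fun p hp => ?_) hZa
        exact le_iSup₂_of_le p (Finset.mem_insert.2 (Or.inl hp)) le_rfl
      · refine aestronglyMeasurable_mono_subalgebra (iSup₂_le fun p hp => ?_) ih.1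
        exact le_iSup₂_of_le p (Finset.mem_insert_of_mem hp) le_rfl
    · rw [Indep.integral_mul_of_aestronglyMeasurable (hle _) (hle _)
        (indep_iSup_of_disjoint hm hi hdisj) hZa ih.1, ih.2]

lemma IsStableSubordinator.integral_exp {ν : ℝ} {H : ℝ≥0 → Ω → ℝ≥0}
    (hH : IsStableSubordinator ν H P) (t : ℝ≥0) {μ : ℝ} (hμ : 0 < μ) :
    ∫ ω, Real.exp (-μ * (H t ω : ℝ)) ∂P = Real.exp (-(t : ℝ) * μ ^ ν) := by
  have h1 := hH.laplace 0 t zero_le μ hμ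
  rw [NNReal.coe_zero, sub_zero] at h1
  rw [← h1]
  refine integral_congr_ae ?_
  filter_upwards [hH.zero] with ω h
  simp [h]

lemma norm_exp_neg_mul_le_one {μ : ℝ} (hμ : 0 ≤ μ) (x : ℝ≥0) : ‖Real.exp (-μ * (x : ℝ))‖ ≤ 1 := by
  rw [Real.norm_of_nonneg (Real.exp_pos _).le, Real.exp_le_one_iff]
  nlinarith [mul_nonneg hμ x.2]

lemma iterComp_laplace [IsProbabilityMeasure P] {ν : ℝ} (r : ℕ) {H : Fin r → ℝ≥0 → Ω → ℝ≥0}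
    (hH : ∀ i, IsStableSubordinator ν (H i) P)
    (hi : iIndep (fun i => processSigma (H i)) P) (s : ℝ≥0) :
    AEStronglyMeasurable[⨆ i, processSigma (H i)]
        (fun ω => iterComp r (fun i t => H i t ω) s) P ∧
      ∀ μ : ℝ, 0 < μ → ∫ ω, Real.exp (-μ * (iterComp r (fun i t => H i t ω) s : ℝ)) ∂P =
        Real.exp (-(s : ℝ) * μ ^ ν ^ r) := by
  induction r with
  | zero =>
    refine ⟨⟨_, @stronglyMeasurable_const _ _ (_) _ s, ae_eq_rfl⟩, fun μ hμ => ?_⟩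
    simp only [iterComp, pow_zero, Real.rpow_one, integral_const, probReal_univ, one_smul]
    ring_nf
  | succ r ih =>
    obtain ⟨ih1, ih2⟩ := ih (H := fun i => H i.succ) (fun i => hH i.succ)
      (hi.precomp (Fin.succ_injective r))
    have hle : ∀ i, processSigma (H i) ≤ m₀ := fun i => processSigma_le (hH i).measurable
    have hc : ∀ᵐ ω ∂P, ∀ t, ContinuousWithinAt (fun s => H 0 s ω) (Ici t) t :=
      (hH 0).paths.mono fun ω h => h.2
    have h2le : (⨆ i : Fin r, processSigma (H i.succ)) ≤ m₀ := iSup_le fun i => hle _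
    have hind : Indep (processSigma (H 0)) (⨆ i : Fin r, processSigma (H i.succ)) P := by
      have := indep_iSup_of_disjoint hle hi
        (S := {0}) (T := {i | i ≠ 0}) (by simp)
      refine indep_of_indep_of_le this ?_ (iSup_le fun i => ?_)
      · exact le_iSup₂_of_le 0 rfl le_rfl
      · exact le_iSup₂_of_le i.succ (Fin.succ_ne_zero i) le_rfl
    constructor
    · refine aestronglyMeasurable_process_comp (X := H 0) (fun t => ?_) hc
        (aestronglyMeasurable_mono_subalgebra (iSup_le fun i => ?_) ih1)
      · exact (measurable_processSigma (H 0) t).mono (le_iSup (fun i => processSigma (H i)) 0) le_rfl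
      · exact le_iSup (fun i => processSigma (H i)) i.succ
    · intro μ hμ
      have h1 := integral_process_comp (P := P) (X := H 0) (hle 0) h2le hind
        (measurable_processSigma (H 0)) hc ih1
        (ψ := fun x : ℝ≥0 => Real.exp (-μ * (x : ℝ))) (by fun_prop) (C := 1)
        (norm_exp_neg_mul_le_one hμ.le)
        (χ := fun t : ℝ≥0 => Real.exp (-(t : ℝ) * μ ^ ν)) (by fun_prop)
        (fun t => (hH 0).integral_exp t hμ)
      simp only [iterComp]
      rw [h1]
      have h2 := ih2 (μ ^ ν) (Real.rpow_pos_of_pos hμ ν)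
      rw [← Real.rpow_mul hμ.le, ← pow_succ'] at h2
      rw [← h2]
      refine integral_congr_ae (Eventually.of_forall fun ω => ?_)
      simp only
      ring_nf

lemma monotone_iterComp (r : ℕ) {h : Fin r → ℝ≥0 → ℝ≥0} (hh : ∀ i, Monotone (h i)) :
    Monotone (iterComp r h) := by
  induction r with
  | zero => exact monotone_id
  | succ r ih => exact (hh 0).comp (ih fun i => hh i.succ)

lemma monotone_weightedSum {m r : ℕ} {ν lam : Fin m → ℝ} (hlam : ∀ j, 0 < lam j)
    {h : Fin m → Fin r → ℝ≥0 → ℝ≥0} (hh : ∀ j i, Monotone (h j i)) :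
    Monotone (weightedSum ν lam h) := fun _ _ hst =>
  Finset.sum_le_sum fun j _ => mul_le_mul_of_nonneg_left
    (NNReal.coe_le_coe.2 (monotone_iterComp r (hh j) hst)) (Real.rpow_nonneg (hlam j).le _)

lemma weightedSum_nonneg {m r : ℕ} {ν lam : Fin m → ℝ} (hlam : ∀ j, 0 < lam j)
    (h : Fin m → Fin r → ℝ≥0 → ℝ≥0) (s : ℝ≥0) : 0 ≤ weightedSum ν lam h s :=
  Finset.sum_nonneg fun j _ => mul_nonneg (Real.rpow_nonneg (hlam j).le _) (NNReal.coe_nonneg _)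

section WeightedSum

variable [IsProbabilityMeasure P] {m r : ℕ} {ν lam : Fin m → ℝ}
  {H : Fin m → Fin r → ℝ≥0 → Ω → ℝ≥0}

lemma aestronglyMeasurable_weightedSum (hH : ∀ j i, IsStableSubordinator (ν j) (H j i) P)
    (hi : iIndep (fun p : Fin m × Fin r => processSigma (H p.1 p.2)) P) (s : ℝ≥0) :
    AEStronglyMeasurable[⨆ p : Fin m × Fin r, processSigma (H p.1 p.2)]
      (fun ω => weightedSum ν lam (fun j i t => H j i t ω) s) P := by
  unfold weightedSum
  refine aestronglyMeasurable_sum_of_subalgebra fun j => ?_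
  have h1 := (iterComp_laplace r (hH j)
    (hi.precomp (g := fun i => (j, i)) fun i i' h => (Prod.ext_iff.1 h).2) s).1
  have h2 : AEStronglyMeasurable[⨆ p : Fin m × Fin r, processSigma (H p.1 p.2)]
      (fun ω => iterComp r (fun i t => H j i t ω) s) P :=
    aestronglyMeasurable_mono_subalgebra (iSup_le fun i =>
      le_iSup (fun p : Fin m × Fin r => processSigma (H p.1 p.2)) (j, i)) h1
  exact (NNReal.continuous_coe.comp_aestronglyMeasurable h2).const_mul _

/-- The Laplace transform of the weighted sum of iterated subordinators. -/
lemma integral_exp_weightedSum (hν : ∀ j, 0 < ν j) (hlam : ∀ j, 0 < lam j)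
    (hH : ∀ j i, IsStableSubordinator (ν j) (H j i) P)
    (hi : iIndep (fun p : Fin m × Fin r => processSigma (H p.1 p.2)) P) (s : ℝ≥0)
    {μ : ℝ} (hμ : 0 < μ) :
    ∫ ω, Real.exp (-μ * weightedSum ν lam (fun j i t => H j i t ω) s) ∂P =
      Real.exp (-(s : ℝ) * symbol (fun j => ν j ^ r) lam μ) := by
  have hle : ∀ p : Fin m × Fin r, processSigma (H p.1 p.2) ≤ m₀ := fun p =>
    processSigma_le (hH p.1 p.2).measurable
  have hj (j : Fin m) := iterComp_laplace r (hH j)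
    (hi.precomp (g := fun i => (j, i)) fun i i' h => (Prod.ext_iff.1 h).2) s
  have h1 : ∀ ω, Real.exp (-μ * weightedSum ν lam (fun j i t => H j i t ω) s) =
      ∏ j, Real.exp (-(μ * lam j ^ (1 / ν j ^ r)) *
        (iterComp r (fun i t => H j i t ω) s : ℝ)) := fun ω => by
    rw [weightedSum, Finset.mul_sum, Real.exp_sum]
    exact Finset.prod_congr rfl fun j _ => by ring_nf
  simp only [h1]
  rw [(integral_prod_of_iIndep hle hi (fun j => ?_) Finset.univ).2]
  · rw [symbol, Finset.mul_sum, Real.exp_sum]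
    refine Finset.prod_congr rfl fun j _ => ?_
    have hlj := Real.rpow_pos_of_pos (hlam j) (1 / ν j ^ r)
    rw [(hj j).2 _ (mul_pos hμ hlj), Real.mul_rpow hμ.le hlj.le, ← Real.rpow_mul (hlam j).le,
      one_div_mul_cancel (pow_pos (hν j) r).ne', Real.rpow_one, mul_comm (μ ^ ν j ^ r)]
  · have : Continuous fun x : ℝ≥0 => Real.exp (-(μ * lam j ^ (1 / ν j ^ r)) * (x : ℝ)) := by
      fun_prop
    exact this.comp_aestronglyMeasurable (hj j).1

lemma ae_monotone_weightedSum (hlam : ∀ j, 0 < lam j)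
    (hH : ∀ j i, IsStableSubordinator (ν j) (H j i) P) :
    ∀ᵐ ω ∂P, Monotone (weightedSum ν lam (fun j i t => H j i t ω)) := by
  have : ∀ᵐ ω ∂P, ∀ j i, Monotone (fun t => H j i t ω) :=
    ae_all_iff.2 fun j => ae_all_iff.2 fun i => (hH j i).paths.mono fun ω h => h.1
  filter_upwards [this] with ω h
  exact monotone_weightedSum hlam h

lemma ae_unbounded_weightedSum (hm : 0 < m) (hν : ∀ j, 0 < ν j) (hlam : ∀ j, 0 < lam j)
    (hH : ∀ j i, IsStableSubordinator (ν j) (H j i) P)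
    (hi : iIndep (fun p : Fin m × Fin r => processSigma (H p.1 p.2)) P) :
    ∀ᵐ ω ∂P, ∀ t : ℝ, ∃ s, t ≤ weightedSum ν lam (fun j i t => H j i t ω) s := by
  have hle : (⨆ p : Fin m × Fin r, processSigma (H p.1 p.2)) ≤ m₀ :=
    iSup_le fun p => processSigma_le (hH p.1 p.2).measurable
  have hΨ : 0 < symbol (fun j => ν j ^ r) lam 1 :=
    Finset.sum_pos (fun j _ => by simpa using hlam j) ⟨⟨0, hm⟩, Finset.mem_univ _⟩
  have key : ∀ k : ℕ, ∀ᵐ ω ∂P, ∃ s, (k : ℝ) ≤ weightedSum ν lam (fun j i t => H j i t ω) s := by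
    intro k
    rw [ae_iff, ← measureReal_eq_zero_iff]
    refine le_antisymm ?_ measureReal_nonneg
    have hlim : Tendsto (fun n : ℕ => Real.exp k *
        Real.exp (-(n : ℝ) * symbol (fun j => ν j ^ r) lam 1)) atTop (𝓝 0) := by
      rw [← mul_zero (Real.exp k)]
      refine Tendsto.const_mul _ (Real.tendsto_exp_atBot.comp ?_)
      simp only [neg_mul]
      exact tendsto_neg_atTop_atBot.comp (tendsto_natCast_atTop_atTop.atTop_mul_const hΨ)
    refine ge_of_tendsto hlim (Eventually.of_forall fun n => ?_)
    have hm1 := (aestronglyMeasurable_mono_subalgebra hle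
      (aestronglyMeasurable_weightedSum (lam := lam) hH hi (n : ℝ≥0)))
    have hint : Integrable (fun ω =>
        Real.exp (-1 * weightedSum ν lam (fun j i t => H j i t ω) (n : ℝ≥0))) P := by
      refine Integrable.of_bound ((by fun_prop : Continuous fun x : ℝ =>
        Real.exp (-1 * x)).comp_aestronglyMeasurable hm1) 1 (Eventually.of_forall fun ω => ?_)
      rw [Real.norm_of_nonneg (Real.exp_pos _).le, Real.exp_le_one_iff]
      linarith [weightedSum_nonneg (ν := ν) hlam (fun j i t => H j i t ω) (n : ℝ≥0)]
    have hmk := mul_meas_ge_le_integral_of_nonneg (Eventually.of_forall fun ω =>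
      (Real.exp_pos (-1 * weightedSum ν lam (fun j i t => H j i t ω) (n : ℝ≥0))).le) hint
      (Real.exp (-(k : ℝ)))
    rw [integral_exp_weightedSum hν hlam hH hi _ one_pos, Real.exp_neg,
      inv_mul_le_iff₀ (Real.exp_pos _)] at hmk
    refine le_trans (measureReal_mono ?_) hmk
    intro ω hω
    have hω : ¬ ∃ s, (k : ℝ) ≤ weightedSum ν lam (fun j i t => H j i t ω) s := hω
    push Not at hω
    change (Real.exp (k : ℝ))⁻¹ ≤ Real.exp _
    rw [← Real.exp_neg, Real.exp_le_exp]
    linarith [hω (n : ℝ≥0)]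
  filter_upwards [ae_all_iff.2 key] with ω h t
  obtain ⟨k, hk⟩ := exists_nat_ge t
  obtain ⟨s, hs⟩ := h k
  exact ⟨s, hk.trans hs⟩

end WeightedSum

/-! ### The inverse process -/

lemma lt_of_lt_inverseProcess {f : ℝ≥0 → ℝ} {s t : ℝ≥0} (hs : 0 < s)
    (h : s < inverseProcess f t) : f s < t := by
  by_contra! hst
  exact h.not_ge (csInf_le (OrderBot.bddBelow _) ⟨hs, hst⟩)

lemma inverseProcess_nonempty {f : ℝ≥0 → ℝ} (hf : Monotone f) (hu : ∀ t : ℝ, ∃ s, t ≤ f s)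
    (t : ℝ≥0) : {s : ℝ≥0 | 0 < s ∧ (t : ℝ) ≤ f s}.Nonempty := by
  obtain ⟨s, hs⟩ := hu t
  exact ⟨s + 1, by positivity, hs.trans (hf (by simp))⟩

lemma le_inverseProcess {f : ℝ≥0 → ℝ} (hf : Monotone f) (hu : ∀ t : ℝ, ∃ s, t ≤ f s) {s t : ℝ≥0}
    (h : f s < t) : s ≤ inverseProcess f t := by
  refine le_csInf (inverseProcess_nonempty hf hu t) fun b hb => ?_
  by_contra! hbs
  exact absurd (hb.2.trans (hf hbs.le)) (not_le.2 h)

lemma coe_inverseProcess_eq_iInf {f : ℝ≥0 → ℝ} (hf : Monotone f) (hu : ∀ t : ℝ, ∃ s, t ≤ f s)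
    (t : ℝ≥0) : (inverseProcess f t : ENNReal) =
      ⨅ q : {q : ℚ // 0 < q}, if (t : ℝ) ≤ f (q : ℝ).toNNReal then
        ((q : ℝ).toNNReal : ENNReal) else ⊤ := by
  refine le_antisymm (le_iInf fun q => ?_) (le_of_forall_gt fun x hx => ?_)
  · split_ifs with h
    · exact ENNReal.coe_le_coe.2 (csInf_le (OrderBot.bddBelow _) ⟨by simpa using q.2, h⟩)
    · exact le_top
  · obtain ⟨y, hy1, hy2⟩ := ENNReal.lt_iff_exists_nnreal_btwn.1 hx
    obtain ⟨s, hs, hsy⟩ := exists_lt_of_csInf_lt (inverseProcess_nonempty hf hu t)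
      (ENNReal.coe_lt_coe.1 hy1)
    obtain ⟨q, -, hq1, hq2⟩ := (NNReal.lt_iff_exists_rat_btwn s y).1 hsy
    have hq0 : 0 < q := by simpa using hs.1.trans hq1
    refine (iInf_le _ ⟨q, hq0⟩).trans_lt ?_
    rw [if_pos (hs.2.trans (hf hq1.le))]
    exact (ENNReal.coe_lt_coe.2 hq2).trans hy2

lemma aestronglyMeasurable_inverseProcess {m : MeasurableSpace Ω} {f : ℝ≥0 → Ω → ℝ}
    (hfm : ∀ s, AEStronglyMeasurable[m] (f s) P) (hf : ∀ᵐ ω ∂P, Monotone (fun s => f s ω))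
    (hu : ∀ᵐ ω ∂P, ∀ t : ℝ, ∃ s, t ≤ f s ω) (t : ℝ≥0) :
    AEStronglyMeasurable[m] (fun ω => inverseProcess (fun s => f s ω) t) P := by
  choose g hg hfg using hfm
  refine ⟨fun ω => (⨅ q : {q : ℚ // 0 < q},
    if (t : ℝ) ≤ g (q : ℝ).toNNReal ω then
      ((q : ℝ).toNNReal : ENNReal) else ⊤).toNNReal, ?_, ?_⟩
  · refine Measurable.stronglyMeasurable (ENNReal.measurable_toNNReal.comp ?_)
    refine Measurable.iInf fun q => Measurable.ite ?_ measurable_const measurable_const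
    exact measurableSet_le measurable_const (hg _).measurable
  · have : ∀ᵐ ω ∂P, ∀ q : ℚ, f (q : ℝ).toNNReal ω = g (q : ℝ).toNNReal ω :=
      ae_all_iff.2 fun q => hfg _
    filter_upwards [hf, hu, this] with ω h1 h2 h3
    simp only [← h3]
    rw [← coe_inverseProcess_eq_iInf h1 h2, ENNReal.toNNReal_coe]

end Subordinators

/-! ### The potential measures and the inverse process -/

lemma lintegral_exp_neg_mul_Ioi {a : ℝ} (ha : 0 < a) (x : ℝ) :
    ∫⁻ t in Ioi x, ENNReal.ofReal (Real.exp (-a * t)) = ENNReal.ofReal (Real.exp (-a * x) / a) := by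
  rw [← ofReal_integral_eq_lintegral_ofReal (integrableOn_exp_mul_Ioi (by linarith) x)
    (Eventually.of_forall fun _ => (Real.exp_pos _).le), integral_exp_mul_Ioi (by linarith)]
  congr 1
  rw [div_neg, neg_div, neg_neg]

lemma lintegral_exp_neg_mul_Ioc {a : ℝ} (ha : 0 < a) {x : ℝ} (hx : 0 ≤ x) :
    ∫⁻ t in Ioc 0 x, ENNReal.ofReal (Real.exp (-a * t)) =
      ENNReal.ofReal ((1 - Real.exp (-a * x)) / a) := by
  have hi := integrableOn_exp_mul_Ioi (a := -a) (by linarith) 0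
  rw [← ofReal_integral_eq_lintegral_ofReal (hi.mono_set Ioc_subset_Ioi_self)
    (Eventually.of_forall fun _ => (Real.exp_pos _).le)]
  have h := setIntegral_union (μ := volume) (f := fun t => Real.exp (-a * t))
    (Ioc_disjoint_Ioi le_rfl) measurableSet_Ioi (hi.mono_set (t := Ioi 0) (s := Ioc 0 x) fun _ h => h.1)
    (hi.mono_set (Ioi_subset_Ioi hx))
  rw [Ioc_union_Ioi_eq_Ioi hx, integral_exp_mul_Ioi (by linarith),
    integral_exp_mul_Ioi (by linarith)] at h
  congr 1
  rw [eq_comm, ← eq_sub_iff_add_eq] at h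
  rw [h, mul_zero, Real.exp_zero]
  field_simp

/-- The measure with density `exp (-κ s)` on `(0, ∞)`. -/
def expMeas (κ : ℝ) : Measure ℝ :=
  (volume.restrict (Ioi 0)).withDensity fun s => ENNReal.ofReal (Real.exp (-κ * s))

lemma lintegral_expMeas (κ : ℝ) (g : ℝ → ENNReal) :
    ∫⁻ s, g s ∂(expMeas κ) = ∫⁻ s in Ioi (0 : ℝ), ENNReal.ofReal (Real.exp (-κ * s)) * g s :=
  lintegral_withDensity_eq_lintegral_mul_non_measurable _ (by fun_prop)
    (Eventually.of_forall fun _ => ENNReal.ofReal_lt_top) g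

lemma lintegral_expMeas_mono {κ κ' : ℝ} (h : κ' ≤ κ) (g : ℝ → ENNReal) :
    ∫⁻ s, g s ∂(expMeas κ) ≤ ∫⁻ s, g s ∂(expMeas κ') := by
  rw [lintegral_expMeas, lintegral_expMeas]
  refine setLIntegral_mono_ae' measurableSet_Ioi (Eventually.of_forall fun s hs => ?_)
  gcongr
  have hs : 0 < s := hs
  nlinarith

lemma expMeas_univ {κ : ℝ} (hκ : 0 < κ) : expMeas κ univ = ENNReal.ofReal (1 / κ) := by
  rw [← lintegral_one, lintegral_expMeas]
  simpa using lintegral_exp_neg_mul_Ioi hκ 0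

lemma isFiniteMeasure_expMeas {κ : ℝ} (hκ : 0 < κ) : IsFiniteMeasure (expMeas κ) :=
  ⟨by rw [expMeas_univ hκ]; exact ENNReal.ofReal_lt_top⟩

/-- `Monotone` functions that agree a.e. on `(0, ∞)` with a continuous function agree with it
everywhere on `(0, ∞)`. -/
lemma eq_of_monotone_of_ae_eq {M N : ℝ → ℝ} (hM : Monotone M) (hN : ContinuousOn N (Ioi 0))
    (h : ∀ᵐ t, t ∈ Ioi (0 : ℝ) → M t = N t) {t : ℝ} (ht : 0 < t) : M t = N t := by
  have hNt : Tendsto N (𝓝 t) (𝓝 (N t)) := hN.continuousAt (Ioi_mem_nhds ht)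
  have key : ∀ a b : ℝ, 0 < a → a < b → ∃ s ∈ Ioo a b, M s = N s := by
    intro a b ha hab
    by_contra! hne
    have h0 : volume (Ioo a b) = 0 := by
      refine measure_mono_null (fun s hs => ?_) (ae_iff.1 h)
      exact fun hc => hne s hs (hc (ha.trans hs.1))
    rw [Real.volume_Ioo, ENNReal.ofReal_eq_zero] at h0
    linarith
  refine le_antisymm (le_of_forall_pos_le_add fun ε hε => ?_)
    (le_of_forall_pos_le_add fun ε hε => ?_)
  · obtain ⟨δ, hδ, hδ'⟩ := Metric.tendsto_nhds_nhds.1 hNt ε hε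
    obtain ⟨s, hs, hMs⟩ := key t (t + δ) ht (by linarith)
    have h1 := hδ' (x := s) (by rw [Real.dist_eq, abs_of_pos (by linarith [hs.1])]; linarith [hs.2])
    rw [Real.dist_eq] at h1
    have h2 := hM hs.1.le
    linarith [(abs_lt.1 h1).2]
  · obtain ⟨δ, hδ, hδ'⟩ := Metric.tendsto_nhds_nhds.1 hNt ε hε
    obtain ⟨s, hs, hMs⟩ := key (max (t / 2) (t - δ)) t (by positivity) (by simp [ht, hδ])
    have hs1 := (le_max_right (t / 2) (t - δ)).trans_lt hs.1
    have h1 := hδ' (x := s) (by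
      rw [Real.dist_eq, abs_of_neg (by linarith [hs.2])]; linarith)
    rw [Real.dist_eq] at h1
    have h2 := hM hs.2.le
    linarith [(abs_lt.1 h1).1]

section InverseProcess

variable {Ω : Type*} [m₀ : MeasurableSpace Ω] {P : Measure Ω} {J : Type*} [Fintype J]
  {α lam : J → ℝ} {f : ℝ≥0 → Ω → ℝ}

/-- A nonnegative nondecreasing unbounded process whose one-dimensional laws have the Laplace
transforms `μ ↦ exp (-s * symbol α lam μ)`. -/
structure IsIncreasingProcess (α lam : J → ℝ) (f : ℝ≥0 → Ω → ℝ) (P : Measure Ω) : Prop where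
  aemeasurable : ∀ s, AEMeasurable (f s) P
  nonneg : ∀ s ω, 0 ≤ f s ω
  mono : ∀ᵐ ω ∂P, Monotone (fun s => f s ω)
  unbounded : ∀ᵐ ω ∂P, ∀ t : ℝ, ∃ s, t ≤ f s ω
  laplace : ∀ (s : ℝ≥0) (μ : ℝ), 0 < μ →
    ∫ ω, Real.exp (-μ * f s ω) ∂P = Real.exp (-(s : ℝ) * symbol α lam μ)

/-- The law at time `s` of a process. -/
def timeLaw (f : ℝ≥0 → Ω → ℝ) (P : Measure Ω) (s : ℝ) : Measure ℝ := P.map (f s.toNNReal)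

/-- The `κ`-potential measure of a process. -/
def potential (f : ℝ≥0 → Ω → ℝ) (P : Measure Ω) (κ : ℝ) : Measure ℝ :=
  (expMeas κ).bind (timeLaw f P)

namespace IsIncreasingProcess

variable [IsProbabilityMeasure P]

lemma timeLaw_Iio (hf : IsIncreasingProcess α lam f P) (s t : ℝ) :
    timeLaw f P s (Iio t) = P {ω | f s.toNNReal ω < t} :=
  Measure.map_apply_of_aemeasurable (hf.aemeasurable _) measurableSet_Iio

lemma measurable_timeLaw (hf : IsIncreasingProcess α lam f P) : Measurable (timeLaw f P) := by
  have (s : ℝ) : IsProbabilityMeasure (timeLaw f P s) :=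
    Measure.isProbabilityMeasure_map (hf.aemeasurable _)
  refine .measure_of_isPiSystem_of_isProbabilityMeasure (borel_eq_generateFrom_Iio ℝ)
    isPiSystem_Iio ?_
  rintro _ ⟨t, rfl⟩
  refine Antitone.measurable fun s s' hss => ?_
  simp only [hf.timeLaw_Iio]
  refine measure_mono_ae ?_
  filter_upwards [hf.mono] with ω h h1
  exact (h (Real.toNNReal_le_toNNReal hss)).trans_lt h1

lemma potential_apply (hf : IsIncreasingProcess α lam f P) (κ : ℝ) {B : Set ℝ}
    (hB : MeasurableSet B) : potential f P κ B = ∫⁻ s, timeLaw f P s B ∂(expMeas κ) :=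
  Measure.bind_apply hB hf.measurable_timeLaw.aemeasurable

lemma potential_univ (hf : IsIncreasingProcess α lam f P) {κ : ℝ} (hκ : 0 < κ) :
    potential f P κ univ = ENNReal.ofReal (1 / κ) := by
  have (s : ℝ) : IsProbabilityMeasure (timeLaw f P s) :=
    Measure.isProbabilityMeasure_map (hf.aemeasurable _)
  rw [hf.potential_apply κ MeasurableSet.univ]
  simp [expMeas_univ hκ]

lemma isFiniteMeasure_potential (hf : IsIncreasingProcess α lam f P) {κ : ℝ} (hκ : 0 < κ) :
    IsFiniteMeasure (potential f P κ) :=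
  ⟨by rw [hf.potential_univ hκ]; exact ENNReal.ofReal_lt_top⟩

lemma potential_mono (hf : IsIncreasingProcess α lam f P) {κ κ' : ℝ} (h : κ' ≤ κ) {B : Set ℝ}
    (hB : MeasurableSet B) : potential f P κ B ≤ potential f P κ' B := by
  rw [hf.potential_apply κ hB, hf.potential_apply κ' hB]
  exact lintegral_expMeas_mono h _

lemma potential_Iio_zero (hf : IsIncreasingProcess α lam f P) (κ : ℝ) :
    potential f P κ (Iio 0) = 0 := by
  rw [hf.potential_apply κ measurableSet_Iio]
  simp [hf.timeLaw_Iio, not_lt.2 (hf.nonneg _ _)]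

lemma lintegral_exp_timeLaw (hf : IsIncreasingProcess α lam f P) {s μ : ℝ} (hs : 0 ≤ s)
    (hμ : 0 < μ) : ∫⁻ x, ENNReal.ofReal (Real.exp (-μ * x)) ∂(timeLaw f P s) =
      ENNReal.ofReal (Real.exp (-symbol α lam μ * s)) := by
  rw [timeLaw, lintegral_map' (by fun_prop) (hf.aemeasurable _),
    ← ofReal_integral_eq_lintegral_ofReal, hf.laplace _ μ hμ, Real.coe_toNNReal _ hs]
  · ring_nf
  · refine Integrable.of_bound
      ((hf.aemeasurable _).const_mul (-μ)).exp.aestronglyMeasurable 1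
      (Eventually.of_forall fun ω => ?_)
    rw [Real.norm_of_nonneg (Real.exp_pos _).le, Real.exp_le_one_iff]
    nlinarith [mul_nonneg hμ.le (hf.nonneg s.toNNReal ω)]
  · exact Eventually.of_forall fun _ => (Real.exp_pos _).le

lemma lintegral_exp_potential (hf : IsIncreasingProcess α lam f P) {κ μ : ℝ} (hκ : 0 < κ)
    (hμ : 0 < μ) (hΨ : 0 < symbol α lam μ) :
    ∫⁻ x, ENNReal.ofReal (Real.exp (-μ * x)) ∂(potential f P κ) =
      ENNReal.ofReal (1 / (symbol α lam μ + κ)) := by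
  rw [potential, Measure.lintegral_bind hf.measurable_timeLaw.aemeasurable (by fun_prop),
    lintegral_expMeas]
  have : ∀ s ∈ Ioi (0 : ℝ), ENNReal.ofReal (Real.exp (-κ * s)) *
      ∫⁻ x, ENNReal.ofReal (Real.exp (-μ * x)) ∂(timeLaw f P s) =
      ENNReal.ofReal (Real.exp (-(symbol α lam μ + κ) * s)) := fun s hs => by
    rw [hf.lintegral_exp_timeLaw (le_of_lt hs) hμ, ← ENNReal.ofReal_mul (Real.exp_pos _).le,
      ← Real.exp_add]
    ring_nf
  rw [setLIntegral_congr_fun measurableSet_Ioi this, lintegral_exp_neg_mul_Ioi (by linarith)]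
  simp

/-- The Laplace transform of the distribution function of the potential measure. -/
lemma lintegral_exp_mul_potential_Iio (hf : IsIncreasingProcess α lam f P) {κ μ : ℝ} (hκ : 0 < κ)
    (hμ : 0 < μ) (hΨ : 0 < symbol α lam μ) :
    ∫⁻ t in Ioi (0 : ℝ), ENNReal.ofReal (Real.exp (-μ * t)) * potential f P κ (Iio t) =
      ENNReal.ofReal (1 / (μ * (symbol α lam μ + κ))) := by
  have := hf.isFiniteMeasure_potential hκ
  have h1 : ∀ t, ENNReal.ofReal (Real.exp (-μ * t)) * potential f P κ (Iio t) =
      ∫⁻ x, (Ioi x).indicator (fun t => ENNReal.ofReal (Real.exp (-μ * t))) t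
        ∂(potential f P κ) := fun t => by
    rw [← lintegral_indicator_const measurableSet_Iio]
    rfl
  have hmeas : Measurable fun p : ℝ × ℝ =>
      (Ioi p.2).indicator (fun t => ENNReal.ofReal (Real.exp (-μ * t))) p.1 := by
    have : (fun p : ℝ × ℝ => (Ioi p.2).indicator (fun t => ENNReal.ofReal (Real.exp (-μ * t))) p.1)
        = {p : ℝ × ℝ | p.2 < p.1}.indicator fun p => ENNReal.ofReal (Real.exp (-μ * p.1)) := rfl
    rw [this]
    exact Measurable.indicator (by fun_prop) (measurableSet_lt measurable_snd measurable_fst)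
  simp only [h1]
  rw [lintegral_lintegral_swap hmeas.aemeasurable]
  have h2 : ∀ᵐ x ∂(potential f P κ), ∫⁻ t in Ioi (0 : ℝ),
      (Ioi x).indicator (fun t => ENNReal.ofReal (Real.exp (-μ * t))) t =
      ENNReal.ofReal (1 / μ) * ENNReal.ofReal (Real.exp (-μ * x)) := by
    have h0 : ∀ᵐ x ∂(potential f P κ), 0 ≤ x := by
      rw [ae_iff]
      simp only [not_le]
      exact hf.potential_Iio_zero κ
    filter_upwards [h0] with x hx
    rw [setLIntegral_indicator measurableSet_Ioi, Ioi_inter_Ioi, sup_eq_left.2 hx,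
      lintegral_exp_neg_mul_Ioi hμ, ← ENNReal.ofReal_mul (by positivity)]
    ring_nf
  rw [lintegral_congr_ae h2, lintegral_const_mul _ (by fun_prop),
    hf.lintegral_exp_potential hκ hμ hΨ, ← ENNReal.ofReal_mul (by positivity)]
  congr 1
  field_simp

lemma monotone_potential_Iio (hf : IsIncreasingProcess α lam f P) {κ : ℝ} (hκ : 0 < κ) :
    Monotone fun t => (potential f P κ).real (Iio t) := by
  have := hf.isFiniteMeasure_potential hκ
  exact fun s t hst => measureReal_mono (Iio_subset_Iio hst)

/-- The distribution function of the potential measure is given by the resolvent series. -/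
lemma potential_Iio_eq {A : ℝ} (hA : IsLeadOrder α lam A) (hf : IsIncreasingProcess α lam f P)
    {κ t : ℝ} (hκ : 0 < κ) (ht : 0 < t) :
    (potential f P κ).real (Iio t) = relaxSeries α lam A κ (1 + A) t := by
  have hfin := hf.isFiniteMeasure_potential hκ
  have hmono := hf.monotone_potential_Iio hκ
  refine eq_of_monotone_of_ae_eq hmono
    (hA.continuousOn_relaxSeries hκ.le (by linarith [hA.lead_pos])) ?_ ht
  obtain ⟨a, ha, hlap⟩ := hA.exists_laplace_relaxSeries hκ.le
  have hM : ∀ μ, a ≤ μ →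
      IntegrableOn (fun t => Real.exp (-μ * t) * (potential f P κ).real (Iio t)) (Ioi 0) ∧
      ∫ t in Ioi (0 : ℝ), Real.exp (-μ * t) * (potential f P κ).real (Iio t) =
        1 / (μ * (symbol α lam μ + κ)) := by
    intro μ hμ
    have hμ0 : 0 < μ := ha.trans_le hμ
    have hΨ := hA.symbol_pos hμ0
    have hint : ∫⁻ t in Ioi (0 : ℝ),
        ENNReal.ofReal (Real.exp (-μ * t) * (potential f P κ).real (Iio t)) =
        ENNReal.ofReal (1 / (μ * (symbol α lam μ + κ))) := by
      rw [← hf.lintegral_exp_mul_potential_Iio hκ hμ0 hΨ]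
      refine lintegral_congr fun t => ?_
      rw [ENNReal.ofReal_mul (Real.exp_pos _).le, ofReal_measureReal]
    have hm : AEStronglyMeasurable (fun t => Real.exp (-μ * t) *
        (potential f P κ).real (Iio t)) (volume.restrict (Ioi 0)) :=
      ((by fun_prop : Measurable fun t : ℝ => Real.exp (-μ * t)).mul
        hmono.measurable).aestronglyMeasurable
    have hpos : 0 ≤ᵐ[volume.restrict (Ioi 0)] fun t =>
        Real.exp (-μ * t) * (potential f P κ).real (Iio t) :=
      Eventually.of_forall fun t => mul_nonneg (Real.exp_pos _).le measureReal_nonneg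
    refine ⟨(lintegral_ofReal_ne_top_iff_integrable hm hpos).1
      (by rw [hint]; exact ENNReal.ofReal_ne_top), ?_⟩
    rw [integral_eq_lintegral_of_nonneg_ae hpos hm, hint, ENNReal.toReal_ofReal (by positivity)]
  have := ae_eq_zero_of_laplace_eq_zero (a := a)
    (f := fun t => (potential f P κ).real (Iio t) - relaxSeries α lam A κ (1 + A) t) ?_ ?_
  · filter_upwards [this] with t h1 h2
    exact sub_eq_zero.1 (h1 h2)
  · simp only [smul_eq_mul, mul_sub]
    exact (hM a le_rfl).1.sub (hlap a le_rfl).1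
  · intro μ hμ
    simp only [smul_eq_mul, mul_sub]
    rw [integral_sub (hM μ hμ).1 (hlap μ hμ).1, (hM μ hμ).2, (hlap μ hμ).2, sub_self]

lemma relaxSeries_nonneg {A : ℝ} (hA : IsLeadOrder α lam A) (hf : IsIncreasingProcess α lam f P)
    {κ t : ℝ} (hκ : 0 < κ) (ht : 0 < t) : 0 ≤ relaxSeries α lam A κ A t := by
  refine (hA.hasDerivAt_relaxSeries hκ.le hA.lead_pos ht).hasDerivWithinAt.nonneg_of_monotoneOn
    (s := Ioi 0) ?_ fun a ha b hb hab => ?_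
  · exact accPt_principal_iff_nhdsWithin.2 (by
      rw [sdiff_eq, inter_comm, nhdsWithin_inter_of_mem' (mem_nhdsWithin_of_mem_nhds (Ioi_mem_nhds ht))]
      infer_instance)
  · rw [← hf.potential_Iio_eq hA hκ ha, ← hf.potential_Iio_eq hA hκ hb]
    exact hf.monotone_potential_Iio hκ hab

lemma relaxSeries_anti {A : ℝ} (hA : IsLeadOrder α lam A) (hf : IsIncreasingProcess α lam f P)
    {κ κ' t : ℝ} (hκ' : 0 < κ') (h : κ' ≤ κ) (ht : 0 < t) :
    relaxSeries α lam A κ A t ≤ relaxSeries α lam A κ' A t := by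
  have hκ : 0 < κ := hκ'.trans_le h
  have hfin := hf.isFiniteMeasure_potential hκ
  have hfin' := hf.isFiniteMeasure_potential hκ'
  rw [← sub_nonneg]
  refine ((hA.hasDerivAt_relaxSeries hκ'.le hA.lead_pos ht).sub
    (hA.hasDerivAt_relaxSeries hκ.le hA.lead_pos ht)).hasDerivWithinAt.nonneg_of_monotoneOn
    (s := Ioi 0) ?_ fun a ha b hb hab => ?_
  · exact accPt_principal_iff_nhdsWithin.2 (by
      rw [sdiff_eq, inter_comm, nhdsWithin_inter_of_mem' (mem_nhdsWithin_of_mem_nhds (Ioi_mem_nhds ht))]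
      infer_instance)
  · simp only [Pi.sub_apply]
    rw [← hf.potential_Iio_eq hA hκ ha, ← hf.potential_Iio_eq hA hκ hb,
      ← hf.potential_Iio_eq hA hκ' ha, ← hf.potential_Iio_eq hA hκ' hb]
    have hd : ∀ (ρ : Measure ℝ) [IsFiniteMeasure ρ],
        ρ.real (Iio b) = ρ.real (Iio a) + ρ.real (Ico a b) := fun ρ _ => by
      rw [← Iio_union_Ico_eq_Iio hab, measureReal_union _ measurableSet_Ico]
      exact Set.disjoint_left.2 fun x hx hx' => hx'.1.not_gt hx
    rw [hd (potential f P κ), hd (potential f P κ')]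
    have : (potential f P κ).real (Ico a b) ≤ (potential f P κ').real (Ico a b) :=
      ENNReal.toReal_mono (measure_ne_top _ _) (hf.potential_mono h measurableSet_Ico)
    linarith

/-- A bound of the densities of the potential measures that is uniform in `κ`. -/
lemma exists_abs_relaxSeries_le {A : ℝ} (hA : IsLeadOrder α lam A)
    (hf : IsIncreasingProcess α lam f P) {T : ℝ} (hT : 0 < T) :
    ∃ C, 0 ≤ C ∧ ∀ κ, 0 ≤ κ → ∀ t, 0 < t → t ≤ T →
      |relaxSeries α lam A κ A t| ≤ C * t ^ (A - 1) := by
  obtain ⟨C, hC, h⟩ := hA.exists_abs_relaxSeries_le 1 zero_le_one hA.lead_pos hT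
  refine ⟨C, hC, fun κ hκ t ht htT => ?_⟩
  rcases le_total κ 1 with h1 | h1
  · exact h κ hκ h1 t ht htT
  · rw [abs_of_nonneg (hf.relaxSeries_nonneg hA (by linarith) ht)]
    exact (hf.relaxSeries_anti hA one_pos h1 ht).trans
      ((le_abs_self _).trans (h 1 zero_le_one le_rfl t ht htT))

lemma lintegral_expMeas_measure_lt (L : Ω → ℝ≥0) (hL : AEMeasurable L P) {κ : ℝ} (hκ : 0 < κ)
    (R : ℝ → ℝ → Prop) (hR : MeasurableSet {p : ℝ × ℝ | R p.1 p.2})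
    (hlt : ∀ s x, s < x → R s x) (hle : ∀ s x, R s x → s ≤ x) :
    ∫⁻ s, P {ω | R s (L ω)} ∂(expMeas κ) =
      ∫⁻ ω, ENNReal.ofReal ((1 - Real.exp (-κ * (L ω : ℝ))) / κ) ∂P := by
  obtain ⟨L', hL', hLL'⟩ := hL
  have := isFiniteMeasure_expMeas hκ
  have h1 : ∀ s, P {ω | R s (L ω)} = ∫⁻ ω, {ω | R s (L' ω)}.indicator 1 ω ∂P := fun s => by
    rw [lintegral_indicator_one]
    · refine measure_congr ?_
      filter_upwards [hLL'] with ω h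
      exact congrArg (fun x : ℝ≥0 => R s x) h
    · exact (measurable_const.prodMk hL'.coe_nnreal_real) hR
  have h2 : ∫⁻ ω, ENNReal.ofReal ((1 - Real.exp (-κ * (L ω : ℝ))) / κ) ∂P =
      ∫⁻ ω, ENNReal.ofReal ((1 - Real.exp (-κ * (L' ω : ℝ))) / κ) ∂P :=
    lintegral_congr_ae (hLL'.mono fun ω h => by simp only [h])
  simp only [h1]
  rw [h2, lintegral_lintegral_swap]
  · refine lintegral_congr fun ω => ?_
    have h3 : ∀ s, {ω | R s (L' ω)}.indicator (1 : Ω → ENNReal) ω =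
        {s | R s (L' ω)}.indicator 1 s := fun s => rfl
    have hms : MeasurableSet {s | R s (L' ω)} := (measurable_id.prodMk measurable_const) hR
    simp only [h3]
    rw [lintegral_indicator_one hms, expMeas, withDensity_apply _ hms,
      ← lintegral_exp_neg_mul_Ioc hκ (NNReal.coe_nonneg _), Measure.restrict_restrict hms]
    refine setLIntegral_congr ?_
    have hlast : ∀ᵐ s : ℝ, s ≠ L' ω := by simp [ae_iff]
    filter_upwards [hlast] with s hs
    refine propext ⟨fun h => ⟨h.2, hle _ _ h.1⟩, fun h => ⟨hlt _ _ (lt_of_le_of_ne h.2 hs), h.1⟩⟩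
  · refine Measurable.aemeasurable ?_
    have : Function.uncurry (fun (s : ℝ) ω => {ω | R s (L' ω)}.indicator (1 : Ω → ENNReal) ω) =
      {p : ℝ × Ω | R p.1 (L' p.2)}.indicator 1 := rfl
    rw [this]
    exact measurable_one.indicator
      ((measurable_fst.prodMk (hL'.coe_nnreal_real.comp measurable_snd)) hR)

/-- The Laplace transform of the inverse process. -/
lemma integral_exp_inverseProcess {A : ℝ} (hA : IsLeadOrder α lam A)
    (hf : IsIncreasingProcess α lam f P) {κ : ℝ} (hκ : 0 ≤ κ) (t : ℝ≥0) :
    ∫ ω, Real.exp (-κ * (inverseProcess (fun s => f s ω) t : ℝ)) ∂P =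
      1 - κ * relaxSeries α lam A κ (1 + A) t := by
  rcases hκ.eq_or_lt with rfl | hκ
  · simp
  rcases (zero_le (a := t)).eq_or_lt with rfl | ht
  · have h0 : ∀ ω, inverseProcess (fun s => f s ω) 0 = 0 := fun ω => by
      have : {s : ℝ≥0 | 0 < s ∧ ((0 : ℝ≥0) : ℝ) ≤ f s ω} = Ioi 0 := by
        ext s
        simp [hf.nonneg]
      rw [inverseProcess, this, csInf_Ioi]
    simp [h0, IsLeadOrder.relaxSeries_of_nonpos]
  have ht' : (0 : ℝ) < t := ht
  set L : Ω → ℝ≥0 := fun ω => inverseProcess (fun s => f s ω) t with hL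
  have hLm : AEMeasurable L P := (aestronglyMeasurable_inverseProcess (m := m₀)
    (fun s => (hf.aemeasurable s).aestronglyMeasurable) hf.mono hf.unbounded t).aemeasurable
  have hb1 := lintegral_expMeas_measure_lt (P := P) L hLm hκ (fun s x => s < x)
    (measurableSet_lt measurable_fst measurable_snd) (fun _ _ h => h) (fun _ _ h => h.le)
  have hb2 := lintegral_expMeas_measure_lt (P := P) L hLm hκ (fun s x => s ≤ x)
    (measurableSet_le measurable_fst measurable_snd) (fun _ _ h => h.le) (fun _ _ h => h)
  have hpos : ∀ᵐ s ∂(expMeas κ), 0 < s := by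
    rw [expMeas]
    exact (withDensity_absolutelyContinuous _ _).ae_le (ae_restrict_mem measurableSet_Ioi)
  have hle1 : ∫⁻ s, P {ω | s < (L ω : ℝ)} ∂(expMeas κ) ≤ potential f P κ (Iio t) := by
    rw [hf.potential_apply κ measurableSet_Iio]
    refine lintegral_mono_ae ?_
    filter_upwards [hpos] with s hs
    rw [hf.timeLaw_Iio]
    refine measure_mono fun ω hω => ?_
    refine lt_of_lt_inverseProcess (f := fun s => f s ω) (t := t) (by simpa using hs) ?_
    exact (Real.toNNReal_lt_iff_lt_coe hs.le).2 hω
  have hle2 : potential f P κ (Iio t) ≤ ∫⁻ s, P {ω | s ≤ (L ω : ℝ)} ∂(expMeas κ) := by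
    rw [hf.potential_apply κ measurableSet_Iio]
    refine lintegral_mono fun s => ?_
    rw [hf.timeLaw_Iio]
    refine measure_mono_ae ?_
    filter_upwards [hf.mono, hf.unbounded] with ω h1 h2 h3
    exact Real.toNNReal_le_iff_le_coe.1 (le_inverseProcess h1 h2 h3)
  rw [hb1] at hle1
  rw [hb2] at hle2
  have heq := le_antisymm hle1 hle2
  have hei : Integrable (fun ω => Real.exp (-κ * (L ω : ℝ))) P := by
    refine Integrable.of_bound
      ((hLm.coe_nnreal_real.const_mul _).exp.aestronglyMeasurable) 1
      (Eventually.of_forall fun ω => norm_exp_neg_mul_le_one hκ.le _)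
  have hdi : Integrable (fun ω => (1 - Real.exp (-κ * (L ω : ℝ))) / κ) P :=
    ((integrable_const (1 : ℝ)).sub hei).div_const κ
  rw [← ofReal_integral_eq_lintegral_ofReal hdi
    (Eventually.of_forall fun ω => div_nonneg (sub_nonneg.2
      ((le_abs_self _).trans (norm_exp_neg_mul_le_one hκ.le _))) hκ.le), integral_div,
    integral_sub (integrable_const _) hei] at heq
  simp only [integral_const, probReal_univ, one_smul] at heq
  have hnn : 0 ≤ (1 - ∫ ω, Real.exp (-κ * (L ω : ℝ)) ∂P) / κ := by
    refine div_nonneg (sub_nonneg.2 ?_) hκ.le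
    calc _ ≤ ∫ ω, (1 : ℝ) ∂P := integral_mono hei (integrable_const _) fun ω =>
          (le_abs_self _).trans (norm_exp_neg_mul_le_one hκ.le _)
      _ = 1 := by simp
  rw [← hf.potential_Iio_eq hA hκ ht', measureReal_def, ← heq]
  rw [ENNReal.toReal_ofReal hnn, mul_div_cancel₀ _ hκ.ne', sub_sub_cancel]

end IsIncreasingProcess

end InverseProcess

/-! ### Superpositions of relaxation functions -/

section Superposition

variable {J : Type*} [Fintype J] {α lam : J → ℝ} {A : ℝ}

/-- The relaxation function, with Laplace transform
`symbol α lam μ / (μ * (symbol α lam μ + κ))`. -/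
def relaxation (α lam : J → ℝ) (A κ t : ℝ) : ℝ := 1 - κ * relaxSeries α lam A κ (1 + A) t

/-- Bounds of the relaxation functions that are uniform in `κ`. -/
structure RelaxationBounds (α lam : J → ℝ) (A : ℝ) : Prop where
  lead : IsLeadOrder α lam A
  abs_le_one : ∀ κ, 0 ≤ κ → ∀ t, 0 ≤ t → |relaxation α lam A κ t| ≤ 1
  density_le : ∀ T, 0 < T → ∃ C, 0 ≤ C ∧ ∀ κ, 0 ≤ κ → ∀ t, 0 < t → t ≤ T →
      |relaxSeries α lam A κ A t| ≤ C * t ^ (A - 1)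

lemma continuousOn_relaxation (hA : IsLeadOrder α lam A) {κ : ℝ} (hκ : 0 ≤ κ) :
    ContinuousOn (relaxation α lam A κ) (Ici 0) := by
  refine continuousOn_const.sub (continuousOn_const.mul fun t ht => ?_)
  rcases (show (0 : ℝ) ≤ t from ht).eq_or_lt with rfl | ht
  · obtain ⟨C, hC, h⟩ := hA.exists_abs_relaxSeries_le κ hκ (b := 1 + A)
      (by linarith [hA.lead_pos]) one_pos
    have h0 : Tendsto (fun t : ℝ => C * t ^ A) (𝓝[≥] 0) (𝓝 0) := by
      have := (Real.continuousAt_rpow_const 0 A (Or.inr hA.lead_pos.le)).tendsto.const_mul C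
      rw [Real.zero_rpow hA.lead_pos.ne', mul_zero] at this
      exact this.mono_left nhdsWithin_le_nhds
    rw [ContinuousWithinAt, IsLeadOrder.relaxSeries_of_nonpos _ _ _ _ _ le_rfl]
    refine squeeze_zero_norm' ?_ h0
    have h1 : ∀ᶠ t in 𝓝[≥] (0 : ℝ), t ≤ 1 := nhdsWithin_le_nhds (Iic_mem_nhds one_pos)
    filter_upwards [h1, self_mem_nhdsWithin] with t ht1 ht
    rcases (show (0 : ℝ) ≤ t from ht).eq_or_lt with rfl | ht
    · simp [IsLeadOrder.relaxSeries_of_nonpos, Real.zero_rpow hA.lead_pos.ne']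
    · simpa using h κ hκ le_rfl t ht ht1
  · exact (hA.hasDerivAt_relaxSeries hκ hA.lead_pos ht).continuousAt.continuousWithinAt

lemma hasDerivAt_relaxation (hA : IsLeadOrder α lam A) {κ t : ℝ} (hκ : 0 ≤ κ) (ht : 0 < t) :
    HasDerivAt (relaxation α lam A κ) (-(κ * relaxSeries α lam A κ A t)) t :=
  ((hA.hasDerivAt_relaxSeries hκ hA.lead_pos ht).const_mul κ).const_sub 1

lemma measurable_relaxation_comp (hA : IsLeadOrder α lam A) {X : Type*} [MeasurableSpace X]
    {k : X → ℝ} (hk : Measurable k) (hk0 : ∀ x, 0 ≤ k x) (t : ℝ) :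
    Measurable fun x => relaxation α lam A (k x) t :=
  measurable_const.sub (hk.mul ((hA.measurable_relaxSeries_comp hk hk0
    (show 0 < 1 + A by linarith [hA.lead_pos])).comp (measurable_id.prodMk measurable_const)))

variable {X : Type*} [MeasurableSpace X] {ρ : Measure X} {k : X → ℝ} {h : X → ℂ}

/-- The superposition of the relaxation functions `relaxation α lam A (k x)` with weights `h x`. -/
def superposition (α lam : J → ℝ) (A : ℝ) (ρ : Measure X) (k : X → ℝ) (h : X → ℂ) (t : ℝ) : ℂ :=
  ∫ x, h x * (relaxation α lam A (k x) t : ℂ) ∂ρ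

lemma integrable_mul_relaxation (hR : RelaxationBounds α lam A) (hk : Measurable k)
    (hk0 : ∀ x, 0 ≤ k x) (hh : Integrable h ρ) {t : ℝ} (ht : 0 ≤ t) :
    Integrable (fun x => h x * (relaxation α lam A (k x) t : ℂ)) ρ := by
  refine hh.mul_bdd (c := 1)
    (measurable_relaxation_comp hR.lead hk hk0 t).complex_ofReal.aestronglyMeasurable
    (Eventually.of_forall fun x => ?_)
  rw [Complex.norm_real]
  exact hR.abs_le_one _ (hk0 x) t ht

lemma continuousOn_superposition (hR : RelaxationBounds α lam A) (hk : Measurable k)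
    (hk0 : ∀ x, 0 ≤ k x) (hh : Integrable h ρ) :
    ContinuousOn (superposition α lam A ρ k h) (Ici 0) := by
  refine fun t ht => continuousWithinAt_of_dominated (bound := fun x => ‖h x‖) ?_ ?_ hh.norm ?_
  · filter_upwards [self_mem_nhdsWithin] with s hs
    exact (integrable_mul_relaxation hR hk hk0 hh hs).aestronglyMeasurable
  · filter_upwards [self_mem_nhdsWithin] with s hs
    refine Eventually.of_forall fun x => ?_
    rw [norm_mul, Complex.norm_real]
    exact mul_le_of_le_one_right (norm_nonneg _) (hR.abs_le_one _ (hk0 x) s hs)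
  · refine Eventually.of_forall fun x => continuousWithinAt_const.mul ?_
    exact Complex.continuous_ofReal.continuousAt.comp_continuousWithinAt
      (continuousOn_relaxation hR.lead (hk0 x) t ht)

/-- The time derivative of a superposition of relaxation functions. -/
lemma hasDerivAt_superposition (hR : RelaxationBounds α lam A) (hk : Measurable k)
    (hk0 : ∀ x, 0 ≤ k x) (hh : Integrable h ρ) (hkh : Integrable (fun x => (k x : ℂ) * h x) ρ)
    {t : ℝ} (ht : 0 < t) :
    Integrable (fun x => (k x : ℂ) * h x * (relaxSeries α lam A (k x) A t : ℂ)) ρ ∧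
    HasDerivAt (superposition α lam A ρ k h)
      (-∫ x, (k x : ℂ) * h x * (relaxSeries α lam A (k x) A t : ℂ) ∂ρ) t := by
  obtain ⟨C, hC, hle⟩ := hR.density_le (2 * t) (by positivity)
  have hm : Measurable fun x => (relaxSeries α lam A (k x) A t : ℂ) :=
    ((hR.lead.measurable_relaxSeries_comp hk hk0 hR.lead.lead_pos).comp
      (measurable_id.prodMk measurable_const)).complex_ofReal
  have hmain := hasDerivAt_integral_of_dominated_loc_of_deriv_le (μ := ρ) (x₀ := t)
    (s := Ioo (t / 2) (2 * t))
    (F := fun t x => h x * (relaxation α lam A (k x) t : ℂ))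
    (F' := fun t x => -((k x : ℂ) * h x * (relaxSeries α lam A (k x) A t : ℂ)))
    (bound := fun x => ‖(k x : ℂ) * h x‖ * (C * ((t / 2) ^ (A - 1) + (2 * t) ^ (A - 1))))
    (Ioo_mem_nhds (by linarith) (by linarith)) ?_
    (integrable_mul_relaxation hR hk hk0 hh ht.le)
    (hkh.aestronglyMeasurable.mul hm.aestronglyMeasurable).neg ?_ (hkh.norm.mul_const _) ?_
  · rw [integral_neg] at hmain
    refine ⟨?_, hmain.2⟩
    simpa using hmain.1.neg
  · filter_upwards [Ioi_mem_nhds ht] with s hs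
    exact (integrable_mul_relaxation hR hk hk0 hh (le_of_lt hs)).aestronglyMeasurable
  · refine Eventually.of_forall fun x s hs => ?_
    have hs0 : 0 < s := lt_trans (by positivity) hs.1
    rw [norm_neg, norm_mul, Complex.norm_real]
    gcongr
    refine (hle _ (hk0 x) s hs0 hs.2.le).trans ?_
    gcongr
    rcases le_total 0 (A - 1) with hA1 | hA1
    · exact (Real.rpow_le_rpow hs0.le hs.2.le hA1).trans (le_add_of_nonneg_left (by positivity))
    · exact (Real.rpow_le_rpow_of_nonpos (by positivity) hs.1.le hA1).trans
        (le_add_of_nonneg_right (by positivity))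
  · refine Eventually.of_forall fun x s hs => ?_
    have hs0 : 0 < s := lt_trans (by positivity) hs.1
    have := ((hasDerivAt_relaxation hR.lead (hk0 x) hs0).ofReal_comp).const_mul (h x)
    exact this.congr_deriv (by push_cast; ring)

/-- The fractional integrals of the time derivative of a superposition of relaxation functions. -/
lemma integral_powKer_mul_deriv_superposition (hR : RelaxationBounds α lam A)
    (hk : Measurable k) (hk0 : ∀ x, 0 ≤ k x) [SFinite ρ]
    (hkh : Integrable (fun x => (k x : ℂ) * h x) ρ) {d t : ℝ} (hd : 0 < d) (ht : 0 < t) :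
    IntegrableOn (fun s => powKer d (t - s) •
        (-∫ x, (k x : ℂ) * h x * (relaxSeries α lam A (k x) A s : ℂ) ∂ρ)) (Ioc 0 t) ∧
      Integrable (fun x => (k x : ℂ) * h x * (relaxSeries α lam A (k x) (d + A) t : ℂ)) ρ ∧
      ∫ s in Ioc 0 t, powKer d (t - s) •
        (-∫ x, (k x : ℂ) * h x * (relaxSeries α lam A (k x) A s : ℂ) ∂ρ) =
        -∫ x, (k x : ℂ) * h x * (relaxSeries α lam A (k x) (d + A) t : ℂ) ∂ρ := by
  obtain ⟨C, hC, hle⟩ := hR.density_le t ht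
  have hA := hR.lead.lead_pos
  have hi : IntegrableOn (fun s => powKer d (t - s) * powKer A s) (Ioc 0 t) :=
    (intervalIntegrable_powKer_mul_powKer hd hA ht).1
  have hdom : Integrable (fun p : X × ℝ => ‖(k p.1 : ℂ) * h p.1‖ *
      (powKer d (t - p.2) * powKer A p.2)) (ρ.prod (volume.restrict (Ioc 0 t))) :=
    hkh.norm.mul_prod hi
  have hmeas : Measurable fun p : X × ℝ => relaxSeries α lam A (k p.1) A p.2 :=
    hR.lead.measurable_relaxSeries_comp hk hk0 hA
  have hG : Integrable (fun p : X × ℝ => ((k p.1 : ℂ) * h p.1) *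
      ((powKer d (t - p.2) * relaxSeries α lam A (k p.1) A p.2 : ℝ) : ℂ))
      (ρ.prod (volume.restrict (Ioc 0 t))) := by
    refine (hdom.mul_const (C * Real.Gamma A)).mono' ?_ ?_
    · refine (hkh.aestronglyMeasurable.comp_fst).mul
        (Measurable.aestronglyMeasurable (Measurable.complex_ofReal ?_))
      exact ((measurable_powKer d).comp (measurable_const.sub measurable_snd)).mul hmeas
    · have h2 : ∀ᵐ p ∂(ρ.prod (volume.restrict (Ioc 0 t))), p.2 ∈ Ioc 0 t :=
        Measure.quasiMeasurePreserving_snd.ae (ae_restrict_mem measurableSet_Ioc)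
      filter_upwards [h2] with p hp
      have hΓ := Real.Gamma_pos_of_pos hA
      rw [norm_mul ((k p.1 : ℂ) * h p.1), Complex.norm_real, norm_mul (powKer d _),
        Real.norm_of_nonneg (powKer_nonneg hd _), powKer_of_pos A hp.1]
      have := hle _ (hk0 p.1) p.2 hp.1 hp.2
      have hpk := powKer_nonneg hd (t - p.2)
      calc _ ≤ ‖(k p.1 : ℂ) * h p.1‖ * (powKer d (t - p.2) * (C * p.2 ^ (A - 1))) := by
            gcongr
            exact this
        _ = _ := by field_simp
  have hx (x : X) : ∫ s in Ioc 0 t, (((k x : ℂ) * h x) *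
      ((powKer d (t - s) * relaxSeries α lam A (k x) A s : ℝ) : ℂ)) =
      (k x : ℂ) * h x * (relaxSeries α lam A (k x) (d + A) t : ℂ) := by
    rw [integral_const_mul, integral_complex_ofReal, ← intervalIntegral.integral_of_le ht.le,
      hR.lead.integral_powKer_mul_relaxSeries (hk0 x) hd hA ht]
  have hs (s : ℝ) : powKer d (t - s) •
      (-∫ x, (k x : ℂ) * h x * (relaxSeries α lam A (k x) A s : ℂ) ∂ρ) =
      -∫ x, (((k x : ℂ) * h x) *
      ((powKer d (t - s) * relaxSeries α lam A (k x) A s : ℝ) : ℂ)) ∂ρ := by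
    rw [smul_neg, ← integral_smul]
    congr 2
    ext x
    rw [Complex.real_smul]
    push_cast
    ring
  simp only [hs]
  refine ⟨hG.integral_prod_right.neg, ?_, ?_⟩
  · simpa only [hx] using hG.integral_prod_left
  · rw [integral_neg, ← integral_integral_swap hG]
    simp only [hx]

lemma caputoDeriv_superposition (hR : RelaxationBounds α lam A)
    (hk : Measurable k) (hk0 : ∀ x, 0 ≤ k x) [SFinite ρ] (hh : Integrable h ρ)
    (hkh : Integrable (fun x => (k x : ℂ) * h x) ρ) {j : J} (hα1 : α j ≤ 1) {t : ℝ} (ht : 0 < t) :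
    Integrable (fun x => (k x : ℂ) * h x * (relaxSeries α lam A (k x) (1 - α j + A) t : ℂ)) ρ ∧
      HasCaputo (α j) (superposition α lam A ρ k h) t ∧
      caputoDeriv (α j) (superposition α lam A ρ k h) t =
        -∫ x, (k x : ℂ) * h x * (relaxSeries α lam A (k x) (1 - α j + A) t : ℂ) ∂ρ := by
  have hd {s : ℝ} (hs : 0 < s) := hasDerivAt_superposition hR hk hk0 hh hkh hs
  unfold HasCaputo caputoDeriv
  rcases hα1.eq_or_lt with h1 | h1
  · rw [if_pos h1, if_pos h1, h1, sub_self, zero_add]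
    exact ⟨(hd ht).1, (hd ht).2.differentiableAt, (hd ht).2.deriv⟩
  · rw [if_neg h1.ne, if_neg h1.ne]
    have hd0 : 0 < 1 - α j := by linarith
    have hΓ := Real.Gamma_pos_of_pos hd0
    obtain ⟨hi1, hi2, hi3⟩ := integral_powKer_mul_deriv_superposition hR hk hk0 hkh hd0 ht
    have hker : ∀ s ∈ Ioo 0 t, ((t - s) ^ (-α j) : ℝ) • deriv (superposition α lam A ρ k h) s =
        Real.Gamma (1 - α j) • (powKer (1 - α j) (t - s) •
        (-∫ x, (k x : ℂ) * h x * (relaxSeries α lam A (k x) A s : ℂ) ∂ρ)) := fun s hs => by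
      rw [(hd hs.1).2.deriv, smul_smul, powKer_of_pos _ (sub_pos.2 hs.2), mul_div_cancel₀ _ hΓ.ne']
      ring_nf
    refine ⟨hi2, ⟨fun s hs => (hd hs.1).2.differentiableAt, ?_⟩, ?_⟩
    · rw [intervalIntegrable_iff_integrableOn_Ioo_of_le ht.le]
      refine IntegrableOn.congr_fun ?_ (fun s hs => (hker s hs).symm) measurableSet_Ioo
      exact (hi1.mono_set Ioo_subset_Ioc_self).smul (Real.Gamma (1 - α j))
    · rw [← hi3, intervalIntegral.integral_of_le ht.le, integral_Ioc_eq_integral_Ioo,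
        integral_Ioc_eq_integral_Ioo, setIntegral_congr_fun measurableSet_Ioo hker, integral_smul,
        smul_smul, inv_mul_cancel₀ hΓ.ne', one_smul]

/-- The fractional relaxation equation for superpositions. -/
lemma sum_caputoDeriv_superposition (hR : RelaxationBounds α lam A)
    (hk : Measurable k) (hk0 : ∀ x, 0 ≤ k x) [SFinite ρ] (hh : Integrable h ρ)
    (hkh : Integrable (fun x => (k x : ℂ) * h x) ρ) (hα1 : ∀ j, α j ≤ 1) {t : ℝ} (ht : 0 < t) :
    ∑ j, (lam j : ℂ) * caputoDeriv (α j) (superposition α lam A ρ k h) t =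
      -∫ x, (k x : ℂ) * h x * (relaxation α lam A (k x) t : ℂ) ∂ρ := by
  have hj (j : J) := caputoDeriv_superposition hR hk hk0 hh hkh (hα1 j) ht
  simp only [(hj _).2.2, mul_neg, Finset.sum_neg_distrib, ← integral_const_mul]
  rw [← integral_finsetSum _ fun j _ => (hj j).1.const_mul _]
  congr 2
  ext x
  have := hR.lead.sum_mul_relaxSeries (hk0 x) ht
  rw [relaxation, ← this]
  push_cast
  rw [Finset.mul_sum]
  exact Finset.sum_congr rfl fun j _ => by ring

end Superposition

/-! ### Pairings with Schwartz functions -/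

section Pairing

variable {n : ℕ}

lemma integral_fourierInv_eq (w : Measure (EuclideanSpace ℝ (Fin n))) [IsFiniteMeasure w]
    {g : EuclideanSpace ℝ (Fin n) → ℂ} (hg : Integrable g) :
    ∫ x, 𝓕⁻ g x ∂w = ∫ ξ, g ξ * charFun w ((2 * Real.pi) • ξ) := by
  simp only [Real.fourierInv_eq', smul_eq_mul]
  have hi : Integrable (Function.uncurry fun x ξ : EuclideanSpace ℝ (Fin n) =>
      Complex.exp (((2 * Real.pi * inner ℝ ξ x : ℝ) : ℂ) * Complex.I) * g ξ) (w.prod volume) := by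
    refine (hg.comp_snd w).bdd_mul (c := 1) ?_ (Eventually.of_forall fun p => ?_)
    · exact (by fun_prop : Continuous fun p : EuclideanSpace ℝ (Fin n) × EuclideanSpace ℝ (Fin n) =>
        Complex.exp (((2 * Real.pi * inner ℝ p.2 p.1 : ℝ) : ℂ) * Complex.I)).aestronglyMeasurable
    · rw [Complex.norm_exp_ofReal_mul_I]
  rw [integral_integral_swap hi]
  refine integral_congr_ae (Eventually.of_forall fun ξ => ?_)
  simp only
  rw [integral_mul_const, mul_comm, charFun_apply]
  congr 2
  ext x
  rw [inner_smul_right, real_inner_comm]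

lemma integral_schwartz_eq (w : Measure (EuclideanSpace ℝ (Fin n))) [IsFiniteMeasure w]
    (φ : 𝓢(EuclideanSpace ℝ (Fin n), ℂ)) :
    ∫ x, φ x ∂w = ∫ ξ, 𝓕 φ ξ * charFun w ((2 * Real.pi) • ξ) := by
  rw [← integral_fourierInv_eq w (𝓕 φ).integrable, ← SchwartzMap.fourierInv_coe,
    FourierTransform.fourierInv_fourier_eq]

/-- The symbol of `c² (-Δ)^β` in the normalization of Mathlib's Fourier transform. -/
def freqSymbol (β c : ℝ) (ξ : EuclideanSpace ℝ (Fin n)) : ℝ :=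
  c ^ 2 * (2 * Real.pi * ‖ξ‖) ^ (2 * β)

variable {β c : ℝ}

lemma freqSymbol_nonneg (β c : ℝ) (ξ : EuclideanSpace ℝ (Fin n)) : 0 ≤ freqSymbol β c ξ := by
  unfold freqSymbol
  positivity

lemma continuous_freqSymbol (hβ : 0 < β) :
    Continuous (freqSymbol β c : EuclideanSpace ℝ (Fin n) → ℝ) := by
  unfold freqSymbol
  exact continuous_const.mul ((by fun_prop : Continuous fun ξ : EuclideanSpace ℝ (Fin n) =>
    2 * Real.pi * ‖ξ‖).rpow_const fun _ => Or.inr (by positivity))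

lemma freqSymbol_le (hβ : 0 < β) (hβ1 : β ≤ 1) (ξ : EuclideanSpace ℝ (Fin n)) :
    freqSymbol β c ξ ≤ c ^ 2 * (1 + (2 * Real.pi) ^ 2 * ‖ξ‖ ^ 2) := by
  unfold freqSymbol
  refine mul_le_mul_of_nonneg_left ?_ (sq_nonneg c)
  rw [← mul_pow]
  set y := 2 * Real.pi * ‖ξ‖ with hy
  have hy0 : 0 ≤ y := by positivity
  rcases le_total y 1 with h | h
  · exact (Real.rpow_le_one hy0 h (by positivity)).trans (by nlinarith)
  · have := Real.rpow_le_rpow_of_exponent_le h (show 2 * β ≤ 2 by linarith)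
    rw [Real.rpow_two] at this
    linarith

lemma integrable_freqSymbol_mul (hβ : 0 < β) (hβ1 : β ≤ 1)
    (ψ : 𝓢(EuclideanSpace ℝ (Fin n), ℂ)) :
    Integrable fun ξ => (freqSymbol β c ξ : ℂ) * ψ ξ := by
  have hd : Integrable fun ξ => c ^ 2 * (‖ψ ξ‖ + (2 * Real.pi) ^ 2 * (‖ξ‖ ^ 2 * ‖ψ ξ‖)) :=
    (ψ.integrable.norm.add ((ψ.integrable_pow_mul volume 2).const_mul _)).const_mul _
  refine hd.mono' ?_ (Eventually.of_forall fun ξ => ?_)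
  · exact ((Complex.continuous_ofReal.comp (continuous_freqSymbol hβ)).mul
      ψ.continuous).aestronglyMeasurable
  · rw [norm_mul, Complex.norm_real, Real.norm_of_nonneg (freqSymbol_nonneg β c ξ)]
    refine (mul_le_mul_of_nonneg_right (freqSymbol_le hβ hβ1 ξ) (norm_nonneg _)).trans ?_
    exact le_of_eq (by ring)

lemma integral_fracLaplacian (hβ : 0 < β) (hβ1 : β ≤ 1)
    (w : Measure (EuclideanSpace ℝ (Fin n))) [IsFiniteMeasure w]
    (φ : 𝓢(EuclideanSpace ℝ (Fin n), ℂ)) :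
    (c : ℂ) ^ 2 * ∫ x, fracLaplacian β φ x ∂w =
      ∫ ξ, (freqSymbol β c ξ : ℂ) * 𝓕 φ ξ * charFun w ((2 * Real.pi) • ξ) := by
  have h1 := integrable_freqSymbol_mul (c := 1) hβ hβ1 (𝓕 φ)
  simp only [freqSymbol, one_pow, one_mul, SchwartzMap.fourier_coe] at h1
  unfold fracLaplacian
  rw [integral_fourierInv_eq w h1, ← integral_const_mul]
  refine integral_congr_ae (Eventually.of_forall fun ξ => ?_)
  simp only [freqSymbol, SchwartzMap.fourier_coe]
  push_cast
  ring

/-- A family of probability laws whose characteristic functions are relaxation functions solves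
the Cauchy problem. -/
theorem isCauchySolution_of_charFun {m : ℕ} {α lam : Fin m → ℝ} {A : ℝ}
    (hR : RelaxationBounds α lam A) (hα1 : ∀ j, α j ≤ 1) (hβ : 0 < β) (hβ1 : β ≤ 1)
    {w : ℝ≥0 → Measure (EuclideanSpace ℝ (Fin n))} (hw : ∀ t, IsProbabilityMeasure (w t))
    (hw0 : w 0 = Measure.dirac 0)
    (hchar : ∀ (t : ℝ≥0) (ξ : EuclideanSpace ℝ (Fin n)),
      charFun (w t) ξ = (relaxation α lam A (c ^ 2 * ‖ξ‖ ^ (2 * β)) t : ℂ)) :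
    IsCauchySolution α lam β c w := by
  have hk : Measurable (freqSymbol β c : EuclideanSpace ℝ (Fin n) → ℝ) :=
    (continuous_freqSymbol hβ).measurable
  have hk0 := freqSymbol_nonneg (n := n) β c
  have hchar' : ∀ t : ℝ, 0 ≤ t → ∀ ξ, charFun (w t.toNNReal) ((2 * Real.pi) • ξ) =
      (relaxation α lam A (freqSymbol β c ξ) t : ℂ) := fun t ht ξ => by
    rw [hchar, norm_smul, Real.norm_of_nonneg (by positivity), Real.coe_toNNReal t ht, freqSymbol]
  have hpair : ∀ (φ : 𝓢(EuclideanSpace ℝ (Fin n), ℂ)) (t : ℝ), 0 ≤ t → pairing w φ t =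
      superposition α lam A volume (freqSymbol (n := n) β c) (fun ξ => 𝓕 φ ξ) t := fun φ t ht => by
    rw [pairing, integral_schwartz_eq, superposition]
    simp only [hchar' t ht]
  have hpairE : ∀ (φ : 𝓢(EuclideanSpace ℝ (Fin n), ℂ)) (t : ℝ), 0 < t → pairing w φ =ᶠ[𝓝 t]
      superposition α lam A volume (freqSymbol (n := n) β c) (fun ξ => 𝓕 φ ξ) := fun φ t ht => by
    filter_upwards [Ioi_mem_nhds ht] with s hs using hpair φ s (le_of_lt hs)
  have hcap : ∀ (φ : 𝓢(EuclideanSpace ℝ (Fin n), ℂ)) j (t : ℝ), 0 < t → (HasCaputo (α j) (pairing w φ) t ↔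
      HasCaputo (α j) (superposition α lam A volume (freqSymbol (n := n) β c) (fun ξ => 𝓕 φ ξ)) t) ∧
      caputoDeriv (α j) (pairing w φ) t =
      caputoDeriv (α j) (superposition α lam A volume (freqSymbol (n := n) β c) (fun ξ => 𝓕 φ ξ)) t := by
    intro φ j t ht
    unfold HasCaputo caputoDeriv
    split_ifs with h1
    · exact ⟨(hpairE φ t ht).differentiableAt_iff, (hpairE φ t ht).deriv_eq⟩
    · have hker : ∀ s ∈ Ioo 0 t, ((t - s) ^ (-α j) : ℝ) • deriv (pairing w φ) s =
          ((t - s) ^ (-α j) : ℝ) •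
            deriv (superposition α lam A volume (freqSymbol (n := n) β c) (fun ξ => 𝓕 φ ξ)) s := fun s hs => by
        rw [(hpairE φ s hs.1).deriv_eq]
      constructor
      · rw [intervalIntegrable_iff_integrableOn_Ioo_of_le ht.le,
          intervalIntegrable_iff_integrableOn_Ioo_of_le ht.le,
          integrableOn_congr_fun hker measurableSet_Ioo]
        exact and_congr_left fun _ => forall₂_congr fun s hs => (hpairE φ s hs.1).differentiableAt_iff
      · rw [intervalIntegral.integral_of_le ht.le, intervalIntegral.integral_of_le ht.le,
          integral_Ioc_eq_integral_Ioo, integral_Ioc_eq_integral_Ioo,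
          setIntegral_congr_fun measurableSet_Ioo hker]
  refine ⟨hw, hw0, fun φ => ?_, fun φ t ht j => ?_, fun φ t ht => ?_⟩
  · exact (continuousOn_superposition hR hk hk0 (𝓕 φ).integrable).congr fun t ht => hpair φ t ht
  · exact (hcap φ j t ht).1.2 (caputoDeriv_superposition hR hk hk0 (𝓕 φ).integrable
      (integrable_freqSymbol_mul hβ hβ1 _) (hα1 j) ht).2.1
  · simp only [(hcap φ _ t ht).2]
    rw [sum_caputoDeriv_superposition hR hk hk0 (𝓕 φ).integrable
      (integrable_freqSymbol_mul hβ hβ1 _) hα1 ht, neg_mul, integral_fracLaplacian hβ hβ1]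
    simp only [hchar' t ht.le]

end Pairing

/-! ### The law of the subordinated process -/

lemma exists_isLeadOrder {m : ℕ} (hm : 0 < m) {α lam : Fin m → ℝ} (hα : ∀ j, 0 < α j)
    (hlam : ∀ j, 0 < lam j) : ∃ A, IsLeadOrder α lam A := by
  have : Nonempty (Fin m) := ⟨⟨0, hm⟩⟩
  obtain ⟨j, hj⟩ := Finite.exists_max α
  exact ⟨α j, hα, hlam, hj, j, rfl⟩

section Law

variable {Ω : Type*} [m₀ : MeasurableSpace Ω] {P : Measure Ω} [IsProbabilityMeasure P]

lemma IsIncreasingProcess.relaxationBounds {J : Type*} [Fintype J] {α lam : J → ℝ} {A : ℝ}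
    {f : ℝ≥0 → Ω → ℝ} (hA : IsLeadOrder α lam A) (hf : IsIncreasingProcess α lam f P) :
    RelaxationBounds α lam A := by
  refine ⟨hA, fun κ hκ t ht => ?_, fun T hT => hf.exists_abs_relaxSeries_le hA hT⟩
  have h := hf.integral_exp_inverseProcess hA hκ t.toNNReal
  rw [Real.coe_toNNReal t ht] at h
  rw [relaxation, ← h, ← Real.norm_eq_abs]
  simpa using norm_integral_le_of_norm_le_const (μ := P)
    (Eventually.of_forall fun ω => norm_exp_neg_mul_le_one hκ
      (inverseProcess (fun s => f s ω) t.toNNReal))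

variable {n m r : ℕ} {ν lam : Fin m → ℝ} {β c : ℝ} {S : ℝ≥0 → Ω → EuclideanSpace ℝ (Fin n)}
  {H : Fin m → Fin r → ℝ≥0 → Ω → ℝ≥0}

lemma iSup_processSigma_le (hH : ∀ j i, IsStableSubordinator (ν j) (H j i) P) :
    (⨆ p : Fin m × Fin r, processSigma (H p.1 p.2)) ≤ m₀ :=
  iSup_le fun p => processSigma_le (hH p.1 p.2).measurable

lemma isIncreasingProcess_weightedSum (hm : 0 < m) (hν : ∀ j, 0 < ν j) (hlam : ∀ j, 0 < lam j)
    (hH : ∀ j i, IsStableSubordinator (ν j) (H j i) P)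
    (hi : iIndep (fun p : Fin m × Fin r => processSigma (H p.1 p.2)) P) :
    IsIncreasingProcess (fun j => ν j ^ r) lam
      (fun s ω => weightedSum ν lam (fun j i t => H j i t ω) s) P where
  aemeasurable s := (aestronglyMeasurable_mono_subalgebra
    (iSup_processSigma_le hH) (aestronglyMeasurable_weightedSum hH hi s)).aemeasurable
  nonneg s _ := weightedSum_nonneg hlam _ s
  mono := ae_monotone_weightedSum hlam hH
  unbounded := ae_unbounded_weightedSum hm hν hlam hH hi
  laplace s _ hμ := integral_exp_weightedSum hν hlam hH hi s hμ

lemma IsIsotropicStable.charFun_map (hS : IsIsotropicStable β S P) (t : ℝ≥0)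
    (ξ : EuclideanSpace ℝ (Fin n)) :
    charFun (P.map (S t)) ξ = ((Real.exp (-(t : ℝ) * ‖ξ‖ ^ (2 * β)) : ℝ) : ℂ) := by
  have h := hS.charFun_eq 0 t zero_le ξ
  rw [Measure.map_congr (show (fun ω => S t ω - S 0 ω) =ᵐ[P] S t from
    hS.zero.mono fun ω h => by simp [h])] at h
  simpa using h

lemma aestronglyMeasurable_timeChange (hm : 0 < m) (hν : ∀ j, 0 < ν j) (hlam : ∀ j, 0 < lam j)
    (hH : ∀ j i, IsStableSubordinator (ν j) (H j i) P)
    (hi : iIndep (fun p : Fin m × Fin r => processSigma (H p.1 p.2)) P) (t : ℝ≥0) :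
    AEStronglyMeasurable[⨆ p : Fin m × Fin r, processSigma (H p.1 p.2)]
      (fun ω => (c ^ 2).toNNReal * inverseProcess (weightedSum ν lam (fun j i s => H j i s ω)) t)
      P :=
  (continuous_const.mul continuous_id).comp_aestronglyMeasurable
    (aestronglyMeasurable_inverseProcess
      (fun s => aestronglyMeasurable_weightedSum (lam := lam) hH hi s)
      (ae_monotone_weightedSum hlam hH) (ae_unbounded_weightedSum hm hν hlam hH hi) t)

lemma aemeasurable_subordinated (hm : 0 < m) (hν : ∀ j, 0 < ν j) (hlam : ∀ j, 0 < lam j)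
    (hS : IsIsotropicStable β S P) (hH : ∀ j i, IsStableSubordinator (ν j) (H j i) P)
    (hi : iIndep (fun p : Fin m × Fin r => processSigma (H p.1 p.2)) P) (t : ℝ≥0) :
    AEMeasurable (subordinated ν lam c S H t) P :=
  (aestronglyMeasurable_process_comp hS.measurable
    (hS.paths.mono fun _ h t => (h t).1)
    (aestronglyMeasurable_mono_subalgebra
      (iSup_processSigma_le hH)
      (aestronglyMeasurable_timeChange hm hν hlam hH hi t))).aemeasurable

lemma charFun_subordinated (hm : 0 < m) (hν : ∀ j, 0 < ν j) (hlam : ∀ j, 0 < lam j) {A : ℝ}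
    (hA : IsLeadOrder (fun j => ν j ^ r) lam A)
    (hS : IsIsotropicStable β S P) (hH : ∀ j i, IsStableSubordinator (ν j) (H j i) P)
    (hi : iIndep (fun p : Fin m × Fin r => processSigma (H p.1 p.2)) P)
    (hSH : Indep (processSigma S) (⨆ p : Fin m × Fin r, processSigma (H p.1 p.2)) P)
    (t : ℝ≥0) (ξ : EuclideanSpace ℝ (Fin n)) :
    charFun (P.map (subordinated ν lam c S H t)) ξ =
      (relaxation (fun j => ν j ^ r) lam A (c ^ 2 * ‖ξ‖ ^ (2 * β)) t : ℂ) := by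
  have hψ : Continuous fun x : EuclideanSpace ℝ (Fin n) =>
      Complex.exp ((inner ℝ x ξ : ℝ) * Complex.I) := by fun_prop
  have hχ : Continuous fun s : ℝ≥0 =>
      ((Real.exp (-(s : ℝ) * ‖ξ‖ ^ (2 * β)) : ℝ) : ℂ) := by fun_prop
  rw [charFun_apply, integral_map (aemeasurable_subordinated hm hν hlam hS hH hi t)
    hψ.aestronglyMeasurable]
  have h := integral_process_comp (P := P) (processSigma_le hS.measurable)
    (iSup_processSigma_le hH) hSH
    (X := S) (measurable_processSigma S) (hS.paths.mono fun _ h t => (h t).1)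
    (aestronglyMeasurable_timeChange (c := c) hm hν hlam hH hi t) hψ (C := 1)
    (fun x => (Complex.norm_exp_ofReal_mul_I _).le) hχ (fun s => by
      rw [← hS.charFun_map s ξ, charFun_apply,
        integral_map (hS.measurable s).aemeasurable hψ.aestronglyMeasurable])
  refine h.trans ?_
  have hf := isIncreasingProcess_weightedSum hm hν hlam hH hi
  rw [integral_complex_ofReal, relaxation, ← hf.integral_exp_inverseProcess hA (by positivity) t]
  congr 2
  ext ω
  rw [NNReal.coe_mul, Real.coe_toNNReal _ (sq_nonneg c)]
  ring_nf

lemma map_subordinated_zero (hlam : ∀ j, 0 < lam j) (hS : IsIsotropicStable β S P) :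
    P.map (subordinated ν lam c S H 0) = Measure.dirac 0 := by
  have h0 : ∀ ω, inverseProcess (weightedSum ν lam (fun j i s => H j i s ω)) 0 = 0 := fun ω => by
    have : {s : ℝ≥0 | 0 < s ∧
        ((0 : ℝ≥0) : ℝ) ≤ weightedSum ν lam (fun j i s => H j i s ω) s} = Ioi 0 := by
      ext s
      simp [weightedSum_nonneg hlam]
    rw [inverseProcess, this, csInf_Ioi]
  rw [Measure.map_congr (show subordinated ν lam c S H 0 =ᵐ[P] fun _ => 0 from
    hS.zero.mono fun ω h => by simp [subordinated, h0, h]), Measure.map_const]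
  simp

lemma indep_processSigma_of_indepFun
    (hSH : IndepFun (fun ω (t : ℝ≥0) => S t ω)
      (fun ω (p : Fin m × Fin r) (t : ℝ≥0) => H p.1 p.2 t ω) P) :
    Indep (processSigma S) (⨆ p : Fin m × Fin r, processSigma (H p.1 p.2)) P := by
  refine indep_of_indep_of_le_right ((IndepFun_iff_Indep _ _ _).1 hSH) (iSup_le fun p => ?_)
  exact ((measurable_pi_apply p).comp (comap_measurable
    fun ω (p : Fin m × Fin r) (t : ℝ≥0) => H p.1 p.2 t ω)).comap_le

/-- The laws of the subordinated process solve the Cauchy problem. -/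
theorem isCauchySolution_subordinated (hm : 0 < m) (hν : ∀ j, 0 < ν j ∧ ν j ≤ 1)
    (hlam : ∀ j, 0 < lam j) (hβ : 0 < β ∧ β ≤ 1)
    (hS : IsIsotropicStable β S P) (hH : ∀ j i, IsStableSubordinator (ν j) (H j i) P)
    (hi : iIndep (fun p : Fin m × Fin r => processSigma (H p.1 p.2)) P)
    (hSH : Indep (processSigma S) (⨆ p : Fin m × Fin r, processSigma (H p.1 p.2)) P) :
    IsCauchySolution (fun j => ν j ^ r) lam β c
      (fun t => P.map (subordinated ν lam c S H t)) := by
  have hν0 : ∀ j, 0 < ν j := fun j => (hν j).1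
  obtain ⟨A, hA⟩ := exists_isLeadOrder hm (α := fun j => ν j ^ r) (fun j => pow_pos (hν0 j) r) hlam
  exact isCauchySolution_of_charFun
    ((isIncreasingProcess_weightedSum hm hν0 hlam hH hi).relaxationBounds hA)
    (fun j => pow_le_one₀ (hν0 j).le (hν j).2) hβ.1 hβ.2
    (fun t => Measure.isProbabilityMeasure_map
      (aemeasurable_subordinated hm hν0 hlam hS hH hi t))
    (map_subordinated_zero hlam hS) (charFun_subordinated hm hν0 hlam hA hS hH hi hSH)

end Law

/-! ### Laplace transforms of Caputo equations -/

section CaputoLaplace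

lemma integral_powKer {d T : ℝ} (hd : 0 < d) {s : ℝ} (hs : 0 < s) (hsT : s ≤ T) :
    ∫ t in Ioc 0 T, powKer d (t - s) = powKer (d + 1) (T - s) := by
  rw [← Ioc_union_Ioc_eq_Ioc hs.le hsT]
  have hz : ∀ t ∈ Ioc 0 s, powKer d (t - s) = 0 := fun t ht =>
    powKer_of_nonpos d (sub_nonpos.2 ht.2)
  rcases hsT.eq_or_lt with rfl | hsT
  · rw [Ioc_self, union_empty, setIntegral_congr_fun measurableSet_Ioc hz, integral_zero, sub_self,
      powKer_of_nonpos _ le_rfl]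
  have h := integral_powKer_mul_powKer one_pos hd (sub_pos.2 hsT)
  have h1 : ∫ x in (0 : ℝ)..(T - s), powKer 1 (T - s - x) * powKer d x =
      ∫ x in (0 : ℝ)..(T - s), powKer d x := by
    rw [intervalIntegral.integral_of_le (sub_pos.2 hsT).le, integral_Ioc_eq_integral_Ioo,
      intervalIntegral.integral_of_le (sub_pos.2 hsT).le, integral_Ioc_eq_integral_Ioo]
    exact setIntegral_congr_fun measurableSet_Ioo fun x hx => by
      simp only [powKer_one (sub_pos.2 hx.2), one_mul]
  have h2 : ∫ t in s..T, powKer d (t - s) = powKer (d + 1) (T - s) := by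
    rw [intervalIntegral.integral_comp_sub_right, sub_self, ← h1, h, add_comm]
  have hi : IntervalIntegrable (fun t => powKer d (t - s)) volume s T := by
    by_contra hn
    rw [intervalIntegral.integral_undef hn] at h2
    exact (powKer_pos (by linarith) (sub_pos.2 hsT)).ne h2
  have hzi : IntegrableOn (fun t => powKer d (t - s)) (Ioc 0 s) :=
    (integrableOn_zero (μ := volume) (s := Ioc 0 s)).congr_fun
      (fun t ht => (hz t ht).symm) measurableSet_Ioc
  rw [setIntegral_union (by simp [Set.disjoint_left]; intros; linarith) measurableSet_Ioc hzi hi.1,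
    setIntegral_congr_fun measurableSet_Ioc hz, integral_zero, zero_add,
    ← intervalIntegral.integral_of_le hsT.le, h2]

lemma integrableOn_powKer {d : ℝ} (hd : 0 < d) (T : ℝ) : IntegrableOn (powKer d) (Ioc 0 T) := by
  have h := integrableOn_exp_mul_powKer hd one_pos
  have h' := (h.mono_set (show Ioc 0 T ⊆ Ioi 0 from fun t ht => ht.1)).continuousOn_mul_of_subset
    (K := Icc 0 T) (g := fun t : ℝ => Real.exp t) (by fun_prop) isCompact_Icc
    measurableSet_Ioc Ioc_subset_Icc_self
  refine h'.congr_fun (fun t _ => ?_) measurableSet_Ioc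
  simp only [← mul_assoc, ← Real.exp_add]
  simp

/-- Integration in time of a fractional integral. -/
lemma integral_integral_powKer {d T : ℝ} (hd : 0 < d) {f : ℝ → ℂ}
    (hf : IntegrableOn f (Ioc 0 T)) :
    IntegrableOn (fun t => ∫ s in Ioc 0 t, powKer d (t - s) • f s) (Ioc 0 T) ∧
      ∫ t in Ioc 0 T, (∫ s in Ioc 0 t, powKer d (t - s) • f s) =
        ∫ s in Ioc 0 T, powKer (d + 1) (T - s) • f s := by
  have h1 : ∀ t ∈ Ioc 0 T, ∫ s in Ioc 0 t, powKer d (t - s) • f s =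
      ∫ s in Ioc 0 T, powKer d (t - s) • f s := fun t ht => by
    symm
    refine setIntegral_eq_of_subset_of_forall_sdiff_eq_zero measurableSet_Ioc
      (Ioc_subset_Ioc_right ht.2) fun s hs => ?_
    have : t < s := by
      by_contra hc
      exact hs.2 ⟨hs.1.1, not_lt.1 hc⟩
    rw [powKer_of_nonpos _ (by linarith), zero_smul]
  rw [setIntegral_congr_fun measurableSet_Ioc h1, integrableOn_congr_fun h1 measurableSet_Ioc]
  have hi : Integrable (Function.uncurry fun t s : ℝ => powKer d (t - s) • f s)
      ((volume.restrict (Ioc 0 T)).prod (volume.restrict (Ioc 0 T))) := by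
    have hc := ((integrable_indicator_iff measurableSet_Ioc).2 hf).convolution_integrand
      (ContinuousLinearMap.lsmul ℝ ℝ (E := ℂ)).flip
      ((integrable_indicator_iff measurableSet_Ioc).2 (integrableOn_powKer hd T))
    rw [Measure.prod_restrict]
    refine hc.integrableOn.congr_fun (fun p hp => ?_) (measurableSet_Ioc.prod measurableSet_Ioc)
    simp only [ContinuousLinearMap.flip_apply, ContinuousLinearMap.lsmul_apply, Function.uncurry]
    rw [indicator_of_mem hp.2]
    by_cases hps : p.1 - p.2 ∈ Ioc 0 T
    · rw [indicator_of_mem hps]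
    · rw [indicator_of_notMem hps, powKer_of_nonpos]
      by_contra hn
      exact hps ⟨not_le.1 hn, by linarith [hp.1.2, hp.2.1]⟩
  refine ⟨hi.integral_prod_left, ?_⟩
  rw [integral_integral_swap hi]
  refine setIntegral_congr_fun measurableSet_Ioc fun s hs => ?_
  rw [integral_smul_const, integral_powKer hd hs.1 hs.2]

/-- Integration by parts against a fractional kernel. -/
lemma integral_powKer_succ_smul_deriv {d T : ℝ} (hd : 0 < d) (hT : 0 < T) {u u' : ℝ → ℂ}
    (hu : ContinuousOn u (Icc 0 T)) (hu' : ∀ t ∈ Ioo 0 T, HasDerivAt u (u' t) t)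
    (hi : IntervalIntegrable u' volume 0 T) :
    ∫ s in Ioc 0 T, powKer (d + 1) (T - s) • u' s =
      ∫ s in Ioc 0 T, powKer d (T - s) • (u s - u 0) := by
  have hΓ := Real.Gamma_pos_of_pos hd
  set K : ℝ → ℂ := fun s => (((T - s) ^ d / Real.Gamma (d + 1) : ℝ) : ℂ) with hK
  set K' : ℝ → ℂ := fun s => -((powKer d (T - s) : ℝ) : ℂ) with hK'
  have hKc : ContinuousOn K (uIcc 0 T) := by
    refine (Complex.continuous_ofReal.comp ?_).continuousOn
    exact ((continuous_const.sub continuous_id).rpow_const fun s => Or.inr hd.le).div_const _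
  have hKd : ∀ s ∈ Ioo (min 0 T) (max 0 T), HasDerivAt K (K' s) s := fun s hs => by
    rw [min_eq_left hT.le, max_eq_right hT.le] at hs
    have hp : 0 < T - s := sub_pos.2 hs.2
    have h1 := (((hasDerivAt_id s).const_sub T).rpow_const (p := d)
      (Or.inl hp.ne')).div_const (Real.Gamma (d + 1))
    refine h1.ofReal_comp.congr_deriv ?_
    simp only [hK']
    rw [powKer_of_pos _ hp, Real.Gamma_add_one hd.ne']
    simp only [id]
    push_cast
    have : (d : ℂ) ≠ 0 := by exact_mod_cast hd.ne'
    field_simp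
  have hKi : IntervalIntegrable K' volume 0 T := by
    have h0 : IntervalIntegrable (powKer d) volume 0 T :=
      (intervalIntegrable_iff_integrableOn_Ioc_of_le hT.le).2 (integrableOn_powKer hd T)
    have h1 := (h0.comp_sub_left T).symm
    rw [sub_zero, sub_self] at h1
    exact ⟨h1.1.ofReal.neg, h1.2.ofReal.neg⟩
  have hmain := intervalIntegral.integral_mul_deriv_eq_deriv_mul_of_hasDerivAt
    (u := K) (v := fun s => u s - u 0) (u' := K') (v' := u') (a := 0) (b := T) hKc
    (by rw [uIcc_of_le hT.le]; exact hu.sub continuousOn_const) hKd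
    (fun s hs => (hu' s (by rwa [min_eq_left hT.le, max_eq_right hT.le] at hs)).sub_const _) hKi hi
  have hKT : K T = 0 := by simp [hK, Real.zero_rpow hd.ne']
  rw [hKT, zero_mul, sub_self, mul_zero, sub_zero, zero_sub, ← intervalIntegral.integral_neg,
    intervalIntegral.integral_of_le hT.le, intervalIntegral.integral_of_le hT.le] at hmain
  calc _ = ∫ s in Ioc 0 T, K s * u' s := by
        rw [integral_Ioc_eq_integral_Ioo, integral_Ioc_eq_integral_Ioo]
        refine setIntegral_congr_fun measurableSet_Ioo fun s hs => ?_
        simp only [hK]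
        rw [powKer_of_pos _ (sub_pos.2 hs.2), add_sub_cancel_right, Complex.real_smul]
    _ = _ := hmain
    _ = _ := by
        refine setIntegral_congr_fun measurableSet_Ioc fun s _ => ?_
        simp only [hK', Complex.real_smul]
        ring

lemma integrableOn_exp_smul_of_bounded {μ : ℝ} (hμ : 0 < μ) {f : ℝ → ℂ}
    (hf : ContinuousOn f (Ici 0)) {C : ℝ} (hC : ∀ t, 0 ≤ t → ‖f t‖ ≤ C) :
    IntegrableOn (fun t => Real.exp (-μ * t) • f t) (Ioi 0) := by
  have he : IntegrableOn (fun t => Real.exp (-μ * t)) (Ioi 0) :=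
    integrableOn_exp_mul_Ioi (by linarith) 0
  refine Integrable.smul_bdd (C := C) he
    ((hf.mono Ioi_subset_Ici_self).aestronglyMeasurable measurableSet_Ioi) ?_
  filter_upwards [ae_restrict_mem measurableSet_Ioi] with t ht using hC t (le_of_lt ht)

/-- The Laplace transform of a fractional integral. -/
lemma laplace_integral_powKer {b μ : ℝ} (hb : 0 < b) (hμ : 0 < μ) {f : ℝ → ℂ}
    (hf : IntegrableOn (fun t => Real.exp (-μ * t) • f t) (Ioi 0)) :
    IntegrableOn (fun t => Real.exp (-μ * t) • ∫ s in Ioc 0 t, powKer b (t - s) • f s) (Ioi 0) ∧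
      ∫ t in Ioi (0 : ℝ), Real.exp (-μ * t) • (∫ s in Ioc 0 t, powKer b (t - s) • f s) =
        μ ^ (-b) • ∫ t in Ioi (0 : ℝ), Real.exp (-μ * t) • f t := by
  have h1 : ∀ t ∈ Ioi (0 : ℝ), ∫ s in (0 : ℝ)..t, (ContinuousLinearMap.lsmul ℝ ℝ (E := ℂ)).flip
      (Real.exp (-μ * s) • f s) (Real.exp (-μ * (t - s)) * powKer b (t - s)) =
      Real.exp (-μ * t) • ∫ s in Ioc 0 t, powKer b (t - s) • f s := fun t ht => by
    rw [intervalIntegral.integral_of_le (le_of_lt ht), ← integral_smul]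
    congr 1 with s
    simp only [ContinuousLinearMap.flip_apply, ContinuousLinearMap.lsmul_apply, smul_smul]
    congr 1
    rw [show -μ * t = -μ * (t - s) + -μ * s by ring, Real.exp_add]
    ring
  have hk := integrableOn_exp_mul_powKer hb hμ
  constructor
  · have h := (integrable_posConvolution hf hk
      (ContinuousLinearMap.lsmul ℝ ℝ (E := ℂ)).flip).integrableOn (s := Ioi 0)
    refine h.congr_fun (fun t ht => ?_) measurableSet_Ioi
    rw [← h1 t ht, posConvolution, indicator_of_mem ht]
  · have h := integral_posConvolution hf hk (ContinuousLinearMap.lsmul ℝ ℝ (E := ℂ)).flip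
    rw [setIntegral_congr_fun measurableSet_Ioi h1, integral_exp_mul_powKer hb hμ] at h
    exact h

end CaputoLaplace

section CaputoEquation

variable {u : ℝ → ℂ} {J : Type*} [Fintype J]

lemma HasCaputo.differentiableAt {α s : ℝ} (h : ∀ t, 0 < t → HasCaputo α u t) (hs : 0 < s) :
    DifferentiableAt ℝ u s := by
  by_cases h1 : α = 1
  · have := h s hs
    rwa [HasCaputo, if_pos h1] at this
  · have := h (s + 1) (by linarith)
    rw [HasCaputo, if_neg h1] at this
    exact this.1 s ⟨hs, by linarith⟩

lemma HasCaputo.intervalIntegrable_deriv {α T : ℝ} (hα : 0 < α) (hα1 : α < 1) (hT : 0 < T)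
    (h : HasCaputo α u T) : IntervalIntegrable (deriv u) volume 0 T := by
  rw [HasCaputo, if_neg hα1.ne] at h
  have hc : ContinuousOn (fun s : ℝ => (((T - s) ^ α : ℝ) : ℂ)) (uIcc 0 T) :=
    (Complex.continuous_ofReal.comp ((continuous_const.sub continuous_id).rpow_const
      fun s => Or.inr hα.le)).continuousOn
  have hi := h.2.continuousOn_mul hc
  rw [intervalIntegrable_iff_integrableOn_Ioo_of_le hT.le] at hi ⊢
  refine hi.congr_fun (fun s hs => ?_) measurableSet_Ioo
  have hp : 0 < T - s := sub_pos.2 hs.2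
  simp only [Complex.real_smul]
  rw [← mul_assoc, ← Complex.ofReal_mul, ← Real.rpow_add hp, add_neg_cancel, Real.rpow_zero,
    Complex.ofReal_one, one_mul]

lemma caputoDeriv_eq_integral_powKer {α t : ℝ} (hα1 : α < 1) (ht : 0 < t) :
    caputoDeriv α u t = ∫ s in Ioc 0 t, powKer (1 - α) (t - s) • deriv u s := by
  rw [caputoDeriv, if_neg hα1.ne, intervalIntegral.integral_of_le ht.le, ← integral_smul,
    integral_Ioc_eq_integral_Ioo, integral_Ioc_eq_integral_Ioo]
  refine setIntegral_congr_fun measurableSet_Ioo fun s hs => ?_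
  rw [powKer_of_pos _ (sub_pos.2 hs.2), smul_smul, div_eq_inv_mul, sub_sub_cancel_left]

/-- The time integral of a Caputo derivative. -/
lemma integral_caputoDeriv {α T : ℝ} (hα1 : α ≤ 1) (hT : 0 < T)
    (hu : ContinuousOn u (Icc 0 T)) (hd : ∀ t ∈ Ioo 0 T, DifferentiableAt ℝ u t)
    (hi : IntervalIntegrable (deriv u) volume 0 T) :
    IntegrableOn (caputoDeriv α u) (Ioc 0 T) ∧
      ∫ t in Ioc 0 T, caputoDeriv α u t = if α = 1 then u T - u 0 else
        ∫ s in Ioc 0 T, powKer (1 - α) (T - s) • (u s - u 0) := by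
  rcases hα1.eq_or_lt with rfl | hα1
  · have : caputoDeriv 1 u = deriv u := by
      ext t
      rw [caputoDeriv, if_pos rfl]
    rw [this, if_pos rfl, ← intervalIntegral.integral_of_le hT.le]
    exact ⟨hi.1, intervalIntegral.integral_eq_sub_of_hasDerivAt_of_le hT.le hu
      (fun t ht => (hd t ht).hasDerivAt) hi⟩
  · have hd0 : 0 < 1 - α := by linarith
    have hk : ∀ t ∈ Ioc 0 T, caputoDeriv α u t =
        ∫ s in Ioc 0 t, powKer (1 - α) (t - s) • deriv u s :=
      fun t ht => caputoDeriv_eq_integral_powKer hα1 ht.1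
    rw [integrableOn_congr_fun hk measurableSet_Ioc, setIntegral_congr_fun measurableSet_Ioc hk,
      if_neg hα1.ne, ← integral_powKer_succ_smul_deriv hd0 hT hu
        (fun t ht => (hd t ht).hasDerivAt) hi]
    exact integral_integral_powKer hd0 hi.1

/-- The Laplace transform of a Caputo equation. -/
theorem laplace_caputo_equation [Nonempty J] {α lam : J → ℝ} (hα : ∀ j, 0 < α j)
    (hα1 : ∀ j, α j ≤ 1) (hlam : ∀ j, 0 < lam j) {b : ℝ → ℂ} (hu : ContinuousOn u (Ici 0))
    (hb : ContinuousOn b (Ici 0)) {C : ℝ} (huC : ∀ t, 0 ≤ t → ‖u t‖ ≤ C)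
    {C' : ℝ} (hbC : ∀ t, 0 ≤ t → ‖b t‖ ≤ C') (hcap : ∀ t, 0 < t → ∀ j, HasCaputo (α j) u t)
    (heqn : ∀ t, 0 < t → ∑ j, (lam j : ℂ) * caputoDeriv (α j) u t = -b t) {μ : ℝ} (hμ : 0 < μ) :
    symbol α lam μ • ((∫ t in Ioi (0 : ℝ), Real.exp (-μ * t) • u t) - μ⁻¹ • u 0) =
      -∫ t in Ioi (0 : ℝ), Real.exp (-μ * t) • b t := by
  have hd : ∀ t, 0 < t → DifferentiableAt ℝ u t := fun t ht =>
    HasCaputo.differentiableAt (fun s hs => hcap s hs (Classical.arbitrary J)) ht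
  have hi : ∀ T, 0 < T → IntervalIntegrable (deriv u) volume 0 T := fun T hT => by
    by_cases h1 : ∃ j, α j < 1
    · obtain ⟨j, hj⟩ := h1
      exact (hcap T hT j).intervalIntegrable_deriv (hα j) hj hT
    · have h1' : ∀ j, α j = 1 := fun j => le_antisymm (hα1 j) (not_lt.1 fun h => h1 ⟨j, h⟩)
      have hΛ : (∑ j, (lam j : ℂ)) ≠ 0 := by
        rw [← Complex.ofReal_sum]
        exact_mod_cast (Finset.sum_pos (fun j _ => hlam j) Finset.univ_nonempty).ne'
      have hder : ∀ t ∈ Ioo 0 T, -((∑ j, (lam j : ℂ))⁻¹ * b t) = deriv u t := fun t ht => by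
        have h := heqn t ht.1
        simp only [caputoDeriv, h1', if_true, ← Finset.sum_mul] at h
        rw [← mul_neg, ← h, inv_mul_cancel_left₀ hΛ]
      rw [intervalIntegrable_iff_integrableOn_Ioo_of_le hT.le]
      refine IntegrableOn.congr_fun ?_ hder measurableSet_Ioo
      have hbc : ContinuousOn (fun t => -((∑ j, (lam j : ℂ))⁻¹ * b t)) (Icc 0 T) :=
        (continuousOn_const.mul (hb.mono Icc_subset_Ici_self)).neg
      exact hbc.integrableOn_Icc.mono_set Ioo_subset_Icc_self
  have hint (T : ℝ) (hT : 0 < T) (j : J) := integral_caputoDeriv (hα1 j) hT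
    (hu.mono Icc_subset_Ici_self) (fun t ht => hd t ht.1) (hi T hT)
  have hue := integrableOn_exp_smul_of_bounded hμ hu huC
  have he0 : IntegrableOn (fun t => Real.exp (-μ * t) • u 0) (Ioi 0) :=
    integrableOn_exp_smul_of_bounded hμ continuousOn_const fun _ _ => le_rfl
  have hve : IntegrableOn (fun t => Real.exp (-μ * t) • (u t - u 0)) (Ioi 0) := by
    simp only [smul_sub]
    exact hue.sub he0
  have hbe := integrableOn_exp_smul_of_bounded hμ hb hbC
  have hV : ∫ t in Ioi (0 : ℝ), Real.exp (-μ * t) • (u t - u 0) =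
      (∫ t in Ioi (0 : ℝ), Real.exp (-μ * t) • u t) - μ⁻¹ • u 0 := by
    simp only [smul_sub]
    rw [integral_sub hue he0, integral_smul_const, integral_exp_mul_Ioi (by linarith)]
    simp
  set V := ∫ t in Ioi (0 : ℝ), Real.exp (-μ * t) • (u t - u 0) with hVdef
  have hD (j : J) : IntegrableOn (fun T => Real.exp (-μ * T) •
      ∫ t in Ioc 0 T, caputoDeriv (α j) u t) (Ioi 0) ∧
      ∫ T in Ioi (0 : ℝ), Real.exp (-μ * T) • (∫ t in Ioc 0 T, caputoDeriv (α j) u t) =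
        μ ^ (α j - 1) • V := by
    by_cases h1 : α j = 1
    · have hk : ∀ T ∈ Ioi (0 : ℝ), Real.exp (-μ * T) • (∫ t in Ioc 0 T, caputoDeriv (α j) u t) =
          Real.exp (-μ * T) • (u T - u 0) := fun T hT => by rw [(hint T hT j).2, if_pos h1]
      rw [integrableOn_congr_fun hk measurableSet_Ioi, setIntegral_congr_fun measurableSet_Ioi hk,
        h1, sub_self, Real.rpow_zero, one_smul]
      exact ⟨hve, rfl⟩
    · have hlt := lt_of_le_of_ne (hα1 j) h1
      have hk : ∀ T ∈ Ioi (0 : ℝ), Real.exp (-μ * T) • (∫ t in Ioc 0 T, caputoDeriv (α j) u t) =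
          Real.exp (-μ * T) • ∫ s in Ioc 0 T, powKer (1 - α j) (T - s) • (u s - u 0) :=
        fun T hT => by rw [(hint T hT j).2, if_neg h1]
      rw [integrableOn_congr_fun hk measurableSet_Ioi, setIntegral_congr_fun measurableSet_Ioi hk,
        ← neg_sub 1 (α j)]
      exact laplace_integral_powKer (by linarith) hμ hve
  have hB := (laplace_integral_powKer one_pos hμ hbe).2
  have hsum : ∀ T ∈ Ioi (0 : ℝ), Real.exp (-μ * T) • (∫ s in Ioc 0 T, powKer 1 (T - s) • b s) =
      -∑ j, (lam j : ℂ) * (Real.exp (-μ * T) • ∫ t in Ioc 0 T, caputoDeriv (α j) u t) :=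
    fun T hT => by
      have h1 : ∫ s in Ioc 0 T, powKer 1 (T - s) • b s =
          -∑ j, (lam j : ℂ) * ∫ t in Ioc 0 T, caputoDeriv (α j) u t := by
        simp only [← integral_const_mul]
        rw [← integral_finsetSum _ fun j _ => (hint T hT j).1.const_mul _, ← integral_neg,
          integral_Ioc_eq_integral_Ioo, integral_Ioc_eq_integral_Ioo]
        refine setIntegral_congr_fun measurableSet_Ioo fun s hs => ?_
        rw [heqn s hs.1, neg_neg, powKer_one (sub_pos.2 hs.2), one_smul]
      rw [h1, smul_neg, Finset.smul_sum]
      simp only [mul_smul_comm]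
  rw [setIntegral_congr_fun measurableSet_Ioi hsum, integral_neg,
    integral_finsetSum _ fun j _ => (hD j).1.const_mul _] at hB
  simp only [integral_const_mul, (hD _).2] at hB
  rw [← hV]
  have hB' : μ • (∑ j, (lam j : ℂ) * μ ^ (α j - 1) • V) =
      -∫ t in Ioi (0 : ℝ), Real.exp (-μ * t) • b t := by
    rw [← neg_eq_iff_eq_neg, ← smul_neg, hB, smul_smul, Real.rpow_neg_one, mul_inv_cancel₀ hμ.ne',
      one_smul]
  rw [← hB', symbol, Finset.smul_sum, Finset.sum_smul]
  refine Finset.sum_congr rfl fun j _ => ?_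
  rw [Real.rpow_sub_one hμ.ne']
  simp only [Complex.real_smul]
  have : (μ : ℂ) ≠ 0 := by exact_mod_cast hμ.ne'
  push_cast
  field_simp

end CaputoEquation

/-! ### Uniqueness for the Cauchy problem -/

section Uniqueness

variable {n m : ℕ} {α lam : Fin m → ℝ} {β c : ℝ}

/-- The frequency integral of the characteristic functions of a family of laws against `g`. -/
def freqPairing (w : ℝ≥0 → Measure (EuclideanSpace ℝ (Fin n)))
    (g : EuclideanSpace ℝ (Fin n) → ℂ) (t : ℝ) : ℂ :=
  ∫ ξ, g ξ * charFun (w t.toNNReal) ((2 * Real.pi) • ξ)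

/-- Smooth functions with compact support away from the origin. -/
structure IsFreqTest (g : EuclideanSpace ℝ (Fin n) → ℂ) : Prop where
  contDiff : ContDiff ℝ (⊤ : ℕ∞) g
  hasCompactSupport : HasCompactSupport g
  zero_notMem : 0 ∉ tsupport g

namespace IsFreqTest

variable {g : EuclideanSpace ℝ (Fin n) → ℂ}

lemma integrable (hg : IsFreqTest g) : Integrable g :=
  hg.contDiff.continuous.integrable_of_hasCompactSupport hg.hasCompactSupport

lemma mul_left (hg : IsFreqTest g) {q : EuclideanSpace ℝ (Fin n) → ℂ}
    (hq : ∀ ξ, ξ ≠ 0 → ContDiffAt ℝ (⊤ : ℕ∞) q ξ) : IsFreqTest fun ξ => q ξ * g ξ := by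
  refine ⟨contDiff_iff_contDiffAt.2 fun ξ => ?_, hg.hasCompactSupport.mul_left,
    fun h => hg.zero_notMem (tsupport_mul_subset_right h)⟩
  by_cases hξ : ξ ∈ tsupport g
  · exact (hq ξ (fun h => hg.zero_notMem (h ▸ hξ))).mul hg.contDiff.contDiffAt
  · have h0 : (fun ξ => q ξ * g ξ) =ᶠ[𝓝 ξ] fun _ => 0 := by
      filter_upwards [notMem_tsupport_iff_eventuallyEq.1 hξ] with x hx
      simp [hx]
    exact contDiffAt_const.congr_of_eventuallyEq h0

end IsFreqTest

lemma contDiffAt_freqSymbol {ξ : EuclideanSpace ℝ (Fin n)} (hξ : ξ ≠ 0) :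
    ContDiffAt ℝ (⊤ : ℕ∞) (freqSymbol β c) ξ := by
  unfold freqSymbol
  refine contDiffAt_const.mul (ContDiffAt.rpow_const_of_ne ?_ ?_)
  · exact contDiffAt_const.mul (contDiffAt_norm ℝ hξ)
  · exact mul_ne_zero (by positivity) (norm_ne_zero_iff.2 hξ)

lemma norm_freqPairing_le {w : ℝ≥0 → Measure (EuclideanSpace ℝ (Fin n))}
    (hw : ∀ t, IsProbabilityMeasure (w t)) {g : EuclideanSpace ℝ (Fin n) → ℂ} (hg : Integrable g)
    (t : ℝ) : ‖freqPairing w g t‖ ≤ ∫ ξ, ‖g ξ‖ := by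
  refine norm_integral_le_of_norm_le hg.norm (Eventually.of_forall fun ξ => ?_)
  rw [norm_mul]
  exact mul_le_of_le_one_right (norm_nonneg _) (norm_charFun_le_one _)

lemma freqPairing_zero {w : ℝ≥0 → Measure (EuclideanSpace ℝ (Fin n))} (hw : w 0 = Measure.dirac 0)
    (g : EuclideanSpace ℝ (Fin n) → ℂ) : freqPairing w g 0 = ∫ ξ, g ξ := by
  simp [freqPairing, hw, charFun_dirac]

lemma integrable_mul_charFun {μ : Measure (EuclideanSpace ℝ (Fin n))} [IsProbabilityMeasure μ]
    {g : EuclideanSpace ℝ (Fin n) → ℂ} (hg : Integrable g) :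
    Integrable fun ξ => g ξ * charFun μ ((2 * Real.pi) • ξ) :=
  hg.mul_bdd (c := 1) ((measurable_charFun.comp (measurable_const_smul _)).aestronglyMeasurable)
    (Eventually.of_forall fun _ => norm_charFun_le_one _)

variable {w : ℝ≥0 → Measure (EuclideanSpace ℝ (Fin n))}

lemma IsFreqTest.exists_pairing_eq (hw : ∀ t, IsProbabilityMeasure (w t)) (hβ : 0 < β)
    (hβ1 : β ≤ 1) {g : EuclideanSpace ℝ (Fin n) → ℂ} (hg : IsFreqTest g) :
    ∃ φ : 𝓢(EuclideanSpace ℝ (Fin n), ℂ), pairing w φ = freqPairing w g ∧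
      ∀ t : ℝ, (c : ℂ) ^ 2 * ∫ x, fracLaplacian β φ x ∂(w t.toNNReal) =
        freqPairing w (fun ξ => (freqSymbol β c ξ : ℂ) * g ξ) t := by
  set G : 𝓢(EuclideanSpace ℝ (Fin n), ℂ) := hg.hasCompactSupport.toSchwartzMap hg.contDiff with hG
  have hGg : ∀ ξ, G ξ = g ξ := fun ξ => rfl
  refine ⟨𝓕⁻ G, ?_, fun t => ?_⟩
  · ext t
    rw [pairing, integral_schwartz_eq, FourierTransform.fourier_fourierInv_eq]
    rfl
  · rw [integral_fracLaplacian hβ hβ1, FourierTransform.fourier_fourierInv_eq]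
    rfl

lemma IsCauchySolution.continuousOn_freqPairing (h : IsCauchySolution α lam β c w) (hβ : 0 < β)
    (hβ1 : β ≤ 1) {g : EuclideanSpace ℝ (Fin n) → ℂ} (hg : IsFreqTest g) :
    ContinuousOn (freqPairing w g) (Ici 0) := by
  obtain ⟨φ, hφ, -⟩ := hg.exists_pairing_eq (c := c) h.prob hβ hβ1
  exact hφ ▸ h.cont φ

lemma IsFreqTest.freqSymbol_mul {g : EuclideanSpace ℝ (Fin n) → ℂ} (hg : IsFreqTest g) :
    IsFreqTest fun ξ => (freqSymbol β c ξ : ℂ) * g ξ :=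
  hg.mul_left fun _ hξ =>
    Complex.ofRealCLM.contDiff.contDiffAt.comp _ (contDiffAt_freqSymbol hξ)

lemma IsCauchySolution.laplace_freqPairing [Nonempty (Fin m)] (h : IsCauchySolution α lam β c w)
    (hα : ∀ j, 0 < α j) (hα1 : ∀ j, α j ≤ 1) (hlam : ∀ j, 0 < lam j) (hβ : 0 < β)
    (hβ1 : β ≤ 1) {g : EuclideanSpace ℝ (Fin n) → ℂ} (hg : IsFreqTest g) {μ : ℝ} (hμ : 0 < μ) :
    symbol α lam μ • ((∫ t in Ioi (0 : ℝ), Real.exp (-μ * t) • freqPairing w g t) -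
        μ⁻¹ • ∫ ξ, g ξ) =
      -∫ t in Ioi (0 : ℝ), Real.exp (-μ * t) •
        freqPairing w (fun ξ => (freqSymbol β c ξ : ℂ) * g ξ) t := by
  have hkg := hg.freqSymbol_mul (β := β) (c := c)
  obtain ⟨φ, hφ, hψ⟩ := hg.exists_pairing_eq (c := c) h.prob hβ hβ1
  rw [← freqPairing_zero h.initial]
  refine laplace_caputo_equation hα hα1 hlam (h.continuousOn_freqPairing hβ hβ1 hg)
    (h.continuousOn_freqPairing hβ hβ1 hkg)
    (fun t _ => norm_freqPairing_le h.prob hg.integrable t)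
    (fun t _ => norm_freqPairing_le h.prob hkg.integrable t) (fun t ht j => ?_) (fun t ht => ?_) hμ
  · exact hφ ▸ h.hasCaputo φ t ht j
  · rw [← hψ, ← hφ, h.eqn φ t ht, neg_mul]

/-- The Laplace transform of a solution in the frequency variable. -/
lemma IsCauchySolution.laplace_freqPairing_eq [Nonempty (Fin m)] (h : IsCauchySolution α lam β c w)
    (hα : ∀ j, 0 < α j) (hα1 : ∀ j, α j ≤ 1) (hlam : ∀ j, 0 < lam j) (hβ : 0 < β)
    (hβ1 : β ≤ 1) {g : EuclideanSpace ℝ (Fin n) → ℂ} (hg : IsFreqTest g) {μ : ℝ} (hμ : 0 < μ) :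
    ∫ t in Ioi (0 : ℝ), Real.exp (-μ * t) • freqPairing w g t =
      symbol α lam μ • μ⁻¹ •
        ∫ ξ, ((symbol α lam μ + freqSymbol β c ξ : ℝ) : ℂ)⁻¹ * g ξ := by
  have hΨ : 0 < symbol α lam μ :=
    Finset.sum_pos (fun j _ => mul_pos (hlam j) (Real.rpow_pos_of_pos hμ _)) Finset.univ_nonempty
  have hne : ∀ ξ : EuclideanSpace ℝ (Fin n),
      ((symbol α lam μ + freqSymbol β c ξ : ℝ) : ℂ) ≠ 0 := fun ξ => by
    exact_mod_cast (add_pos_of_pos_of_nonneg hΨ (freqSymbol_nonneg β c ξ)).ne'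
  have hq : IsFreqTest fun ξ => ((symbol α lam μ + freqSymbol β c ξ : ℝ) : ℂ)⁻¹ * g ξ :=
    hg.mul_left fun ξ hξ => (Complex.ofRealCLM.contDiff.contDiffAt.comp _
      (contDiffAt_const.add (contDiffAt_freqSymbol hξ))).inv (hne ξ)
  have hkq := hq.freqSymbol_mul (β := β) (c := c)
  have hL := h.laplace_freqPairing hα hα1 hlam hβ hβ1 hq hμ
  have hsplit : ∀ t, freqPairing w g t =
      (symbol α lam μ : ℂ) * freqPairing w
        (fun ξ => ((symbol α lam μ + freqSymbol β c ξ : ℝ) : ℂ)⁻¹ * g ξ) t +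
      freqPairing w (fun ξ => (freqSymbol β c ξ : ℂ) *
        (((symbol α lam μ + freqSymbol β c ξ : ℝ) : ℂ)⁻¹ * g ξ)) t := fun t => by
    have := h.prob t.toNNReal
    unfold freqPairing
    rw [← integral_const_mul, ← integral_add ((integrable_mul_charFun hq.integrable).const_mul _)
      (integrable_mul_charFun hkq.integrable)]
    congr 1 with ξ
    have := hne ξ
    rw [Complex.ofReal_add] at this ⊢
    field_simp
  have hi1 := integrableOn_exp_smul_of_bounded hμ (h.continuousOn_freqPairing hβ hβ1 hq)
    (fun t _ => norm_freqPairing_le h.prob hq.integrable t)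
  have hi2 := integrableOn_exp_smul_of_bounded hμ (h.continuousOn_freqPairing hβ hβ1 hkq)
    (fun t _ => norm_freqPairing_le h.prob hkq.integrable t)
  simp only [hsplit, smul_add, ← mul_smul_comm]
  rw [integral_add (hi1.const_mul _) hi2, integral_const_mul]
  rw [smul_sub, sub_eq_iff_eq_add, Complex.real_smul] at hL
  rw [hL]
  ring

/-- Two solutions of the Cauchy problem agree. -/
theorem IsCauchySolution.unique [Nonempty (Fin m)] (h : IsCauchySolution α lam β c w)
    {w' : ℝ≥0 → Measure (EuclideanSpace ℝ (Fin n))} (h' : IsCauchySolution α lam β c w')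
    (hα : ∀ j, 0 < α j) (hα1 : ∀ j, α j ≤ 1) (hlam : ∀ j, 0 < lam j) (hβ : 0 < β)
    (hβ1 : β ≤ 1) (t : ℝ≥0) : w t = w' t := by
  have key : ∀ g : EuclideanSpace ℝ (Fin n) → ℂ, IsFreqTest g → ∀ t : ℝ, 0 < t →
      freqPairing w g t = freqPairing w' g t := fun g hg => by
    have hc := h.continuousOn_freqPairing hβ hβ1 hg
    have hc' := h'.continuousOn_freqPairing hβ hβ1 hg
    have hi (μ : ℝ) (hμ : 0 < μ) := integrableOn_exp_smul_of_bounded hμ hc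
      (fun t _ => norm_freqPairing_le h.prob hg.integrable t)
    have hi' (μ : ℝ) (hμ : 0 < μ) := integrableOn_exp_smul_of_bounded hμ hc'
      (fun t _ => norm_freqPairing_le h'.prob hg.integrable t)
    have hae := ae_eq_zero_of_laplace_eq_zero (a := 1)
      (f := fun t => freqPairing w g t - freqPairing w' g t)
      (by simp only [smul_sub]; exact (hi 1 one_pos).sub (hi' 1 one_pos)) (fun μ hμ => by
        have hμ0 : 0 < μ := one_pos.trans_le hμ
        simp only [smul_sub]
        rw [integral_sub (hi μ hμ0) (hi' μ hμ0),
          h.laplace_freqPairing_eq hα hα1 hlam hβ hβ1 hg hμ0,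
          h'.laplace_freqPairing_eq hα hα1 hlam hβ hβ1 hg hμ0, sub_self])
    have heq : EqOn (fun t => freqPairing w g t - freqPairing w' g t) (fun _ => 0) (Ioi 0) := by
      refine Measure.eqOn_open_of_ae_eq (μ := volume) ?_ isOpen_Ioi
        ((hc.sub hc').mono Ioi_subset_Ici_self) continuousOn_const
      rw [EventuallyEq, ae_restrict_iff' measurableSet_Ioi]
      exact hae
    exact fun t ht => sub_eq_zero.1 (heq ht)
  rcases eq_or_lt_of_le (zero_le (a := t)) with rfl | ht
  · rw [h.initial, h'.initial]
  have := h.prob t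
  have := h'.prob t
  refine Measure.ext_of_charFun (funext fun ζ => ?_)
  rcases eq_or_ne ζ 0 with rfl | hζ
  · simp [charFun_zero]
  have hcont : Continuous fun ξ : EuclideanSpace ℝ (Fin n) =>
      charFun (w t) ((2 * Real.pi) • ξ) - charFun (w' t) ((2 * Real.pi) • ξ) :=
    (continuous_charFun.comp (continuous_const_smul _)).sub
      (continuous_charFun.comp (continuous_const_smul _))
  have hae : ∀ᵐ ξ : EuclideanSpace ℝ (Fin n), ξ ∈ ({0}ᶜ : Set (EuclideanSpace ℝ (Fin n))) →
      charFun (w t) ((2 * Real.pi) • ξ) - charFun (w' t) ((2 * Real.pi) • ξ) = 0 := by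
    refine isOpen_compl_singleton.ae_eq_zero_of_integral_contDiff_smul_eq_zero
      (hcont.locallyIntegrable.locallyIntegrableOn _) fun g hg1 hg2 hg3 => ?_
    have hg : IsFreqTest fun ξ => (g ξ : ℂ) :=
      ⟨Complex.ofRealCLM.contDiff.comp hg1, hg2.comp_left Complex.ofReal_zero, fun h0 =>
        hg3 (tsupport_comp_subset Complex.ofReal_zero g h0) rfl⟩
    have hk := key _ hg t ht
    simp only [freqPairing, Real.toNNReal_coe] at hk
    simp only [Complex.real_smul, mul_sub]
    rw [integral_sub (integrable_mul_charFun hg.integrable) (integrable_mul_charFun hg.integrable),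
      hk, sub_self]
  have heq : EqOn (fun ξ : EuclideanSpace ℝ (Fin n) =>
      charFun (w t) ((2 * Real.pi) • ξ) - charFun (w' t) ((2 * Real.pi) • ξ)) (fun _ => 0)
      ({0}ᶜ : Set (EuclideanSpace ℝ (Fin n))) := by
    refine Measure.eqOn_open_of_ae_eq (μ := volume) ?_ isOpen_compl_singleton hcont.continuousOn
      continuousOn_const
    rw [EventuallyEq, ae_restrict_iff' isOpen_compl_singleton.measurableSet]
    exact hae
  have hfin := heq (show (2 * Real.pi)⁻¹ • ζ ∈ ({0}ᶜ : Set (EuclideanSpace ℝ (Fin n))) from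
    smul_ne_zero (by positivity) hζ)
  simp only [smul_smul] at hfin
  rwa [mul_inv_cancel₀ (by positivity), one_smul, sub_eq_zero] at hfin

end Uniqueness

/-! ### Continuity of càdlàg Brownian motion -/

section CadlagBrownian

/-- The largest point of the grid `2⁻ᵏ ℕ` strictly below `t`, times `2ᵏ`. -/
def dyadicIndex (t : ℝ≥0) (k : ℕ) : ℕ := ⌈t * 2 ^ k⌉₊ - 1

lemma dyadicIndex_lt {t : ℝ≥0} (ht : 0 < t) (k : ℕ) : (dyadicIndex t k : ℝ≥0) / 2 ^ k < t := by
  have h1 : 0 < ⌈t * 2 ^ k⌉₊ := Nat.ceil_pos.2 (by positivity)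
  rw [div_lt_iff₀ (by positivity)]
  exact Nat.lt_ceil.1 (by unfold dyadicIndex; omega)

lemma dyadicIndex_succ {t : ℝ≥0} (ht : 0 < t) (k : ℕ) : dyadicIndex t k + 1 = ⌈t * 2 ^ k⌉₊ := by
  have h1 : 0 < ⌈t * 2 ^ k⌉₊ := Nat.ceil_pos.2 (by positivity)
  unfold dyadicIndex
  omega

lemma le_dyadicIndex_succ {t : ℝ≥0} (ht : 0 < t) (k : ℕ) :
    t ≤ ((dyadicIndex t k + 1 : ℕ) : ℝ≥0) / 2 ^ k := by
  rw [dyadicIndex_succ ht, le_div_iff₀ (by positivity)]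
  exact Nat.le_ceil _

lemma tendsto_dyadicIndex_succ {t : ℝ≥0} (ht : 0 < t) :
    Tendsto (fun k => ((dyadicIndex t k + 1 : ℕ) : ℝ≥0) / 2 ^ k) atTop (𝓝 t) := by
  have h2 : Tendsto (fun k : ℕ => t + (1 / 2 : ℝ≥0) ^ k) atTop (𝓝 (t + 0)) :=
    tendsto_const_nhds.add (NNReal.tendsto_pow_atTop_nhds_zero_of_lt_one (by
      rw [← NNReal.coe_lt_coe]; norm_num))
  rw [add_zero] at h2
  refine tendsto_of_tendsto_of_tendsto_of_le_of_le tendsto_const_nhds h2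
    (fun k => le_dyadicIndex_succ ht k) fun k => ?_
  have h3 := (dyadicIndex_lt ht k).le
  simp only [Nat.cast_add, Nat.cast_one, add_div]
  rw [one_div_pow]
  gcongr

lemma tendsto_dyadicIndex {t : ℝ≥0} (ht : 0 < t) :
    Tendsto (fun k => (dyadicIndex t k : ℝ≥0) / 2 ^ k) atTop (𝓝 t) := by
  have h2 : Tendsto (fun k : ℕ => (1 / 2 : ℝ≥0) ^ k) atTop (𝓝 0) :=
    NNReal.tendsto_pow_atTop_nhds_zero_of_lt_one (by rw [← NNReal.coe_lt_coe]; norm_num)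
  have h3 := (tendsto_dyadicIndex_succ ht).sub h2
  rw [tsub_zero] at h3
  refine h3.congr fun k => ?_
  simp only [Nat.cast_add, Nat.cast_one, add_div, one_div_pow]
  exact add_tsub_cancel_right _ _

lemma dyadicIndex_lt_mul {t : ℝ≥0} (ht : 0 < t) {N : ℕ} (hN : t ≤ N) (k : ℕ) :
    dyadicIndex t k < N * 2 ^ k := by
  rw [← Nat.succ_le_iff, Nat.succ_eq_add_one, dyadicIndex_succ ht, Nat.ceil_le]
  push_cast
  gcongr

/-- A càdlàg function with vanishing dyadic increments is continuous. -/
lemma continuous_of_cadlag {f : ℝ≥0 → ℝ}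
    (hf : ∀ t, ContinuousWithinAt f (Ici t) t ∧ ∃ l, Tendsto f (𝓝[<] t) (𝓝 l))
    (hinc : ∀ N : ℕ, Tendsto (fun k : ℕ => ∑ i ∈ Finset.range (N * 2 ^ k),
      ‖f ((i + 1 : ℕ) / 2 ^ k) - f (i / 2 ^ k)‖ₑ ^ 4) atTop (𝓝 0)) : Continuous f := by
  refine continuous_iff_continuousAt.2 fun t => ?_
  rcases eq_or_lt_of_le (zero_le (a := t)) with rfl | ht
  · have := (hf 0).1
    rwa [show Ici (0 : ℝ≥0) = univ from Set.eq_univ_of_forall fun x => mem_Ici.2 zero_le,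
      continuousWithinAt_univ] at this
  obtain ⟨hr, l, hl⟩ := hf t
  suffices l = f t by
    refine continuousAt_iff_continuous_left'_right'.2 ⟨?_, hr.mono Ioi_subset_Ici_self⟩
    rw [ContinuousWithinAt, ← this]
    exact hl
  obtain ⟨N, hN⟩ := exists_nat_ge t
  have h1 : Tendsto (fun k => f ((dyadicIndex t k : ℝ≥0) / 2 ^ k)) atTop (𝓝 l) :=
    hl.comp (tendsto_nhdsWithin_iff.2 ⟨tendsto_dyadicIndex ht,
      Eventually.of_forall fun k => dyadicIndex_lt ht k⟩)
  have h2 : Tendsto (fun k => f (((dyadicIndex t k + 1 : ℕ) : ℝ≥0) / 2 ^ k)) atTop (𝓝 (f t)) :=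
    hr.tendsto.comp (tendsto_nhdsWithin_iff.2 ⟨tendsto_dyadicIndex_succ ht,
      Eventually.of_forall fun k => le_dyadicIndex_succ ht k⟩)
  have h3 : Tendsto (fun k => ‖f (((dyadicIndex t k + 1 : ℕ) : ℝ≥0) / 2 ^ k) -
      f ((dyadicIndex t k : ℝ≥0) / 2 ^ k)‖ₑ ^ 4) atTop (𝓝 (‖f t - l‖ₑ ^ 4)) :=
    (ENNReal.continuous_pow 4).continuousAt.tendsto.comp (h2.sub h1).enorm
  have h4 : Tendsto (fun k => ‖f (((dyadicIndex t k + 1 : ℕ) : ℝ≥0) / 2 ^ k) -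
      f ((dyadicIndex t k : ℝ≥0) / 2 ^ k)‖ₑ ^ 4) atTop (𝓝 0) := by
    refine tendsto_of_tendsto_of_tendsto_of_le_of_le tendsto_const_nhds (hinc N)
      (fun k => zero_le) fun k => ?_
    exact Finset.single_le_sum (f := fun i : ℕ => ‖f (((i + 1 : ℕ) : ℝ≥0) / 2 ^ k) -
      f ((i : ℝ≥0) / 2 ^ k)‖ₑ ^ 4) (fun i _ => zero_le)
      (Finset.mem_range.2 (dyadicIndex_lt_mul ht hN k))
  have h5 := tendsto_nhds_unique h3 h4
  rw [pow_eq_zero_iff (by norm_num), enorm_eq_zero, sub_eq_zero] at h5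
  exact h5.symm

variable {Ω : Type*} [MeasurableSpace Ω] {P : Measure Ω} {B : ℝ≥0 → Ω → ℝ}

lemma ProbabilityTheory.IsPreBrownianReal.lintegral_enorm_sub_pow (hB : IsPreBrownianReal B P) (s t : ℝ≥0) :
    ∫⁻ ω, ‖B (s + t) ω - B s ω‖ₑ ^ 4 ∂P =
      (t : ENNReal) ^ 2 * ∫⁻ x, ‖x‖ₑ ^ 4 ∂(gaussianReal 0 1) := by
  have h1 := (hB.hasLaw_sub (s + t) s).lintegral_comp (f := fun x => ‖x‖ₑ ^ 4) (by fun_prop)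
  have h2 : nndist (s + t).1 s.1 = t := by
    ext
    rw [coe_nndist, Real.dist_eq]
    show |((s + t : ℝ≥0) : ℝ) - (s : ℝ)| = t
    rw [NNReal.coe_add, add_sub_cancel_left, abs_of_nonneg t.coe_nonneg]
  have h3 := gaussianReal_map_const_mul (μ := 0) (v := 1) (√(t : ℝ))
  have h4 : NNReal.mk (√(t : ℝ) ^ 2) (sq_nonneg _) * 1 = t := by
    ext
    simp
  rw [h4, mul_zero] at h3
  simp only [Pi.sub_apply] at h1
  rw [h1, h2, ← h3, lintegral_map (by fun_prop) (by fun_prop), ← lintegral_const_mul _ (by fun_prop)]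
  refine lintegral_congr fun x => ?_
  rw [enorm_mul, mul_pow]
  congr 1
  rw [Real.enorm_of_nonneg (Real.sqrt_nonneg _), ← ENNReal.ofReal_pow (Real.sqrt_nonneg _),
    show √(t : ℝ) ^ 4 = (t : ℝ) ^ 2 by
      rw [show (4 : ℕ) = 2 * 2 by norm_num, pow_mul, Real.sq_sqrt t.coe_nonneg],
    ENNReal.ofReal_pow t.coe_nonneg, ENNReal.ofReal_coe_nnreal]

/-- A càdlàg pre-Brownian motion is a Brownian motion. -/
theorem ProbabilityTheory.IsPreBrownianReal.isBrownianReal_of_cadlag (hB : IsPreBrownianReal B P)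
    (hm : ∀ t, AEMeasurable (B t) P)
    (hc : ∀ᵐ ω ∂P, ∀ t, ContinuousWithinAt (fun s => B s ω) (Ici t) t ∧
      ∃ l, Tendsto (fun s => B s ω) (𝓝[<] t) (𝓝 l)) : IsBrownianReal B P := by
  refine ⟨hB, ?_⟩
  set C := ∫⁻ x, ‖x‖ₑ ^ 4 ∂(gaussianReal 0 1) with hC
  have hCtop : C ≠ ⊤ := by
    have h := (memLp_id_gaussianReal (μ := 0) (v := 1) 4).eLpNorm_lt_top
    have h4 := eLpNorm_lt_top_iff_lintegral_rpow_enorm_lt_top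
      (f := (id : ℝ → ℝ)) (μ := gaussianReal 0 1) (p := ((4 : ℝ≥0) : ENNReal))
      (by norm_num) ENNReal.coe_ne_top
    have h5 := h4.1 h
    refine ne_of_lt (lt_of_le_of_lt (le_of_eq ?_) h5)
    rw [hC]
    refine lintegral_congr fun x => ?_
    rw [ENNReal.coe_toReal]
    rw [show ((4 : ℝ≥0) : ℝ) = ((4 : ℕ) : ℝ) by norm_num, ENNReal.rpow_natCast]
    rfl
  have hN : ∀ N : ℕ, ∀ᵐ ω ∂P, Tendsto (fun k : ℕ => ∑ i ∈ Finset.range (N * 2 ^ k),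
      ‖B ((i + 1 : ℕ) / 2 ^ k) ω - B (i / 2 ^ k) ω‖ₑ ^ 4) atTop (𝓝 0) := fun N => by
    have hmeas : ∀ s t, AEMeasurable (fun ω => ‖B s ω - B t ω‖ₑ ^ 4) P := fun s t =>
      ((hm s).sub (hm t)).enorm.pow_const 4
    have hterm : ∀ k i : ℕ, ∫⁻ ω, ‖B ((i + 1 : ℕ) / 2 ^ k) ω - B (i / 2 ^ k) ω‖ₑ ^ 4 ∂P =
        ((1 / 2 : ENNReal) ^ k) ^ 2 * C := fun k i => by
      have := hB.lintegral_enorm_sub_pow (i / 2 ^ k) (1 / 2 ^ k)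
      rw [← add_div] at this
      rw [Nat.cast_add, Nat.cast_one, this]
      congr 2
      rw [ENNReal.coe_div (by positivity)]
      simp [ENNReal.inv_pow]
    have hint : ∫⁻ ω, ∑' k : ℕ, ∑ i ∈ Finset.range (N * 2 ^ k),
        ‖B ((i + 1 : ℕ) / 2 ^ k) ω - B (i / 2 ^ k) ω‖ₑ ^ 4 ∂P ≠ ⊤ := by
      rw [lintegral_tsum fun k => Finset.aemeasurable_fun_sum _ fun i _ => hmeas _ _]
      have hk : ∀ k : ℕ, ∫⁻ ω, ∑ i ∈ Finset.range (N * 2 ^ k),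
          ‖B ((i + 1 : ℕ) / 2 ^ k) ω - B (i / 2 ^ k) ω‖ₑ ^ 4 ∂P =
          (N * C) * (1 / 2 : ENNReal) ^ k := fun k => by
        rw [lintegral_finsetSum' _ fun i _ => hmeas _ _]
        simp only [hterm, Finset.sum_const, Finset.card_range, nsmul_eq_mul]
        have h2 : (2 : ENNReal) ^ k * (1 / 2 : ENNReal) ^ k = 1 := by
          rw [← mul_pow, one_div, ENNReal.mul_inv_cancel (by norm_num) (by norm_num), one_pow]
        push_cast
        calc _ = (N * C) * ((2 : ENNReal) ^ k * (1 / 2 : ENNReal) ^ k) * (1 / 2 : ENNReal) ^ k := by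
              ring
          _ = _ := by rw [h2, mul_one]
      simp only [hk]
      rw [ENNReal.tsum_mul_left, ENNReal.tsum_geometric]
      refine ENNReal.mul_ne_top (ENNReal.mul_ne_top (ENNReal.natCast_ne_top N) hCtop) ?_
      simp
    have hfin := ae_lt_top' (AEMeasurable.tsum fun k =>
      Finset.aemeasurable_fun_sum _ fun i _ => hmeas _ _) hint
    filter_upwards [hfin] with ω hω
    exact ENNReal.tendsto_atTop_zero_of_tsum_ne_top hω.ne
  filter_upwards [hc, ae_all_iff.2 hN] with ω h1 h2
  exact continuous_of_cadlag h1 h2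

end CadlagBrownian

/-! ### The isotropic stable process of index `2` -/

section IsotropicBrownian

variable {Ω : Type*} [MeasurableSpace Ω] {P : Measure Ω} [IsProbabilityMeasure P] {n : ℕ}
  {S : ℝ≥0 → Ω → EuclideanSpace ℝ (Fin n)}

lemma IsIsotropicStable.hasLaw_inner (hS : IsIsotropicStable 1 S P)
    (v : EuclideanSpace ℝ (Fin n)) (t : ℝ≥0) :
    HasLaw (fun ω => inner ℝ v (S t ω)) (gaussianReal 0 (2 * t * ‖v‖₊ ^ 2)) P := by
  have hm : Measurable fun ω => inner ℝ v (S t ω) :=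
    (by fun_prop : Measurable fun x : EuclideanSpace ℝ (Fin n) => inner ℝ v x).comp
      (hS.measurable t)
  have : IsProbabilityMeasure (P.map fun ω => inner ℝ v (S t ω)) :=
    Measure.isProbabilityMeasure_map hm.aemeasurable
  refine ⟨hm.aemeasurable, Measure.ext_of_charFun (funext fun u => ?_)⟩
  have h := hS.charFun_map t (u • v)
  rw [charFun_apply, integral_map (hS.measurable t).aemeasurable
    (by fun_prop : Continuous fun x : EuclideanSpace ℝ (Fin n) =>
      Complex.exp ((inner ℝ x (u • v) : ℝ) * Complex.I)).aestronglyMeasurable] at h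
  rw [charFun_gaussianReal, charFun_apply, integral_map hm.aemeasurable
    (by fun_prop : Continuous fun x : ℝ =>
      Complex.exp ((inner ℝ x u : ℝ) * Complex.I)).aestronglyMeasurable]
  have hin : ∀ ω, inner ℝ (inner ℝ v (S t ω)) u = inner ℝ (S t ω) (u • v) := fun ω => by
    rw [real_inner_smul_right, real_inner_comm v, real_inner_comm]
    simp [mul_comm]
  simp only [hin]
  rw [h, mul_one, Real.rpow_two, norm_smul, mul_pow, Real.norm_eq_abs, sq_abs, Complex.ofReal_exp]
  congr 1
  push_cast
  ring

lemma IsIsotropicStable.hasGaussianLaw (hS : IsIsotropicStable 1 S P) (t : ℝ≥0) :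
    HasGaussianLaw (S t) P := by
  refine ⟨isGaussian_of_map_eq_gaussianReal fun L => ⟨0,
    2 * t * ‖(InnerProductSpace.toDual ℝ _).symm L‖₊ ^ 2, ?_⟩⟩
  rw [Measure.map_map L.measurable (hS.measurable t), ← (hS.hasLaw_inner _ t).map_eq]
  congr 1
  ext ω
  simp

lemma IsIsotropicStable.isGaussianProcess (hS : IsIsotropicStable 1 S P) :
    IsGaussianProcess S P :=
  hS.indep.isGaussianProcess hS.hasGaussianLaw hS.zero

lemma IsIsotropicStable.hasIndepIncrements_coord (hS : IsIsotropicStable 1 S P) (i : Fin n) :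
    HasIndepIncrements (fun t ω => S t ω i) P :=
  hS.indep.map (EuclideanSpace.proj (𝕜 := ℝ) i)

lemma IsIsotropicStable.memLp_coord (hS : IsIsotropicStable 1 S P) (i : Fin n) (t : ℝ≥0) :
    MemLp (fun ω => S t ω i) 2 P :=
  ((hS.hasGaussianLaw t).map (EuclideanSpace.proj (𝕜 := ℝ) i)).memLp_two

lemma IsIsotropicStable.covariance_coord_self_time (hS : IsIsotropicStable 1 S P) {i j : Fin n}
    (hij : i ≠ j) (t : ℝ≥0) : cov[fun ω => S t ω i, fun ω => S t ω j; P] = 0 := by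
  have hvar (v : EuclideanSpace ℝ (Fin n)) :
      Var[fun ω => inner ℝ v (S t ω); P] = 2 * t * ‖v‖ ^ 2 := by
    rw [(hS.hasLaw_inner v t).variance_eq, variance_id_gaussianReal]
    simp
  have hi := hvar (EuclideanSpace.single i 1)
  have hj := hvar (EuclideanSpace.single j 1)
  have hs := hvar (EuclideanSpace.single i 1 + EuclideanSpace.single j 1)
  have hn : ‖(EuclideanSpace.single i 1 + EuclideanSpace.single j 1 :
      EuclideanSpace ℝ (Fin n))‖ ^ 2 = 2 := by
    rw [norm_add_sq_real]
    rw [EuclideanSpace.inner_single_left]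
    simp [hij]
    norm_num
  rw [hn] at hs
  simp only [inner_add_left, EuclideanSpace.inner_single_left, map_one, one_mul,
    PiLp.norm_single, norm_one, one_pow, mul_one] at hi hj hs
  rw [variance_fun_add (hS.memLp_coord i t) (hS.memLp_coord j t), hi, hj] at hs
  linarith

lemma IsIsotropicStable.indepFun_coord_increment (hS : IsIsotropicStable 1 S P) (i j : Fin n)
    {s t : ℝ≥0} (hst : s ≤ t) :
    IndepFun (fun ω => S s ω i) (fun ω => S t ω j - S s ω j) P :=
  (hS.indep.indepFun_eval_sub zero_le hst hS.zero).comp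
    (φ := fun x : EuclideanSpace ℝ (Fin n) => x i)
    (ψ := fun x : EuclideanSpace ℝ (Fin n) => x j) (by fun_prop) (by fun_prop)

lemma IsIsotropicStable.covariance_coord (hS : IsIsotropicStable 1 S P) {i j : Fin n}
    (hij : i ≠ j) (s t : ℝ≥0) : cov[fun ω => S s ω i, fun ω => S t ω j; P] = 0 := by
  wlog hst : s ≤ t generalizing s t i j
  · rw [covariance_comm]
    exact this hij.symm t s (le_of_not_ge hst)
  have h2 : (fun ω => S t ω j) = (fun ω => S s ω j) + fun ω => S t ω j - S s ω j := by
    ext ω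
    simp
  have hsub : MemLp (fun ω => S t ω j - S s ω j) 2 P :=
    (hS.memLp_coord j t).sub (hS.memLp_coord j s)
  rw [h2, covariance_add_right (hS.memLp_coord i s) (hS.memLp_coord j s) hsub,
    hS.covariance_coord_self_time hij, (hS.indepFun_coord_increment i j hst).covariance_eq_zero
      (hS.memLp_coord i s) hsub, add_zero]

/-- The isotropic stable process of index `2` is the Brownian motion with generator `Δ`. -/
theorem IsIsotropicStable.isBrownianLaplace (hS : IsIsotropicStable 1 S P) :
    IsBrownianLaplace S P := by
  refine ⟨fun i => ?_, ?_⟩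
  · have hpre : IsPreBrownianReal (fun t ω => (√2)⁻¹ * S t ω i) P := by
      refine HasIndepIncrements.isPreBrownianReal_of_hasLaw (fun t => ?_)
        ((hS.hasIndepIncrements_coord i).smul (√2)⁻¹)
      have h := hS.hasLaw_inner (EuclideanSpace.single i (√2)⁻¹) t
      have hv : 2 * t * ‖(EuclideanSpace.single i (√2)⁻¹ : EuclideanSpace ℝ (Fin n))‖₊ ^ 2 = t := by
        ext
        simp
        rw [mul_comm 2, mul_assoc, mul_inv_cancel₀ (by norm_num), mul_one]
      rw [hv] at h
      simpa [EuclideanSpace.inner_single_left] using h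
    refine hpre.isBrownianReal_of_cadlag (fun t => ?_) ?_
    · exact ((by fun_prop : Measurable fun x : EuclideanSpace ℝ (Fin n) =>
        (√2)⁻¹ * x i).comp (hS.measurable t)).aemeasurable
    · have hcont : Continuous fun x : EuclideanSpace ℝ (Fin n) => (√2)⁻¹ * x i := by fun_prop
      filter_upwards [hS.paths] with ω h t
      obtain ⟨h1, l, h2⟩ := h t
      exact ⟨(hcont.tendsto _).comp h1, _, (hcont.tendsto l).comp h2⟩
  · have hG : IsGaussianProcess (fun (p : (_ : Fin n) × ℝ≥0) ω => S p.2 ω p.1) P :=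
      hS.isGaussianProcess.of_isGaussianProcess fun p =>
        ⟨{p.2}, (EuclideanSpace.proj (𝕜 := ℝ) p.1).comp
          (ContinuousLinearMap.proj ⟨p.2, Finset.mem_singleton_self _⟩), fun ω => rfl⟩
    exact hG.iIndepFun_of_covariance_eq_zero (X := fun i t ω => S t ω i)
      (fun i t => (hS.memLp_coord i t).aemeasurable)
      fun i j hij s t => hS.covariance_coord hij s t

end IsotropicBrownian

end

theorem theorem3p1 {Ω : Type*} [MeasurableSpace Ω] (P : Measure Ω) [IsProbabilityMeasure P]
    (n m r : ℕ) (hm : 0 < m) (ν lam : Fin m → ℝ) (β c : ℝ)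
    (hν : ∀ j, 0 < ν j ∧ ν j ≤ 1) (hlam : ∀ j, 0 < lam j)
    (hβ : 0 < β ∧ β ≤ 1) (hc : 0 < c)
    (S : ℝ≥0 → Ω → EuclideanSpace ℝ (Fin n)) (H : Fin m → Fin r → ℝ≥0 → Ω → ℝ≥0)
    (hS : IsIsotropicStable β S P)
    (hH : ∀ j i, IsStableSubordinator (ν j) (H j i) P)
    (hHindep : iIndepFun (fun (p : Fin m × Fin r) ω (t : ℝ≥0) => H p.1 p.2 t ω) P)
    (hSH : IndepFun (fun ω (t : ℝ≥0) => S t ω)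
      (fun ω (p : Fin m × Fin r) (t : ℝ≥0) => H p.1 p.2 t ω) P) :
    -- the law of `S (c² 𝔏(t))` solves the Cauchy problem
    IsCauchySolution (fun j => ν j ^ r) lam β c
      (fun t => P.map (subordinated ν lam c S H t)) ∧
    -- it is the only solution
    (∀ w : ℝ≥0 → Measure (EuclideanSpace ℝ (Fin n)),
      IsCauchySolution (fun j => ν j ^ r) lam β c w →
        ∀ t, w t = P.map (subordinated ν lam c S H t)) ∧
    -- for `β = 1` the process `S` is the Brownian motion
    (β = 1 → IsBrownianLaplace S P) := by
  have hν0 : ∀ j, 0 < ν j := fun j => (hν j).1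
  have hi : iIndep (fun p : Fin m × Fin r => processSigma (H p.1 p.2)) P := hHindep.iIndep
  have hsol := isCauchySolution_subordinated (c := c) hm hν hlam hβ hS hH hi
    (indep_processSigma_of_indepFun hSH)
  refine ⟨hsol, fun w hw t => ?_, fun h1 => ?_⟩
  · have : Nonempty (Fin m) := ⟨⟨0, hm⟩⟩
    exact hw.unique hsol (fun j => pow_pos (hν0 j) r)
      (fun j => pow_le_one₀ (hν0 j).le (hν j).2) hlam hβ.1 hβ.2 t
  · subst h1
    exact hS.isBrownianLaplace
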